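/- **Theorem (solution formula for the half-space Stokes system).** Let $n\ge 2$, $\mathbb{R}^n_+=\{(x',x_n): x'\in\mathbb{R}^{n-1},\ x_n>0\}$, and let $\widehat{\cdot}$ be the Fourier transform in $x'$ with kernel $e^{-ix'\cdot\xi'}$. Distributions in $x'$ are taken modulo polynomials: they are tested with Schwartz functions whose Fourier transform has compact support in $\mathbb{R}^{n-1}\setminus\{0\}$, and are of finite order on each annulus $r\le|\xi'|\le R$ (this includes $\mathscr S'(\mathbb{R}^{n-1})/\mathscr P(\mathbb{R}^{n-1})$). A weakly measurable curve $y\mapsto f(y)$ of such functionals, $y\in I$, is called *tame* on $I$ if for each annulus there are a Schwartz norm $\|\cdot\|_N$ and a function $g$ on $I$ with $\int_I e^{-\varepsilon|y|}g(y)\,dy<\infty$ for all $\varepsilon>0$ such that, for a.e. $y\in I$, $|\langle f(y),\varphi\rangle|\le g(y)\|\varphi\|_N$ for all test functions $\varphi$ with frequencies in the annulus. Let $\mathcal R_\ell=\partial_{x_\ell}/|\nabla'|$, $\mathcal R'=(\mathcal R_1,\dots,\mathcal R_{n-1})$, and for $a=(a',a_n)$ put $$(\mathcal U^{\rm boundary})'[a](x)=e^{-x_n|\nabla'|}\big[a'+\mathcal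 R'(x_n\nabla'\cdot a')-x_n\nabla' a_n\big](x'),$$ $$\mathcal U^{\rm boundary}_n[a](x)=e^{-x_n|\nabla'|}\big[(1+x_n|\nabla'|)a_n-x_n\nabla'\cdot a'\big](x').$$ Let $K^{(1)}=e^{-|\xi'||z|}$, $K^{(2)}=\operatorname{sgn}(z)e^{-|\xi'||z|}$, $K^{(3)}=(1+|\xi'||z|)e^{-|\xi'||z|}$, $K^{(4)}=|\xi'|z\,e^{-|\xi'||z|}$, $K^{(5)}=(1-|\xi'||z|)e^{-|\xi'||z|}$ and $$\mathcal L^{(j,\pm)}[f](x)=\int_0^\infty\big(K^{(j)}(D',x_n-y_n)\pm K^{(j)}(D',x_n+y_n)\big)f(x',y_n)\,dy_n .$$ For a tensor $F=\{F_{k,\ell}\}_{1\le k,\ell\le n}$ on $\mathbb{R}^n_+$ define, for $x_n\in\mathbb{R}$ and $k=1,\dots,n-1$ (sums over $1,\dots,n-1$), $$u^{\rm w}_k[F]=\tfrac12\sum_m\mathcal R_m\mathcal L^{(1,+)}[F_{k,m}]-\tfrac12\mathcal L^{(2,-)}[F_{k,n}]+\tfrac14\sum_{\ell,m}\mathcal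 R_k\mathcal R_\ell\mathcal R_m\mathcal L^{(3,+)}[F_{\ell,m}]-\tfrac14\sum_\ell\mathcal R_k\mathcal R_\ell\big(\mathcal L^{(4,+)}[F_{n,\ell}]+\mathcal L^{(4,-)}[F_{\ell,n}]\big)-\tfrac14\mathcal R_k\mathcal L^{(5,-)}[F_{n,n}],$$ $$u^{\rm w}_n[F]=\tfrac14\sum_\ell\mathcal R_\ell\mathcal L^{(3,+)}[F_{n,\ell}]-\tfrac14\sum_{\ell,m}\mathcal R_\ell\mathcal R_m\mathcal L^{(4,+)}[F_{\ell,m}]-\tfrac14\mathcal L^{(4,-)}[F_{n,n}]-\tfrac14\sum_\ell\mathcal R_\ell\mathcal L^{(5,-)}[F_{\ell,n}],$$ and $\mathcal U^{\rm force}[F]=u^{\rm w}[F]-\mathcal U^{\rm boundary}[u^{\rm w}[F](\cdot,0)]$. A solution means a pair $(u,p)$ satisfying the equations in the sense of distributions (modulo polynomials in $x'$), where $u$ is tame and weakly continuous in $x_n$, and $p$ is dominated as above with $g$ only locally integrable in $x_n$. Let $a$ be a vector of such functionals on $\mathbb{R}^{n-1}$ and let all entries of $F$ be tame on $(0,\infty)$.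 Write $(\operatorname{div}F)_k=\sum_m\partial_mF_{k,m}$. Then: 1. Let $F^{\rm w}$ be the extension of $F$ to $\mathbb{R}^n$ for which $F_{k,\ell}$ ($\ell<n$) is even and $F_{k,n}$ is odd in $x_n$. With some pressure, $u^{\rm w}[F]$ solves $-\Delta u+\nabla p=\operatorname{div}F^{\rm w}$, $\operatorname{div}u=0$ on $\mathbb{R}^n$, and every solution has velocity $u^{\rm w}[F]$. 2. With some pressure, $u=\mathcal U^{\rm boundary}[a]+\mathcal U^{\rm force}[F]$ solves $-\Delta u+\nabla p=\operatorname{div}F$, $\operatorname{div}u=0$ in $\mathbb{R}^n_+$, with $u(\cdot,x_n)\to a$ weakly as $x_n\downarrow0$, and every solution has this velocity. 3. Let $u$ be a vector field of functions on $\mathbb{R}^n_+$ that is absolutely integrable against all test functions for each $x_n>0$, with $u\otimes u$ so for a.e. $x_n>0$ and tame on $(0,\infty)$. Then $u$, with some pressure, solves the Navier–Stokes problem $-\Delta u+\operatorname{div}(u\otimes u)+\nabla p=\operatorname{div}F$, $\operatorname{div}u=0$ in $\mathbb{R}^n_+$, $u(\cdot,x_n)\to a$ weakly as $x_n\downarrow0$,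 if and only if $u=\mathcal U^{\rm boundary}[a]+\mathcal U^{\rm force}[F-u\otimes u]$ for all $x_n>0$. -/

import Mathlib

open scoped FourierTransform SchwartzMap ContDiff

noncomputable section

namespace HalfSpaceStokes

open MeasureTheory Set Filter Topology

/-! Throughout, `d = n - 1` is the tangential dimension.  Coordinates of `ℝⁿ` are indexed by
`Fin (d + 1)`: the tangential ones are `Fin.castSucc j` with `j : Fin d`, the normal one is
`Fin.last d`. -/

/-- The tangential space `ℝ^{n-1}` with its Euclidean norm. -/
abbrev Tang (d : ℕ) : Type := EuclideanSpace ℝ (Fin d)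

/-- The Fourier transform of `φ` is supported in the annulus `r ≤ |ξ| ≤ R`. -/
def SpectrumIn {d : ℕ} (r R : ℝ) (φ : 𝓢(Tang d, ℂ)) : Prop :=
  ∀ ξ : Tang d, 𝓕 φ ξ ≠ 0 → r ≤ ‖ξ‖ ∧ ‖ξ‖ ≤ R

/-- Test functions on `ℝ^{n-1}`: the Schwartz functions whose Fourier transform has compact support
in `ℝ^{n-1} ∖ {0}`.  A tempered distribution vanishes on all of them exactly when its Fourier
transform is supported in `{0}`, that is, when it is a polynomial. -/
def TestSpace (d : ℕ) : Submodule ℂ 𝓢(Tang d, ℂ) where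
  carrier := {φ | ∃ r R : ℝ, 0 < r ∧ SpectrumIn r R φ}
  zero_mem' := ⟨1, 1, one_pos, fun ξ h => absurd (by simp [FourierTransform.fourier_zero]) h⟩
  add_mem' := by
    rintro φ ψ ⟨r, R, hr, h⟩ ⟨r', R', hr', h'⟩
    refine ⟨min r r', max R R', lt_min hr hr', fun ξ hξ => ?_⟩
    by_cases h0 : 𝓕 φ ξ = 0
    · have h1 : 𝓕 ψ ξ ≠ 0 := fun h1 => hξ (by simp [FourierTransform.fourier_add, h0, h1])
      exact ⟨(min_le_right _ _).trans (h' ξ h1).1, (h' ξ h1).2.trans (le_max_right _ _)⟩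
    · exact ⟨(min_le_left _ _).trans (h ξ h0).1, (h ξ h0).2.trans (le_max_left _ _)⟩
  smul_mem' := by
    rintro c φ ⟨r, R, hr, h⟩
    refine ⟨r, R, hr, fun ξ hξ => h ξ fun h0 => hξ ?_⟩
    simp [FourierTransform.fourier_smul, h0]

/-- Functionals on the test space.  The space `𝓢'(ℝ^{n-1}) / {polynomials}` embeds into it by
restriction, and equality of functionals is equality modulo polynomials. -/
abbrev TDist (d : ℕ) : Type := Module.Dual ℂ (TestSpace d)

/-- The Schwartz norm of order `N` of a test function. -/
def schwartzNorm {d : ℕ} (N : ℕ) (φ : TestSpace d) : ℝ :=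
  (Finset.Iic (N, N)).sup (schwartzSeminormFamily ℂ (Tang d) ℂ) (φ : 𝓢(Tang d, ℂ))

/-- `T` is a distribution: of finite order on each frequency annulus (equivalently, its Fourier
transform is a distribution on `ℝ^{n-1} ∖ {0}`).  The restriction of each tempered distribution
has this property. -/
def IsDistribution {d : ℕ} (T : TDist d) : Prop :=
  ∀ r R : ℝ, 0 < r → ∃ (N : ℕ) (C : ℝ), ∀ φ : TestSpace d,
    SpectrumIn r R (φ : 𝓢(Tang d, ℂ)) → ‖T φ‖ ≤ C * schwartzNorm N φ

/-- A weakly measurable curve of distributions `y ↦ f y`, `y ∈ I`, which on each frequency annulus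
is dominated in some Schwartz norm by a function `g` of `y` with the property `P`. -/
def IsDominated {d : ℕ} (I : Set ℝ) (P : (ℝ → ℝ) → Prop) (f : ℝ → TDist d) : Prop :=
  (∀ φ, AEStronglyMeasurable (fun y => f y φ) (volume.restrict I)) ∧
  ∀ r R : ℝ, 0 < r → ∃ (N : ℕ) (g : ℝ → ℝ), P g ∧
    ∀ᵐ y ∂volume.restrict I, ∀ φ : TestSpace d,
      SpectrumIn r R (φ : 𝓢(Tang d, ℂ)) → ‖f y φ‖ ≤ g y * schwartzNorm N φ

/-- Locally integrable curves of distributions on `I`. -/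
def IsLocInt {d : ℕ} (I : Set ℝ) (f : ℝ → TDist d) : Prop :=
  IsDominated I (fun g => LocallyIntegrableOn g I) f

/-- Integrable curves of distributions on `I` of subexponential growth at infinity: the dominating
functions satisfy `∫_I e^{-ε|y|} g(y) dy < ∞` for each `ε > 0`. -/
def IsTame {d : ℕ} (I : Set ℝ) (f : ℝ → TDist d) : Prop :=
  IsDominated I (fun g => ∀ ε : ℝ, 0 < ε → IntegrableOn (fun y => Real.exp (-ε * |y|) * g y) I) f

open Classical in
/-- The weak integral `∫ f dμ`, that is `φ ↦ ∫ ⟨f(y), φ⟩ dμ(y)` (zero unless all these integrals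
converge absolutely). -/
def weakIntegral {d : ℕ} {α : Type*} [MeasurableSpace α] (μ : Measure α) (f : α → TDist d) :
    TDist d :=
  if h : ∀ φ, Integrable (fun y => f y φ) μ then
    { toFun := fun φ => ∫ y, f y φ ∂μ
      map_add' := fun φ ψ => by
        simp only [map_add]
        exact integral_add (h φ) (h ψ)
      map_smul' := fun c φ => by
        simp only [map_smul, RingHom.id_apply]
        exact integral_smul c _ }
  else 0

/-! ### Tangential derivatives and Fourier multipliers -/

/-- A Fourier symbol on `ℝ^{n-1}`, smooth away from the origin. -/
structure Symb (d : ℕ) where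
  /-- the symbol as a function of the frequency -/
  toFun : Tang d → ℂ
  smooth : ContDiffOn ℝ ∞ toFun {0}ᶜ

/-- The symbol `ξ ↦ m(-ξ)`. -/
def Symb.reflect {d : ℕ} (m : Symb d) : Symb d where
  toFun := fun ξ => m.toFun (-ξ)
  smooth := m.smooth.comp contDiff_neg.contDiffOn (fun ξ hξ => by simpa using hξ)

/-- The function `ξ ↦ m(2πξ) 𝓕φ(ξ)` is smooth with compact support.  The factor `2π` translates
between the Fourier transform with kernel `e^{-2πi x·ξ}`, which is `𝓕` here, and the one with
kernel `e^{-i x·ξ}`, to which symbols refer. -/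
theorem symb_mul_fourier {d : ℕ} (m : Symb d) (φ : TestSpace d) :
    HasCompactSupport (fun ξ : Tang d =>
      m.toFun ((2 * Real.pi) • ξ) * 𝓕 (φ : 𝓢(Tang d, ℂ)) ξ) ∧
    ContDiff ℝ ∞ (fun ξ : Tang d =>
      m.toFun ((2 * Real.pi) • ξ) * 𝓕 (φ : 𝓢(Tang d, ℂ)) ξ) := by
  obtain ⟨r, R, hr, h⟩ := φ.2
  constructor
  · refine HasCompactSupport.intro (isCompact_closedBall (0 : Tang d) R) fun ξ hξ => ?_
    have : 𝓕 (φ : 𝓢(Tang d, ℂ)) ξ = 0 := by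
      by_contra h0
      exact hξ (by simpa using (h ξ h0).2)
    simp [this]
  · rw [contDiff_iff_contDiffAt]
    intro ξ
    by_cases h0 : ξ = 0
    · have hz : (fun ξ : Tang d => m.toFun ((2 * Real.pi) • ξ) * 𝓕 (φ : 𝓢(Tang d, ℂ)) ξ)
          =ᶠ[𝓝 ξ] fun _ => 0 := by
        filter_upwards [Metric.ball_mem_nhds ξ hr] with η hη
        have : 𝓕 (φ : 𝓢(Tang d, ℂ)) η = 0 := by
          by_contra h1
          rw [h0] at hη
          have h2 := (h η h1).1
          have h3 : ‖η‖ < r := by simpa using hη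
          linarith
        simp [this]
      exact contDiffAt_const.congr_of_eventuallyEq hz
    · have h2 : (2 * Real.pi) • ξ ≠ 0 := smul_ne_zero (by positivity) h0
      have hm : ContDiffAt ℝ ∞ m.toFun ((2 * Real.pi) • ξ) :=
        m.smooth.contDiffAt (isOpen_compl_singleton.mem_nhds h2)
      exact (hm.comp ξ (contDiff_const_smul (2 * Real.pi)).contDiffAt).mul
        (𝓕 (φ : 𝓢(Tang d, ℂ))).smooth'.contDiffAt

/-- The multiplier `m(D') = 𝓕⁻¹ m 𝓕` on test functions, as a Schwartz function. -/
def multSchwartz {d : ℕ} (m : Symb d) (φ : TestSpace d) : 𝓢(Tang d, ℂ) :=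
  𝓕⁻ ((symb_mul_fourier m φ).1.toSchwartzMap (symb_mul_fourier m φ).2)

theorem fourier_multSchwartz {d : ℕ} (m : Symb d) (φ : TestSpace d) (ξ : Tang d) :
    𝓕 (multSchwartz m φ) ξ = m.toFun ((2 * Real.pi) • ξ) * 𝓕 (φ : 𝓢(Tang d, ℂ)) ξ := by
  simp [multSchwartz, FourierTransform.fourier_fourierInv_eq]

theorem fourier_injective {d : ℕ} {φ ψ : 𝓢(Tang d, ℂ)} (h : ∀ ξ, 𝓕 φ ξ = 𝓕 ψ ξ) : φ = ψ := by
  have h1 : 𝓕 φ = 𝓕 ψ := by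
    ext ξ
    exact h ξ
  rw [← FourierTransform.fourierInv_fourier_eq (F := 𝓢(Tang d, ℂ)) φ, h1,
    FourierTransform.fourierInv_fourier_eq]

/-- The multiplier `m(D')` as an operator of the test space. -/
def multTest {d : ℕ} (m : Symb d) : TestSpace d →ₗ[ℂ] TestSpace d where
  toFun φ := ⟨multSchwartz m φ, by
    obtain ⟨r, R, hr, h⟩ := φ.2
    refine ⟨r, R, hr, fun ξ hξ => h ξ fun h0 => hξ ?_⟩
    rw [fourier_multSchwartz, h0, mul_zero]⟩
  map_add' φ ψ := by
    refine Subtype.ext (fourier_injective fun ξ => ?_)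
    simp only [Submodule.coe_add, FourierTransform.fourier_add, add_apply,
      fourier_multSchwartz, mul_add]
  map_smul' c φ := by
    refine Subtype.ext (fourier_injective fun ξ => ?_)
    simp only [Submodule.coe_smul, FourierTransform.fourier_smul, smul_apply,
      fourier_multSchwartz, smul_eq_mul, RingHom.id_apply]
    ring

/-- The Fourier multiplier `m(D')` on distributions: `⟨m(D')T, φ⟩ = ⟨T, m(-D')φ⟩`. -/
def mult {d : ℕ} (m : Symb d) : TDist d →ₗ[ℂ] TDist d := (multTest m.reflect).dualMap

/-- The partial derivative `∂_j` on test functions. -/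
def derivTest {d : ℕ} (j : Fin d) : TestSpace d →ₗ[ℂ] TestSpace d where
  toFun φ := ⟨LineDeriv.lineDerivOp (EuclideanSpace.single j (1 : ℝ)) (φ : 𝓢(Tang d, ℂ)), by
    obtain ⟨r, R, hr, h⟩ := φ.2
    refine ⟨r, R, hr, fun ξ hξ => h ξ fun h0 => hξ ?_⟩
    rw [SchwartzMap.fourier_lineDerivOp_eq, smul_apply,
      SchwartzMap.smulLeftCLM_apply_apply (by fun_prop)]
    simp [h0]⟩
  map_add' φ ψ := Subtype.ext (LineDeriv.lineDerivOp_add _ _ _)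
  map_smul' c φ := Subtype.ext (LineDeriv.lineDerivOp_smul _ _ _)

/-- The tangential derivative `∂_j` of distributions: `⟨∂_j T, φ⟩ = -⟨T, ∂_j φ⟩`. -/
def pderiv {d : ℕ} (j : Fin d) : TDist d →ₗ[ℂ] TDist d := -(derivTest j).dualMap

/-- The tangential divergence `∇' · T'`. -/
def tdiv {d : ℕ} (T : Fin (d + 1) → TDist d) : TDist d := ∑ j : Fin d, pderiv j (T j.castSucc)

theorem contDiffOn_norm_compl {d : ℕ} :
    ContDiffOn ℝ ∞ (fun ξ : Tang d => ‖ξ‖) {0}ᶜ :=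
  contDiffOn_id.norm ℝ (fun _ hx => hx)

/-- The symbol `ξ ↦ h(|ξ|)`. -/
def radial {d : ℕ} (h : ℝ → ℝ) (hh : ContDiff ℝ ∞ h) : Symb d where
  toFun := fun ξ => (h ‖ξ‖ : ℂ)
  smooth := (Complex.ofRealCLM.contDiff.comp hh).comp_contDiffOn contDiffOn_norm_compl

/-- `|∇'|`, the multiplier with symbol `|ξ|`. -/
def absGrad {d : ℕ} : TDist d →ₗ[ℂ] TDist d := mult (radial (fun ρ => ρ) contDiff_id)

/-- `e^{-t|∇'|}`, the multiplier with symbol `e^{-t|ξ|}`. -/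
def poisson {d : ℕ} (t : ℝ) : TDist d →ₗ[ℂ] TDist d :=
  mult (radial (fun ρ => Real.exp (-(t * ρ))) (by fun_prop))

/-- The symbol `iξ_j/|ξ|`. -/
def rieszSymb {d : ℕ} (j : Fin d) : Symb d where
  toFun := fun ξ => Complex.I * (ξ j : ℂ) / (‖ξ‖ : ℂ)
  smooth := by
    simp only [div_eq_mul_inv]
    refine (contDiffOn_const.mul ?_).mul (ContDiffOn.inv
      (Complex.ofRealCLM.contDiff.comp_contDiffOn contDiffOn_norm_compl) ?_)
    · exact Complex.ofRealCLM.contDiff.comp_contDiffOn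
        (EuclideanSpace.proj (𝕜 := ℝ) j).contDiff.contDiffOn
    · intro ξ hξ
      simpa using hξ

/-- The Riesz transform `R_j = ∂_j / |∇'|`. -/
def riesz {d : ℕ} (j : Fin d) : TDist d →ₗ[ℂ] TDist d := mult (rieszSymb j)

/-- `K⁽¹⁾(ξ, z) = e^{-|ξ||z|}`. -/
def K1 {d : ℕ} (z : ℝ) : Symb d := radial (fun ρ => Real.exp (-(ρ * |z|))) (by fun_prop)

/-- `K⁽²⁾(ξ, z) = sgn(z) e^{-|ξ||z|}`. -/
def K2 {d : ℕ} (z : ℝ) : Symb d :=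
  radial (fun ρ => Real.sign z * Real.exp (-(ρ * |z|))) (by fun_prop)

/-- `K⁽³⁾(ξ, z) = (1 + |ξ||z|) e^{-|ξ||z|}`. -/
def K3 {d : ℕ} (z : ℝ) : Symb d :=
  radial (fun ρ => (1 + ρ * |z|) * Real.exp (-(ρ * |z|))) (by fun_prop)

/-- `K⁽⁴⁾(ξ, z) = |ξ| z e^{-|ξ||z|}`. -/
def K4 {d : ℕ} (z : ℝ) : Symb d :=
  radial (fun ρ => ρ * z * Real.exp (-(ρ * |z|))) (by fun_prop)

/-- `K⁽⁵⁾(ξ, z) = (1 - |ξ||z|) e^{-|ξ||z|}`. -/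
def K5 {d : ℕ} (z : ℝ) : Symb d :=
  radial (fun ρ => (1 - ρ * |z|) * Real.exp (-(ρ * |z|))) (by fun_prop)

/-- `∫_0^∞ (K(D', x - y) + σ K(D', x + y)) f(y) dy`; the operator `ℒ^{(j,±)}` is the case
`K = K⁽ʲ⁾`, `σ = ±1`. -/
def Lop {d : ℕ} (K : ℝ → Symb d) (σ : ℂ) (f : ℝ → TDist d) (x : ℝ) : TDist d :=
  weakIntegral (volume.restrict (Ioi 0))
    (fun y => mult (K (x - y)) (f y) + σ • mult (K (x + y)) (f y))

/-! ### The explicit operators -/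

/-- The boundary operator at height `x`:
`U_k = e^{-x|∇'|}[a_k + R_k(x ∇'·a') - x ∂_k a_n]` for tangential `k`, and
`U_n = e^{-x|∇'|}[(1 + x|∇'|)a_n - x ∇'·a']`. -/
def boundaryOp {d : ℕ} (a : Fin (d + 1) → TDist d) (x : ℝ) : Fin (d + 1) → TDist d :=
  Fin.lastCases (motive := fun _ => TDist d)
    (poisson x (a (Fin.last d) + (x : ℂ) • absGrad (a (Fin.last d)) - (x : ℂ) • tdiv a))
    (fun k => poisson x (a k.castSucc + riesz k ((x : ℂ) • tdiv a)
      - (x : ℂ) • pderiv k (a (Fin.last d))))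

/-- The explicit whole-space velocity `u^w[F]` at height `x ∈ ℝ`. -/
def uWhole {d : ℕ} (F : ℝ → Fin (d + 1) → Fin (d + 1) → TDist d) (x : ℝ) :
    Fin (d + 1) → TDist d :=
  let n : Fin (d + 1) := Fin.last d
  Fin.lastCases (motive := fun _ => TDist d)
    ((1 / 4 : ℂ) • ∑ l : Fin d, riesz l (Lop K3 1 (fun y => F y n l.castSucc) x)
      - (1 / 4 : ℂ) • ∑ l : Fin d, ∑ m : Fin d,
          riesz l (riesz m (Lop K4 1 (fun y => F y l.castSucc m.castSucc) x))
      - (1 / 4 : ℂ) • Lop K4 (-1) (fun y => F y n n) x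
      - (1 / 4 : ℂ) • ∑ l : Fin d, riesz l (Lop K5 (-1) (fun y => F y l.castSucc n) x))
    (fun k =>
      (1 / 2 : ℂ) • ∑ m : Fin d, riesz m (Lop K1 1 (fun y => F y k.castSucc m.castSucc) x)
      - (1 / 2 : ℂ) • Lop K2 (-1) (fun y => F y k.castSucc n) x
      + (1 / 4 : ℂ) • ∑ l : Fin d, ∑ m : Fin d,
          riesz k (riesz l (riesz m (Lop K3 1 (fun y => F y l.castSucc m.castSucc) x)))
      - (1 / 4 : ℂ) • ∑ l : Fin d,
          riesz k (riesz l (Lop K4 1 (fun y => F y n l.castSucc) x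
            + Lop K4 (-1) (fun y => F y l.castSucc n) x))
      - (1 / 4 : ℂ) • riesz k (Lop K5 (-1) (fun y => F y n n) x))

/-- `U^force[F] = u^w[F] - U^boundary[u^w[F](·, 0)]`. -/
def forceOp {d : ℕ} (F : ℝ → Fin (d + 1) → Fin (d + 1) → TDist d) (x : ℝ) :
    Fin (d + 1) → TDist d :=
  uWhole F x - boundaryOp (uWhole F 0) x

/-- The extension `F^w` of the force tensor to `ℝⁿ`: the entries `F_{k,ℓ}`, `ℓ < n`, are extended
evenly and the entries `F_{k,n}` oddly in the normal variable. -/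
def extendForce {d : ℕ} (F : ℝ → Fin (d + 1) → Fin (d + 1) → TDist d) :
    ℝ → Fin (d + 1) → Fin (d + 1) → TDist d :=
  fun y k l => if 0 ≤ y then F y k l else if l = Fin.last d then -F (-y) k l else F (-y) k l

/-! ### Solutions -/

/-- Distributions in `(x', x_n)`, given by their values on products `θ(x_n) φ(x')`. -/
abbrev XDist (d : ℕ) : Type := (ℝ → ℝ) → TestSpace d → ℂ

/-- The distribution `∫ θ(y) ⟨f(y), φ⟩ dy` defined by a curve `f`. -/
def ofCurve {d : ℕ} (f : ℝ → TDist d) : XDist d := fun θ φ => ∫ y, (θ y : ℂ) * f y φ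

/-- The distributional derivatives `∂_1, …, ∂_n`. -/
def pd {d : ℕ} (m : Fin (d + 1)) (S : XDist d) : XDist d := fun θ φ =>
  Fin.lastCases (motive := fun _ => ℂ) (-S (deriv θ) φ) (fun j => -S θ (derivTest j φ)) m

/-- `-Δu + div N + ∇p = div F`, `div u = 0` in the sense of distributions on `ℝ^{n-1} × I` (modulo
polynomials in `x'`), where `(div F)_k = ∑_m ∂_m F_{k,m}`.  The tensor `N` is `0` for the Stokes
equations and `u ⊗ u` for the Navier-Stokes equations. -/
def SolvesOn {d : ℕ} (I : Set ℝ) (N F : ℝ → Fin (d + 1) → Fin (d + 1) → TDist d)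
    (u : ℝ → Fin (d + 1) → TDist d) (p : ℝ → TDist d) : Prop :=
  ∀ θ : ℝ → ℝ, ContDiff ℝ ∞ θ → HasCompactSupport θ → tsupport θ ⊆ I → ∀ φ : TestSpace d,
    (∀ k, -(∑ m, pd m (pd m (ofCurve fun y => u y k)) θ φ)
        + ∑ m, pd m (ofCurve fun y => N y k m) θ φ + pd k (ofCurve p) θ φ
      = ∑ m, pd m (ofCurve fun y => F y k m) θ φ) ∧
    ∑ m, pd m (ofCurve fun y => u y m) θ φ = 0

/-- `(u, p)` solves the system on `ℝ^{n-1} × I`, with a velocity that is weakly continuous and of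
subexponential growth in the normal variable and a pressure that is locally integrable in it. -/
def IsSolutionOn {d : ℕ} (I : Set ℝ) (N F : ℝ → Fin (d + 1) → Fin (d + 1) → TDist d)
    (u : ℝ → Fin (d + 1) → TDist d) (p : ℝ → TDist d) : Prop :=
  (∀ k, IsTame I fun y => u y k) ∧ (∀ k φ, ContinuousOn (fun y => u y k φ) I) ∧
  IsLocInt I p ∧ SolvesOn I N F u p

/-- Solution of the Stokes equations `-Δu + ∇p = div F`, `div u = 0` on `ℝⁿ`. -/
def IsWholeSpaceSolution {d : ℕ} (F : ℝ → Fin (d + 1) → Fin (d + 1) → TDist d)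
    (u : ℝ → Fin (d + 1) → TDist d) (p : ℝ → TDist d) : Prop :=
  IsSolutionOn univ 0 F u p

/-- Solution on the half space `x_n > 0` with Dirichlet boundary value `a`, attained weakly. -/
def IsHalfSpaceSolution {d : ℕ} (a : Fin (d + 1) → TDist d)
    (N F : ℝ → Fin (d + 1) → Fin (d + 1) → TDist d)
    (u : ℝ → Fin (d + 1) → TDist d) (p : ℝ → TDist d) : Prop :=
  IsSolutionOn (Ioi 0) N F u p ∧
    ∀ k φ, Tendsto (fun y => u y k φ) (𝓝[>] 0) (𝓝 (a k φ))

/-! ### Velocity fields that are functions -/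

/-- The distribution `φ ↦ ∫ f φ dx'` defined by a function `f` on `ℝ^{n-1}`. -/
def ofFun {d : ℕ} (f : Tang d → ℂ) : TDist d :=
  weakIntegral volume fun x =>
    f x • ((⟨⟨fun φ => (φ : 𝓢(Tang d, ℂ)) x, fun _ _ => rfl⟩, fun _ _ => rfl⟩ : TDist d))

/-- The integrals `∫ f φ dx'` converge absolutely. -/
def Pairable {d : ℕ} (f : Tang d → ℂ) : Prop :=
  ∀ φ : TestSpace d, Integrable fun x => f x * (φ : 𝓢(Tang d, ℂ)) x

/-- The velocity distribution of a vector field `v`, where `v y k x'` is `v_k(x', y)`. -/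
def velocity {d : ℕ} (v : ℝ → Fin (d + 1) → Tang d → ℂ) : ℝ → Fin (d + 1) → TDist d :=
  fun y k => ofFun (v y k)

/-- The tensor `v ⊗ v`. -/
def selfTensor {d : ℕ} (v : ℝ → Fin (d + 1) → Tang d → ℂ) :
    ℝ → Fin (d + 1) → Fin (d + 1) → TDist d :=
  fun y k l => ofFun fun x => v y k x * v y l x

/-- Vector fields on the half space for which `v` and `v ⊗ v` define distributions, the latter of
subexponential growth in the normal variable. -/
def IsAdmissible {d : ℕ} (v : ℝ → Fin (d + 1) → Tang d → ℂ) : Prop :=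
  (∀ y, 0 < y → ∀ k, Pairable (v y k)) ∧
  (∀ᵐ y ∂volume.restrict (Ioi (0 : ℝ)), ∀ k l, Pairable fun x => v y k x * v y l x) ∧
  ∀ k l, IsTame (Ioi 0) fun y => selfTensor v y k l

end HalfSpaceStokes

end

open HalfSpaceStokes

/-!
The tangential Fourier transform turns the Stokes system into ordinary differential equations in the
normal variable whose coefficients are the commuting multipliers `|∇'|` and `R_k`, with
`∂_k = R_k |∇'|` and `∑_k R_k² = -1`.  Test functions have frequencies in an annulus
`r ≤ |ξ| ≤ R`, `r > 0`.  On such functions `e^{-t|∇'|}` decays exponentially in `t` in each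
Schwartz norm (`schwartzNorm_expTest_le`), while tame curves grow subexponentially; every integral
converges and every limit at infinity is taken for this reason.

*Existence.*  On the whole line the operators `ℒ` are convolutions of the reflected source with
kernels `(c(z) + c₂(z)|∇'|) e^{-|z||∇'|}` (`Lop_eq_kconv`).  Integration by parts on both sides of
the diagonal differentiates these kernels (`hasWeakDeriv_pconv`) and gives a closed table of
derivatives for the five of them, from which the equations follow by algebra
(`solvesOn_wholeVelocity`).  The boundary flow has the form `e^{-x|∇'|}(a + x D)`, and it solves the
homogeneous equations with pressure `2 e^{-x|∇'|} D_n` (`solvesOn_boundaryOp`).  Subtracting the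
boundary flow of the trace error from the whole-space velocity solves the half-space problem.

*Uniqueness.*  By linearity a solution of the homogeneous system is to be studied.  Mollification in
the normal variable makes it smooth there and keeps the equations and the growth
(`isSmoothFlow_moll`).  A slowly growing solution of `V' = |∇'|V` on a half line vanishes, because
`V(x) = e^{-s|∇'|}V(x + s) → 0` as `s → ∞` (`eq_zero_of_wDerivAt_absGrad`).  This applies to
`P' + |∇'|P`, since the pressure is harmonic, and then to `W_k' + |∇'|W_k + ½ R_k P` and
`W_n' + |∇'|W_n - ½ P`.  The velocity thus satisfies a first-order system, the pressure is determined
by the divergence equation, and integration shows that the solution is the boundary flow of its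
values on each hyperplane (`IsSmoothFlow.velocity_add`).  In the half space these values tend to
zero at the boundary; in the whole space the first-order system has no nonzero slowly growing
solution on the line.

*Navier–Stokes.*  The nonlinear term `u ⊗ u` is tame by hypothesis, so that it can be moved to the
force (`isHalfSpaceSolution_iff_sub`), and the equivalence is the unique solvability of the Stokes
problem with force `F - u ⊗ u`.
-/

open scoped FourierTransform SchwartzMap ContDiff

noncomputable section

namespace HalfSpaceStokes

open MeasureTheory Set Filter Topology

variable {d : ℕ}

/-! ### Schwartz norms of Fourier multipliers -/

theorem schwartzNorm_nonneg (N : ℕ) (φ : TestSpace d) : 0 ≤ schwartzNorm N φ :=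
  apply_nonneg _ _

theorem schwartzNorm_mono {N N' : ℕ} (h : N ≤ N') (φ : TestSpace d) :
    schwartzNorm N φ ≤ schwartzNorm N' φ :=
  (Finset.sup_mono (f := schwartzSeminormFamily ℂ (Tang d) ℂ)
    (Finset.Iic_subset_Iic.2 (Prod.mk_le_mk.2 ⟨h, h⟩))) _

/-- A continuous seminorm on the Schwartz space is dominated by one of the norms `‖·‖_N`. -/
theorem exists_schwartzNorm_bound {q : Seminorm ℂ 𝓢(Tang d, ℂ)} (hq : Continuous q) :
    ∃ (N : ℕ) (C : ℝ), 0 ≤ C ∧ ∀ φ : 𝓢(Tang d, ℂ),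
      q φ ≤ C * (Finset.Iic (N, N)).sup (schwartzSeminormFamily ℂ (Tang d) ℂ) φ := by
  obtain ⟨s, C, -, h⟩ :=
    Seminorm.bound_of_continuous (schwartz_withSeminorms ℂ (Tang d) ℂ) q hq
  obtain ⟨N, hN⟩ : ∃ N : ℕ, s ⊆ Finset.Iic (N, N) := by
    refine ⟨s.sup (fun p => max p.1 p.2), fun p hp => ?_⟩
    have := Finset.le_sup (f := fun p : ℕ × ℕ => max p.1 p.2) hp
    simp only [Finset.mem_Iic]
    exact Prod.mk_le_mk.2 ⟨(le_max_left _ _).trans this, (le_max_right _ _).trans this⟩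
  refine ⟨N, C, C.2, fun φ => (h φ).trans ?_⟩
  have := Finset.sup_mono (f := schwartzSeminormFamily ℂ (Tang d) ℂ) hN φ
  exact mul_le_mul_of_nonneg_left this C.2

theorem continuous_sup_seminorm (N : ℕ) : Continuous fun φ : 𝓢(Tang d, ℂ) =>
    (Finset.Iic (N, N)).sup (schwartzSeminormFamily ℂ (Tang d) ℂ) φ :=
  (schwartz_withSeminorms ℂ (Tang d) ℂ).finset_sups.continuous_seminorm _

theorem seminorm_le_sup {N k n : ℕ} (hk : k ≤ N) (hn : n ≤ N) (f : 𝓢(Tang d, ℂ)) :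
    SchwartzMap.seminorm ℂ k n f
      ≤ (Finset.Iic (N, N)).sup (schwartzSeminormFamily ℂ (Tang d) ℂ) f := by
  have : (k, n) ∈ Finset.Iic (N, N) := by simp [hk, hn]
  exact (Finset.le_sup (f := schwartzSeminormFamily ℂ (Tang d) ℂ) this) f

theorem norm_iteratedFDeriv_le_sup {N n : ℕ} (hn : n ≤ N) (f : 𝓢(Tang d, ℂ)) (ξ : Tang d) :
    ‖iteratedFDeriv ℝ n f ξ‖
      ≤ (Finset.Iic (N, N)).sup (schwartzSeminormFamily ℂ (Tang d) ℂ) f := by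
  have h := SchwartzMap.le_seminorm ℂ 0 n f ξ
  simp only [pow_zero, one_mul] at h
  exact h.trans (seminorm_le_sup (Nat.zero_le _) hn f)

theorem symb_contDiffOn (m : Symb d) :
    ContDiffOn ℝ ∞ (fun ξ : Tang d => m.toFun ((2 * Real.pi) • ξ)) {0}ᶜ :=
  m.smooth.comp (contDiff_const_smul _).contDiffOn
    (fun ξ hξ => by simpa [Real.pi_ne_zero] using hξ)

/-- On test functions with frequencies in an annulus, a multiplier is controlled in Schwartz norms
by finitely many derivatives of its symbol on the annulus. -/
theorem schwartzNorm_multTest_le {r R : ℝ} (hr : 0 < r) (N : ℕ) : ∃ (N' : ℕ) (C : ℝ), 0 ≤ C ∧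
    ∀ (m : Symb d) (B : ℝ), 0 ≤ B → (∀ i ≤ N', ∀ ξ : Tang d, r ≤ ‖ξ‖ → ‖ξ‖ ≤ R →
        ‖iteratedFDeriv ℝ i (fun ξ : Tang d => m.toFun ((2 * Real.pi) • ξ)) ξ‖ ≤ B) →
      ∀ φ : TestSpace d, SpectrumIn r R (φ : 𝓢(Tang d, ℂ)) →
        schwartzNorm N (multTest m φ) ≤ C * B * schwartzNorm N' φ := by
  -- `𝓕⁻¹` and `𝓕` are continuous, so it suffices to bound `m(2πξ) 𝓕φ(ξ)` by the Leibniz rule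
  let q : ℕ → Seminorm ℂ 𝓢(Tang d, ℂ) := fun N =>
    (Finset.Iic (N, N)).sup (schwartzSeminormFamily ℂ (Tang d) ℂ)
  obtain ⟨N₁, C₁, hC₁, h₁⟩ := exists_schwartzNorm_bound
    (q := (q N).comp (FourierTransform.fourierInvCLM ℂ 𝓢(Tang d, ℂ)).toLinearMap)
    ((continuous_sup_seminorm N).comp (FourierTransform.fourierInvCLM ℂ 𝓢(Tang d, ℂ)).continuous)
  obtain ⟨N₂, C₂, hC₂, h₂⟩ := exists_schwartzNorm_bound
    (q := (q N₁).comp (FourierTransform.fourierCLM ℂ 𝓢(Tang d, ℂ)).toLinearMap)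
    ((continuous_sup_seminorm N₁).comp (FourierTransform.fourierCLM ℂ 𝓢(Tang d, ℂ)).continuous)
  refine ⟨max N₁ N₂, C₁ * (max R 1 ^ N₁ * 2 ^ N₁ * C₂), by positivity, fun m B hB0 hB φ hφ => ?_⟩
  have hψ := symb_mul_fourier m φ
  set ψ : 𝓢(Tang d, ℂ) := hψ.1.toSchwartzMap hψ.2 with hψdef
  have hψf : ∀ ξ, ψ ξ = m.toFun ((2 * Real.pi) • ξ) * 𝓕 (φ : 𝓢(Tang d, ℂ)) ξ := fun ξ => rfl
  have e1 : schwartzNorm N (multTest m φ) ≤ C₁ * q N₁ ψ := h₁ ψ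
  have e2 : q N₁ (𝓕 (φ : 𝓢(Tang d, ℂ))) ≤ C₂ * schwartzNorm N₂ φ := h₂ φ
  have hsupp : ∀ ξ, ¬ (r ≤ ‖ξ‖ ∧ ‖ξ‖ ≤ R) → ∀ n, iteratedFDeriv ℝ n ψ ξ = 0 := by
    intro ξ hξ n
    by_contra h
    have h1 := support_iteratedFDeriv_subset (𝕜 := ℝ) (f := ψ) n h
    have hcl : IsClosed {ξ : Tang d | r ≤ ‖ξ‖ ∧ ‖ξ‖ ≤ R} :=
      (isClosed_le continuous_const continuous_norm).inter
        (isClosed_le continuous_norm continuous_const)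
    refine hξ (closure_minimal (fun η hη => ?_) hcl h1)
    refine hφ η fun h0 => hη ?_
    rw [hψf, h0, mul_zero]
  have hQ : 0 ≤ q N₁ (𝓕 (φ : 𝓢(Tang d, ℂ))) := apply_nonneg _ _
  have e3 : q N₁ ψ ≤ max R 1 ^ N₁ * 2 ^ N₁ * B * q N₁ (𝓕 (φ : 𝓢(Tang d, ℂ))) := by
    refine Seminorm.finset_sup_apply_le (by positivity) fun p hp => ?_
    obtain ⟨k, n⟩ := p
    simp only [Finset.mem_Iic, Prod.mk_le_mk] at hp
    rw [SchwartzMap.schwartzSeminormFamily_apply]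
    refine SchwartzMap.seminorm_le_bound ℂ k n ψ (by positivity) fun ξ => ?_
    by_cases hξ : r ≤ ‖ξ‖ ∧ ‖ξ‖ ≤ R; swap
    · rw [hsupp ξ hξ]
      simp only [norm_zero, mul_zero]
      positivity
    have hopen : IsOpen ({0}ᶜ : Set (Tang d)) := isOpen_compl_singleton
    have hξ0 : ξ ∈ ({0}ᶜ : Set (Tang d)) := by
      intro h0
      rw [mem_singleton_iff.1 h0, norm_zero] at hξ
      linarith [hξ.1]
    have hle := norm_iteratedFDerivWithin_mul_le (𝕜 := ℝ) (symb_contDiffOn m)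
      ((𝓕 (φ : 𝓢(Tang d, ℂ))).smooth'.contDiffOn (s := {0}ᶜ)) hopen.uniqueDiffOn hξ0 (n := n)
      (by exact_mod_cast le_top)
    rw [iteratedFDerivWithin_of_isOpen n hopen hξ0] at hle
    have hterm : ∑ i ∈ Finset.range (n + 1), (n.choose i : ℝ)
          * ‖iteratedFDerivWithin ℝ i (fun ξ : Tang d => m.toFun ((2 * Real.pi) • ξ)) {0}ᶜ ξ‖
          * ‖iteratedFDerivWithin ℝ (n - i) (𝓕 (φ : 𝓢(Tang d, ℂ))).toFun {0}ᶜ ξ‖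
        ≤ ∑ i ∈ Finset.range (n + 1), (n.choose i : ℝ) * B * q N₁ (𝓕 (φ : 𝓢(Tang d, ℂ))) := by
      refine Finset.sum_le_sum fun i hi => ?_
      rw [iteratedFDerivWithin_of_isOpen i hopen hξ0,
        iteratedFDerivWithin_of_isOpen (n - i) hopen hξ0]
      have hi' : i ≤ n := by simpa [Nat.lt_succ_iff] using hi
      have b1 := hB i ((hi'.trans hp.2).trans (le_max_left _ _)) ξ hξ.1 hξ.2
      have b2 : ‖iteratedFDeriv ℝ (n - i) (𝓕 (φ : 𝓢(Tang d, ℂ))).toFun ξ‖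
          ≤ q N₁ (𝓕 (φ : 𝓢(Tang d, ℂ))) :=
        norm_iteratedFDeriv_le_sup ((Nat.sub_le _ _).trans hp.2) (𝓕 (φ : 𝓢(Tang d, ℂ))) ξ
      gcongr
    have hsum : ∑ i ∈ Finset.range (n + 1), (n.choose i : ℝ) * B * q N₁ (𝓕 (φ : 𝓢(Tang d, ℂ)))
        = 2 ^ n * B * q N₁ (𝓕 (φ : 𝓢(Tang d, ℂ))) := by
      rw [← Finset.sum_mul, ← Finset.sum_mul]
      congr 2
      exact_mod_cast Nat.sum_range_choose n
    have e4 : ‖iteratedFDeriv ℝ n ψ ξ‖ ≤ 2 ^ n * B * q N₁ (𝓕 (φ : 𝓢(Tang d, ℂ))) :=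
      (hle.trans hterm).trans_eq hsum
    have e5 : ‖ξ‖ ^ k ≤ max R 1 ^ N₁ :=
      (pow_le_pow_left₀ (norm_nonneg _) (hξ.2.trans (le_max_left _ _)) k).trans
        (pow_le_pow_right₀ (le_max_right _ _) hp.1)
    have e6 : (2 : ℝ) ^ n ≤ 2 ^ N₁ := pow_le_pow_right₀ (by norm_num) hp.2
    calc ‖ξ‖ ^ k * ‖iteratedFDeriv ℝ n ψ ξ‖
        ≤ max R 1 ^ N₁ * (2 ^ n * B * q N₁ (𝓕 (φ : 𝓢(Tang d, ℂ)))) := by gcongr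
      _ ≤ max R 1 ^ N₁ * (2 ^ N₁ * B * q N₁ (𝓕 (φ : 𝓢(Tang d, ℂ)))) := by gcongr
      _ = _ := by ring
  calc schwartzNorm N (multTest m φ) ≤ C₁ * q N₁ ψ := e1
    _ ≤ C₁ * (max R 1 ^ N₁ * 2 ^ N₁ * B * (C₂ * schwartzNorm N₂ φ)) := by
      gcongr
      exact e3.trans (by gcongr)
    _ ≤ C₁ * (max R 1 ^ N₁ * 2 ^ N₁ * B * (C₂ * schwartzNorm (max N₁ N₂) φ)) := by
      gcongr
      exact schwartzNorm_mono (le_max_right _ _) φ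
    _ = _ := by ring

theorem isCompact_annulus (r R : ℝ) : IsCompact {ξ : Tang d | r ≤ ‖ξ‖ ∧ ‖ξ‖ ≤ R} := by
  refine (isCompact_closedBall (0 : Tang d) R).of_isClosed_subset
    ((isClosed_le continuous_const continuous_norm).inter
      (isClosed_le continuous_norm continuous_const)) fun ξ hξ => ?_
  simpa using hξ.2

theorem exists_iteratedFDeriv_bound {E : Type*} [NormedAddCommGroup E] [NormedSpace ℝ E]
    {f : Tang d → E} (hf : ContDiffOn ℝ ∞ f {0}ᶜ) {r : ℝ} (hr : 0 < r) (R : ℝ) (N : ℕ) :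
    ∃ B : ℝ, 1 ≤ B ∧ ∀ i ≤ N, ∀ ξ : Tang d, r ≤ ‖ξ‖ → ‖ξ‖ ≤ R → ‖iteratedFDeriv ℝ i f ξ‖ ≤ B := by
  have hsub : {ξ : Tang d | r ≤ ‖ξ‖ ∧ ‖ξ‖ ≤ R} ⊆ {0}ᶜ := by
    rintro ξ hξ h0
    rw [mem_singleton_iff.1 h0, mem_ofPred_eq, norm_zero] at hξ
    linarith [hξ.1]
  have h : ∀ i : ℕ, ∃ B : ℝ, ∀ ξ : Tang d, r ≤ ‖ξ‖ → ‖ξ‖ ≤ R → ‖iteratedFDeriv ℝ i f ξ‖ ≤ B := by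
    intro i
    have hc : ContinuousOn (iteratedFDeriv ℝ i f) {0}ᶜ := by
      have := hf.continuousOn_iteratedFDerivWithin (m := i) (by exact_mod_cast le_top)
        isOpen_compl_singleton.uniqueDiffOn
      exact this.congr fun ξ hξ => (iteratedFDerivWithin_of_isOpen i isOpen_compl_singleton hξ).symm
    obtain ⟨B, hB⟩ := (isCompact_annulus r R).exists_bound_of_continuousOn (hc.mono hsub)
    exact ⟨B, fun ξ h1 h2 => hB ξ ⟨h1, h2⟩⟩
  choose B hB using h
  refine ⟨1 + ∑ i ∈ Finset.range (N + 1), |B i|, ?_, fun i hi ξ h1 h2 => ?_⟩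
  · have := Finset.sum_nonneg (s := Finset.range (N + 1)) (fun i _ => abs_nonneg (B i))
    linarith
  · have h3 : |B i| ≤ ∑ i ∈ Finset.range (N + 1), |B i| :=
      Finset.single_le_sum (f := fun i => |B i|) (fun i _ => abs_nonneg _)
        (Finset.mem_range.2 (Nat.lt_succ_of_le hi))
    linarith [hB i ξ h1 h2, le_abs_self (B i)]

theorem schwartzNorm_multTest_le_of_symb (m : Symb d) {r : ℝ} (hr : 0 < r) (R : ℝ) (N : ℕ) :
    ∃ (N' : ℕ) (C : ℝ), 0 ≤ C ∧ ∀ φ : TestSpace d, SpectrumIn r R (φ : 𝓢(Tang d, ℂ)) →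
      schwartzNorm N (multTest m φ) ≤ C * schwartzNorm N' φ := by
  obtain ⟨N', C, hC, h⟩ := schwartzNorm_multTest_le (d := d) (R := R) hr N
  obtain ⟨B, hB, hB'⟩ := exists_iteratedFDeriv_bound (symb_contDiffOn m) hr R N'
  exact ⟨N', C * B, by positivity, h m B (by positivity) hB'⟩

/-- For radial symbols, finitely many derivatives of the profile control the multiplier. -/
theorem schwartzNorm_multTest_radial_le {r : ℝ} (hr : 0 < r) (R : ℝ) (N : ℕ) :
    ∃ (N' : ℕ) (C : ℝ), 0 ≤ C ∧ ∀ (h : ℝ → ℝ) (hh : ContDiff ℝ ∞ h) (B : ℝ), 0 ≤ B →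
      (∀ i ≤ N', ∀ ρ : ℝ, 2 * Real.pi * r ≤ ρ → ρ ≤ 2 * Real.pi * R → |iteratedDeriv i h ρ| ≤ B) →
      ∀ φ : TestSpace d, SpectrumIn r R (φ : 𝓢(Tang d, ℂ)) →
        schwartzNorm N (multTest (radial h hh) φ) ≤ C * B * schwartzNorm N' φ := by
  obtain ⟨N', C, hC, hm⟩ := schwartzNorm_multTest_le (d := d) (R := R) hr N
  have hf : ContDiffOn ℝ ∞ (fun ξ : Tang d => ‖(2 * Real.pi) • ξ‖) {0}ᶜ :=
    contDiffOn_norm_compl.comp (contDiff_const_smul _).contDiffOn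
      (fun ξ hξ => by simpa [Real.pi_ne_zero] using hξ)
  obtain ⟨D, hD, hD'⟩ := exists_iteratedFDeriv_bound hf hr R N'
  refine ⟨N', C * (N'.factorial * D ^ N'), by positivity, fun h hh B hB hB' φ hφ => ?_⟩
  have key := hm (radial h hh) (N'.factorial * B * D ^ N') (by positivity) (fun i hi ξ h1 h2 => ?_)
    φ hφ
  · refine key.trans_eq ?_
    ring
  have hξ0 : ξ ∈ ({0}ᶜ : Set (Tang d)) := by
    intro h0
    rw [mem_singleton_iff.1 h0, norm_zero] at h1
    linarith
  have hopen : IsOpen ({0}ᶜ : Set (Tang d)) := isOpen_compl_singleton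
  have hg : ContDiff ℝ ∞ (fun ρ : ℝ => (h ρ : ℂ)) := Complex.ofRealCLM.contDiff.comp hh
  have hn : ‖(2 * Real.pi) • ξ‖ = 2 * Real.pi * ‖ξ‖ := by
    rw [norm_smul, Real.norm_of_nonneg (by positivity)]
  have hcomp := norm_iteratedFDerivWithin_comp_le (n := i) (C := B) (D := D) (𝕜 := ℝ)
    (hg.contDiffOn (s := univ)) hf (by exact_mod_cast le_top) uniqueDiffOn_univ hopen.uniqueDiffOn
    (mapsTo_univ _ _) hξ0 ?_ ?_
  · rw [iteratedFDerivWithin_of_isOpen i hopen hξ0] at hcomp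
    calc _ ≤ (i.factorial : ℝ) * B * D ^ i := hcomp
      _ ≤ N'.factorial * B * D ^ N' := by
        have := Nat.factorial_le hi
        gcongr
  · intro j hj
    rw [iteratedFDerivWithin_univ]
    have e : ‖iteratedFDeriv ℝ j (fun ρ : ℝ => (h ρ : ℂ)) ‖(2 * Real.pi) • ξ‖‖
        = ‖iteratedFDeriv ℝ j h ‖(2 * Real.pi) • ξ‖‖ :=
      Complex.ofRealLI.norm_iteratedFDeriv_comp_left (f := h) hh.contDiffAt
        (by exact_mod_cast le_top)
    rw [e, norm_iteratedFDeriv_eq_norm_iteratedDeriv, Real.norm_eq_abs]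
    refine hB' j (hj.trans hi) _ ?_ ?_ <;> rw [hn] <;> gcongr
  · intro j hj1 hj
    rw [iteratedFDerivWithin_of_isOpen j hopen hξ0]
    exact (hD' j (hj.trans hi) ξ h1 h2).trans (le_self_pow₀ hD (by omega))

/-! ### The algebra of multipliers on test functions -/

theorem fourier_multTest (m : Symb d) (φ : TestSpace d) (ξ : Tang d) :
    𝓕 (multTest m φ : 𝓢(Tang d, ℂ)) ξ
      = m.toFun ((2 * Real.pi) • ξ) * 𝓕 (φ : 𝓢(Tang d, ℂ)) ξ :=
  fourier_multSchwartz m φ ξ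

theorem fourier_zero_eq_zero (φ : TestSpace d) : 𝓕 (φ : 𝓢(Tang d, ℂ)) 0 = 0 := by
  obtain ⟨r, R, hr, h⟩ := φ.2
  by_contra h0
  have := (h 0 h0).1
  rw [norm_zero] at this
  linarith

theorem SpectrumIn.multTest {r R : ℝ} {φ : TestSpace d} (h : SpectrumIn r R (φ : 𝓢(Tang d, ℂ)))
    (m : Symb d) : SpectrumIn r R (multTest m φ : 𝓢(Tang d, ℂ)) := fun ξ hξ => h ξ fun h0 => hξ (by
  rw [fourier_multTest, h0, mul_zero])

/-- The frequency `0`, where symbols may be singular, need not be tested. -/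
theorem testSpace_ext {φ ψ : TestSpace d}
    (h : ∀ ξ : Tang d, ξ ≠ 0 → 𝓕 (φ : 𝓢(Tang d, ℂ)) ξ = 𝓕 (ψ : 𝓢(Tang d, ℂ)) ξ) : φ = ψ := by
  refine Subtype.ext (fourier_injective fun ξ => ?_)
  by_cases h0 : ξ = 0
  · rw [h0, fourier_zero_eq_zero, fourier_zero_eq_zero]
  · exact h ξ h0

theorem multTest_comm (m m' : Symb d) (φ : TestSpace d) :
    multTest m (multTest m' φ) = multTest m' (multTest m φ) :=
  testSpace_ext fun ξ _ => by
    simp only [fourier_multTest]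
    ring

/-- The value of the Fourier transform at `ξ`, as a linear functional. -/
def fourierAt (ξ : Tang d) : TestSpace d →ₗ[ℂ] ℂ where
  toFun φ := 𝓕 (φ : 𝓢(Tang d, ℂ)) ξ
  map_add' φ ψ := by simp [FourierTransform.fourier_add]
  map_smul' c φ := by simp [FourierTransform.fourier_smul]

theorem fourierAt_apply (ξ : Tang d) (φ : TestSpace d) :
    fourierAt ξ φ = 𝓕 (φ : 𝓢(Tang d, ℂ)) ξ := rfl

theorem mult_apply (m : Symb d) (T : TDist d) (φ : TestSpace d) :
    mult m T φ = T (multTest m.reflect φ) := rfl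

theorem mult_comm (m m' : Symb d) (T : TDist d) : mult m (mult m' T) = mult m' (mult m T) := by
  ext φ
  simp only [mult_apply]
  rw [multTest_comm]

theorem radial_reflect (h : ℝ → ℝ) (hh : ContDiff ℝ ∞ h) :
    (radial (d := d) h hh).reflect = radial h hh := by
  simp [radial, Symb.reflect]

theorem mult_radial_apply (h : ℝ → ℝ) (hh : ContDiff ℝ ∞ h) (T : TDist d) (φ : TestSpace d) :
    mult (radial h hh) T φ = T (multTest (radial h hh) φ) := by
  rw [mult_apply, radial_reflect]

/-- `|∇'|` on test functions. -/
def absTest : TestSpace d →ₗ[ℂ] TestSpace d := multTest (radial (fun ρ => ρ) contDiff_id)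

/-- `e^{-t|∇'|}` on test functions; here `t` may be negative, since spectra are compact. -/
def expTest (t : ℝ) : TestSpace d →ₗ[ℂ] TestSpace d :=
  multTest (radial (fun ρ => Real.exp (-(t * ρ))) (by fun_prop))

theorem absGrad_apply (T : TDist d) (φ : TestSpace d) : absGrad T φ = T (absTest φ) :=
  mult_radial_apply _ _ _ _

theorem poisson_apply (t : ℝ) (T : TDist d) (φ : TestSpace d) :
    poisson t T φ = T (expTest t φ) :=
  mult_radial_apply _ _ _ _

theorem fourier_absTest (φ : TestSpace d) (ξ : Tang d) :
    𝓕 (absTest φ : 𝓢(Tang d, ℂ)) ξ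
      = ((‖(2 * Real.pi) • ξ‖ : ℝ) : ℂ) * 𝓕 (φ : 𝓢(Tang d, ℂ)) ξ :=
  fourier_multTest _ _ _

theorem fourier_expTest (t : ℝ) (φ : TestSpace d) (ξ : Tang d) :
    𝓕 (expTest t φ : 𝓢(Tang d, ℂ)) ξ
      = ((Real.exp (-(t * ‖(2 * Real.pi) • ξ‖)) : ℝ) : ℂ) * 𝓕 (φ : 𝓢(Tang d, ℂ)) ξ :=
  fourier_multTest _ _ _

theorem expTest_zero (φ : TestSpace d) : expTest 0 φ = φ :=
  testSpace_ext fun ξ _ => by simp [fourier_expTest]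

theorem expTest_add (s t : ℝ) (φ : TestSpace d) :
    expTest (s + t) φ = expTest s (expTest t φ) :=
  testSpace_ext fun ξ _ => by
    simp only [fourier_expTest]
    rw [← mul_assoc, ← Complex.ofReal_mul, ← Real.exp_add]
    ring_nf

theorem absTest_expTest (t : ℝ) (φ : TestSpace d) :
    absTest (expTest t φ) = expTest t (absTest φ) := multTest_comm _ _ _

theorem SpectrumIn.absTest {r R : ℝ} {φ : TestSpace d} (h : SpectrumIn r R (φ : 𝓢(Tang d, ℂ))) :
    SpectrumIn r R (absTest φ : 𝓢(Tang d, ℂ)) := h.multTest _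

theorem SpectrumIn.expTest {r R : ℝ} {φ : TestSpace d} (h : SpectrumIn r R (φ : 𝓢(Tang d, ℂ)))
    (t : ℝ) : SpectrumIn r R (expTest t φ : 𝓢(Tang d, ℂ)) := h.multTest _

theorem poisson_zero (T : TDist d) : poisson 0 T = T := by
  ext φ
  rw [poisson_apply, expTest_zero]

/-- `|∇'|⁻¹`, the multiplier with symbol `1/|ξ|`. -/
def invAbsSymb : Symb d where
  toFun := fun ξ => (‖ξ‖ : ℂ)⁻¹
  smooth := ContDiffOn.inv
    (Complex.ofRealCLM.contDiff.comp_contDiffOn contDiffOn_norm_compl)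
    (fun ξ hξ => by simpa using hξ)

/-- `|∇'|⁻¹` on distributions. -/
def invAbs : TDist d →ₗ[ℂ] TDist d := mult invAbsSymb

theorem absGrad_invAbs (T : TDist d) : absGrad (invAbs T) = T := by
  ext φ
  rw [absGrad_apply, invAbs, mult_apply]
  congr 1
  refine testSpace_ext fun ξ hξ => ?_
  rw [fourier_multTest, fourier_absTest]
  simp only [Symb.reflect, invAbsSymb, norm_neg]
  have : ((‖(2 * Real.pi) • ξ‖ : ℝ) : ℂ) ≠ 0 := by
    simp [hξ, Real.pi_ne_zero]
  field_simp

theorem fourier_derivTest (j : Fin d) (φ : TestSpace d) (ξ : Tang d) :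
    𝓕 (derivTest j φ : 𝓢(Tang d, ℂ)) ξ
      = 2 * Real.pi * Complex.I * (ξ j : ℂ) * 𝓕 (φ : 𝓢(Tang d, ℂ)) ξ := by
  change 𝓕 (LineDeriv.lineDerivOp (EuclideanSpace.single j (1 : ℝ)) (φ : 𝓢(Tang d, ℂ))) ξ = _
  rw [SchwartzMap.fourier_lineDerivOp_eq, smul_apply,
    SchwartzMap.smulLeftCLM_apply_apply (by fun_prop)]
  simp [EuclideanSpace.inner_single_right]
  ring

theorem pderiv_eq (j : Fin d) (T : TDist d) : pderiv j T = riesz j (absGrad T) := by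
  ext φ
  rw [riesz, mult_apply, absGrad_apply]
  change -(T (derivTest j φ)) = _
  rw [← map_neg]
  congr 1
  refine testSpace_ext fun ξ hξ => ?_
  rw [fourier_absTest, fourier_multTest]
  have e : 𝓕 ((-derivTest j φ : TestSpace d) : 𝓢(Tang d, ℂ)) ξ
      = -𝓕 (derivTest j φ : 𝓢(Tang d, ℂ)) ξ := by
    simp [FourierTransform.fourier_neg]
  rw [e, fourier_derivTest]
  simp only [Symb.reflect, rieszSymb, norm_neg]
  have : ((‖(2 * Real.pi) • ξ‖ : ℝ) : ℂ) ≠ 0 := by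
    simp [hξ, Real.pi_ne_zero]
  field_simp
  simp
  ring

theorem sum_riesz_riesz (T : TDist d) : ∑ j : Fin d, riesz j (riesz j T) = -T := by
  ext φ
  simp only [LinearMap.coe_sum, Finset.sum_apply, riesz, mult_apply]
  change _ = -(T φ)
  rw [← map_neg, ← map_sum]
  congr 1
  refine testSpace_ext fun ξ hξ => ?_
  have e : 𝓕 ((∑ j : Fin d, multTest (rieszSymb j).reflect (multTest (rieszSymb j).reflect φ) :
      TestSpace d) : 𝓢(Tang d, ℂ)) ξ = ∑ j : Fin d,
        𝓕 (multTest (rieszSymb j).reflect (multTest (rieszSymb j).reflect φ) : 𝓢(Tang d, ℂ)) ξ := by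
    exact map_sum (fourierAt ξ) _ _
  have e' : 𝓕 ((-φ : TestSpace d) : 𝓢(Tang d, ℂ)) ξ = -𝓕 (φ : 𝓢(Tang d, ℂ)) ξ := by
    simp [FourierTransform.fourier_neg]
  rw [e, e']
  simp only [fourier_multTest, Symb.reflect, rieszSymb, norm_neg]
  have hn : ((‖(2 * Real.pi) • ξ‖ : ℝ) : ℂ) ≠ 0 := by
    simp [hξ, Real.pi_ne_zero]
  have hs : ∑ j : Fin d, ((((2 * Real.pi) • ξ) j : ℝ) : ℂ) ^ 2
      = ((‖(2 * Real.pi) • ξ‖ : ℝ) : ℂ) ^ 2 := by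
    rw [← Complex.ofReal_pow, EuclideanSpace.real_norm_sq_eq]
    push_cast
    rfl
  have : ∀ j : Fin d, Complex.I * (((-((2 * Real.pi) • ξ)) j : ℝ) : ℂ)
        / ((‖(2 * Real.pi) • ξ‖ : ℝ) : ℂ) * (Complex.I * (((-((2 * Real.pi) • ξ)) j : ℝ) : ℂ)
        / ((‖(2 * Real.pi) • ξ‖ : ℝ) : ℂ) * 𝓕 (φ : 𝓢(Tang d, ℂ)) ξ)
      = ((((2 * Real.pi) • ξ) j : ℝ) : ℂ) ^ 2 *
        (-𝓕 (φ : 𝓢(Tang d, ℂ)) ξ / ((‖(2 * Real.pi) • ξ‖ : ℝ) : ℂ) ^ 2) := fun j => by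
    have : ((-((2 * Real.pi) • ξ)) j : ℝ) = -(((2 * Real.pi) • ξ) j) := rfl
    rw [this]
    field_simp
    push_cast
    rw [Complex.I_sq]
    ring
  simp only [this]
  rw [← Finset.sum_mul, hs]
  field_simp

/-! ### The semigroup `e^{-t|∇'|}` -/

theorem iteratedDeriv_exp_neg_mul (t : ℝ) (i : ℕ) (ρ : ℝ) :
    iteratedDeriv i (fun ρ => Real.exp (-(t * ρ))) ρ = (-t) ^ i * Real.exp (-(t * ρ)) := by
  have h : (fun ρ : ℝ => Real.exp (-(t * ρ))) = fun ρ => Real.exp ((-t) * ρ) := by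
    ext ρ
    rw [neg_mul]
  rw [h, iteratedDeriv_exp_const_mul]
  simp only [neg_mul]

/-- Exponential decay of `e^{-t|∇'|}` on test functions with frequencies in an annulus.  The rate
is not optimal: part of it absorbs the powers of `t` produced by the Schwartz norms. -/
theorem schwartzNorm_expTest_le {r : ℝ} (hr : 0 < r) (R : ℝ) (N : ℕ) :
    ∃ (N' : ℕ) (C : ℝ), 0 ≤ C ∧ ∀ t : ℝ, 0 ≤ t → ∀ φ : TestSpace d,
      SpectrumIn r R (φ : 𝓢(Tang d, ℂ)) →
      schwartzNorm N (expTest t φ) ≤ C * Real.exp (-(2 * r * t)) * schwartzNorm N' φ := by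
  obtain ⟨N', C, hC, h⟩ := schwartzNorm_multTest_radial_le (d := d) hr R N
  refine ⟨N', C * (N'.factorial * Real.exp (4 * r) / (4 * r) ^ N'), by positivity,
    fun t ht φ hφ => ?_⟩
  refine (h _ _ ((1 + t) ^ N' * Real.exp (-(2 * Real.pi * r * t))) (by positivity)
    (fun i hi ρ h1 _ => ?_) φ hφ).trans ?_
  · rw [iteratedDeriv_exp_neg_mul, abs_mul, abs_pow, abs_neg, abs_of_nonneg ht, Real.abs_exp]
    refine mul_le_mul ((pow_le_pow_left₀ ht (by linarith) i).trans
      (pow_le_pow_right₀ (by linarith) hi)) (Real.exp_le_exp.2 ?_) (Real.exp_pos _).le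
      (by positivity)
    nlinarith
  · have h1 := Real.pow_div_factorial_le_exp (4 * r * (1 + t)) (by positivity) N'
    have hf : (0 : ℝ) < N'.factorial := by exact_mod_cast N'.factorial_pos
    have h2 : (1 + t) ^ N' ≤
        N'.factorial * Real.exp (4 * r) / (4 * r) ^ N' * Real.exp (4 * r * t) := by
      rw [div_le_iff₀ hf, mul_pow] at h1
      rw [div_mul_eq_mul_div, le_div_iff₀ (by positivity), mul_assoc, ← Real.exp_add]
      calc (1 + t) ^ N' * (4 * r) ^ N' = (4 * r) ^ N' * (1 + t) ^ N' := mul_comm _ _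
        _ ≤ _ := h1
        _ = _ := by ring_nf
    have h3 : Real.exp (4 * r * t) * Real.exp (-(2 * Real.pi * r * t))
        ≤ Real.exp (-(2 * r * t)) := by
      rw [← Real.exp_add]
      refine Real.exp_le_exp.2 ?_
      have := mul_nonneg (mul_nonneg hr.le ht) (sub_nonneg.2 Real.pi_gt_three.le)
      nlinarith
    have h4 : (1 + t) ^ N' * Real.exp (-(2 * Real.pi * r * t))
        ≤ N'.factorial * Real.exp (4 * r) / (4 * r) ^ N' * Real.exp (-(2 * r * t)) := by
      calc _ ≤ N'.factorial * Real.exp (4 * r) / (4 * r) ^ N' * Real.exp (4 * r * t)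
            * Real.exp (-(2 * Real.pi * r * t)) := by gcongr
        _ = N'.factorial * Real.exp (4 * r) / (4 * r) ^ N' * (Real.exp (4 * r * t)
            * Real.exp (-(2 * Real.pi * r * t))) := by ring
        _ ≤ _ := by gcongr
    have h5 := mul_le_mul_of_nonneg_right (mul_le_mul_of_nonneg_left h4 hC)
      (schwartzNorm_nonneg N' φ)
    refine h5.trans_eq ?_
    ring

theorem contDiff_taylor (s : ℝ) :
    ContDiff ℝ ∞ fun ρ : ℝ => Real.exp (-(s * ρ)) - 1 + s * ρ := by fun_prop

/-- All derivatives in `ρ ∈ [0, L]` of the Taylor remainder `e^{-sρ} - 1 + sρ` are `O(s²)`. -/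
theorem abs_iteratedDeriv_taylor_le {s L ρ : ℝ} (hL : 1 ≤ L) (hs : |s| * L ≤ 1) (h0 : 0 ≤ ρ)
    (hρ : ρ ≤ L) (i : ℕ) :
    |iteratedDeriv i (fun ρ : ℝ => Real.exp (-(s * ρ)) - 1 + s * ρ) ρ| ≤ 3 * L ^ 2 * s ^ 2 := by
  have hs1 : |s| ≤ 1 := by nlinarith [abs_nonneg s]
  have hsρ : |-(s * ρ)| ≤ 1 := by
    rw [abs_neg, abs_mul, abs_of_nonneg h0]
    exact (mul_le_mul_of_nonneg_left hρ (abs_nonneg _)).trans hs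
  have hsq : s ^ 2 = |s| ^ 2 := (sq_abs s).symm
  have hL2 : 1 ≤ L ^ 2 := one_le_pow₀ hL
  have hd1 : deriv (fun ρ : ℝ => Real.exp (-(s * ρ)) - 1 + s * ρ)
      = fun ρ => -s * (Real.exp (-(s * ρ)) - 1) := by
    ext x
    have h1 : HasDerivAt (fun ρ : ℝ => s * ρ) s x := by
      simpa using (hasDerivAt_id x).const_mul s
    refine ((h1.fun_neg.exp.sub_const 1).fun_add h1).deriv.trans ?_
    ring
  have hd2 : deriv (fun ρ : ℝ => -s * (Real.exp (-(s * ρ)) - 1))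
      = fun ρ => s ^ 2 * Real.exp (-(s * ρ)) := by
    ext x
    have h1 : HasDerivAt (fun ρ : ℝ => s * ρ) s x := by
      simpa using (hasDerivAt_id x).const_mul s
    refine ((h1.fun_neg.exp.sub_const 1).const_mul (-s)).deriv.trans ?_
    ring
  match i with
  | 0 =>
    rw [iteratedDeriv_zero]
    have := Real.abs_exp_sub_one_sub_id_le hsρ
    have e : Real.exp (-(s * ρ)) - 1 + s * ρ = Real.exp (-(s * ρ)) - 1 - -(s * ρ) := by ring
    rw [e]
    refine this.trans ?_
    have : ρ ^ 2 ≤ L ^ 2 := by gcongr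
    nlinarith [sq_nonneg s, mul_le_mul_of_nonneg_left this (sq_nonneg s),
      mul_nonneg (sq_nonneg L) (sq_nonneg s)]
  | 1 =>
    rw [iteratedDeriv_one, hd1]
    have := Real.abs_exp_sub_one_le hsρ
    rw [abs_neg, abs_mul, abs_of_nonneg h0] at this
    simp only [abs_mul, abs_neg]
    calc |s| * |Real.exp (-(s * ρ)) - 1| ≤ |s| * (2 * (|s| * ρ)) := by gcongr
      _ = 2 * ρ * s ^ 2 := by rw [hsq]; ring
      _ ≤ 3 * L ^ 2 * s ^ 2 := by
        gcongr
        · norm_num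
        · nlinarith
  | i + 2 =>
    rw [iteratedDeriv_succ', iteratedDeriv_succ', hd1, hd2, iteratedDeriv_const_mul_field,
      iteratedDeriv_exp_neg_mul, abs_mul, abs_mul, abs_pow, abs_pow, abs_neg, Real.abs_exp, ← hsq]
    have h1 : |s| ^ i ≤ 1 := pow_le_one₀ (abs_nonneg _) hs1
    have h2 : Real.exp (-(s * ρ)) ≤ 3 := by
      refine (Real.exp_le_exp.2 ((le_abs_self _).trans hsρ)).trans ?_
      exact Real.exp_one_lt_d9.le.trans (by norm_num)
    calc s ^ 2 * (|s| ^ i * Real.exp (-(s * ρ))) ≤ s ^ 2 * (1 * 3) := by gcongr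
      _ ≤ s ^ 2 * (3 * L ^ 2) := mul_le_mul_of_nonneg_left (by linarith) (sq_nonneg s)
      _ = _ := by ring

theorem expTest_taylor_eq (s : ℝ) (φ : TestSpace d) :
    expTest s φ - φ + (s : ℂ) • absTest φ = multTest (radial _ (contDiff_taylor s)) φ := by
  refine testSpace_ext fun ξ _ => ?_
  rw [← fourierAt_apply, ← fourierAt_apply]
  simp only [map_add, map_sub, map_smul, fourierAt_apply, fourier_expTest, fourier_absTest,
    fourier_multTest, radial, smul_eq_mul]
  push_cast
  ring

/-- The second-order Taylor estimate of `e^{-s|∇'|}` at `s = 0`, in Schwartz norms. -/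
theorem schwartzNorm_expTest_taylor_le {r : ℝ} (hr : 0 < r) (R : ℝ) (N : ℕ) :
    ∃ (N' : ℕ) (C δ : ℝ), 0 ≤ C ∧ 0 < δ ∧ ∀ s : ℝ, |s| ≤ δ → ∀ φ : TestSpace d,
      SpectrumIn r R (φ : 𝓢(Tang d, ℂ)) →
      schwartzNorm N (expTest s φ - φ + (s : ℂ) • absTest φ) ≤ C * s ^ 2 * schwartzNorm N' φ := by
  obtain ⟨N', C, hC, h⟩ := schwartzNorm_multTest_radial_le (d := d) hr R N
  set L : ℝ := max (2 * Real.pi * R) 1 with hL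
  have hL1 : 1 ≤ L := le_max_right _ _
  refine ⟨N', C * (3 * L ^ 2), L⁻¹, by positivity, by positivity, fun s hs φ hφ => ?_⟩
  rw [expTest_taylor_eq]
  refine (h _ (contDiff_taylor s) (3 * L ^ 2 * s ^ 2) (by positivity) (fun i _ ρ h1 h2 => ?_)
    φ hφ).trans_eq (by ring)
  refine abs_iteratedDeriv_taylor_le hL1 ?_ (le_trans (by positivity) h1)
    (h2.trans (le_max_left _ _)) i
  rwa [← le_div_iff₀ (by positivity), one_div]

/-- `T` has order at most `N`, with constant `B`, on the frequency annulus `r ≤ |ξ| ≤ R`. -/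
def BoundedOn (r R : ℝ) (N : ℕ) (B : ℝ) (T : TDist d) : Prop :=
  ∀ φ : TestSpace d, SpectrumIn r R (φ : 𝓢(Tang d, ℂ)) → ‖T φ‖ ≤ B * schwartzNorm N φ

/-- The product rule for a curve of distributions tested with `e^{-τ(x)|∇'|} φ`.  Differentiability
of `V` is only assumed weakly; the interaction of both dependences on `x` is controlled by the
uniform order of `V` near `s` and by the quadratic Taylor estimate in Schwartz norms. -/
theorem hasDerivAt_apply_expTest {V : ℝ → TDist d} {V₁ : TDist d} {τ : ℝ → ℝ} {σ s : ℝ}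
    {φ : TestSpace d} {r R : ℝ} {N : ℕ} {B : ℝ} (hr : 0 < r)
    (hφ : SpectrumIn r R (φ : 𝓢(Tang d, ℂ)))
    (hV : ∀ ψ, HasDerivAt (fun x => V x ψ) (V₁ ψ) s) (hτ : HasDerivAt τ σ s)
    (hB : ∀ᶠ x in 𝓝 s, BoundedOn r R N B (V x)) :
    HasDerivAt (fun x => V x (expTest (τ x) φ))
      (V₁ (expTest (τ s) φ) - σ * V s (absTest (expTest (τ s) φ))) s := by
  set ψ := expTest (τ s) φ with hψ
  obtain ⟨N', C, δ, hC, hδ, hT⟩ := schwartzNorm_expTest_taylor_le (d := d) hr R N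
  have hψs : SpectrumIn r R (ψ : 𝓢(Tang d, ℂ)) := hφ.expTest _
  -- the first two Taylor terms involve fixed test functions; the remainder is `O(|x - s|²)`
  let Rem : ℝ → ℂ := fun x =>
    V x (expTest (τ x - τ s) ψ - ψ + ((τ x - τ s : ℝ) : ℂ) • absTest ψ)
  have hsplit : (fun x => V x (expTest (τ x) φ))
      = fun x => V x ψ - ((τ x - τ s : ℝ) : ℂ) * V x (absTest ψ) + Rem x := by
    ext x
    simp only [Rem, map_add, map_sub, map_smul, smul_eq_mul]
    rw [hψ, ← expTest_add, sub_add_cancel]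
    ring
  have hτ' : HasDerivAt (fun x => ((τ x - τ s : ℝ) : ℂ)) (σ : ℂ) s :=
    (hτ.sub_const (τ s)).ofReal_comp
  have hRem : HasDerivAt Rem 0 s := by
    have hO : Rem =O[𝓝 s] fun x => ‖x - s‖ ^ 2 := by
      have hO1 : (fun x => τ x - τ s) =O[𝓝 s] fun x => x - s := hτ.isBigO_sub
      have hO2 : Rem =O[𝓝 s] fun x => (τ x - τ s) ^ 2 := by
        refine Asymptotics.IsBigO.of_bound (|B| * (C * schwartzNorm N' ψ)) ?_
        have hnear : ∀ᶠ x in 𝓝 s, |τ x - τ s| ≤ δ := by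
          have := hτ.continuousAt.tendsto.eventually (Metric.closedBall_mem_nhds (τ s) hδ)
          filter_upwards [this] with x hx
          simpa [Real.dist_eq] using hx
        filter_upwards [hB, hnear] with x hx hx'
        have hsp : SpectrumIn r R ((expTest (τ x - τ s) ψ - ψ
            + ((τ x - τ s : ℝ) : ℂ) • absTest ψ : TestSpace d) : 𝓢(Tang d, ℂ)) := by
          rw [expTest_taylor_eq]
          exact hψs.multTest _
        have h1 := hx _ hsp
        have h2 := hT _ hx' ψ hψs
        rw [Real.norm_of_nonneg (sq_nonneg _)]
        calc ‖Rem x‖ ≤ B * schwartzNorm N _ := h1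
          _ ≤ |B| * schwartzNorm N _ :=
            mul_le_mul_of_nonneg_right (le_abs_self B) (schwartzNorm_nonneg _ _)
          _ ≤ |B| * (C * (τ x - τ s) ^ 2 * schwartzNorm N' ψ) := by gcongr
          _ = _ := by ring
      refine hO2.trans ?_
      have := hO1.pow 2
      simpa using this
    simpa using (hO.hasFDerivAt (𝕜 := ℝ) (by norm_num)).hasDerivAt
  rw [hsplit]
  have := ((hV ψ).sub (hτ'.mul (hV (absTest ψ)))).add hRem
  refine this.congr_deriv ?_
  simp

theorem continuous_apply_expTest {T : TDist d} {φ : TestSpace d} {r R : ℝ} {N : ℕ} {B : ℝ}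
    (hr : 0 < r) (hφ : SpectrumIn r R (φ : 𝓢(Tang d, ℂ))) (hB : BoundedOn r R N B T) :
    Continuous fun t => T (expTest t φ) :=
  continuous_iff_continuousAt.2 fun t =>
    (hasDerivAt_apply_expTest (V := fun _ => T) (V₁ := 0) hr hφ (fun _ => hasDerivAt_const _ _)
      (hasDerivAt_id t) (Eventually.of_forall fun _ => hB)).continuousAt

theorem hasDerivAt_apply_expTest_const {T : TDist d} {φ : TestSpace d} {r R : ℝ} {N : ℕ} {B : ℝ}
    (hr : 0 < r) (hφ : SpectrumIn r R (φ : 𝓢(Tang d, ℂ))) (hB : BoundedOn r R N B T)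
    {τ : ℝ → ℝ} {σ t : ℝ} (hτ : HasDerivAt τ σ t) :
    HasDerivAt (fun t => T (expTest (τ t) φ)) (-(σ * T (expTest (τ t) (absTest φ)))) t := by
  have := hasDerivAt_apply_expTest (V := fun _ => T) (V₁ := 0) hr hφ (fun _ => hasDerivAt_const _ _)
      hτ (Eventually.of_forall fun _ => hB)
  refine this.congr_deriv ?_
  simp [absTest_expTest]

/-- Weakly measurable curves of distributions remain measurable when they are tested with
`e^{-τ|∇'|} φ`, where `τ` varies measurably: `τ` is approximated by simple functions. -/
theorem aestronglyMeasurable_apply_expTest {α : Type*} [MeasurableSpace α] {μ : Measure α}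
    {f : α → TDist d} (hf : ∀ φ, AEStronglyMeasurable (fun a => f a φ) μ) {τ : α → ℝ}
    (hτ : Measurable τ) {φ : TestSpace d} {r R : ℝ} (hr : 0 < r)
    (hφ : SpectrumIn r R (φ : 𝓢(Tang d, ℂ))) (hb : ∀ᵐ a ∂μ, ∃ N B, BoundedOn r R N B (f a)) :
    AEStronglyMeasurable (fun a => f a (expTest (τ a) φ)) μ := by
  have hs : StronglyMeasurable τ := hτ.stronglyMeasurable
  refine aestronglyMeasurable_of_tendsto_ae atTop
    (f := fun n a => f a (expTest (hs.approx n a) φ)) (fun n => ?_) ?_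
  · have e : (fun a => f a (expTest (hs.approx n a) φ)) = fun a =>
        ∑ v ∈ (hs.approx n).range,
          (hs.approx n ⁻¹' {v}).indicator (fun a => f a (expTest v φ)) a := by
      ext a
      rw [Finset.sum_eq_single (hs.approx n a)]
      · simp
      · intro v _ hv
        rw [indicator_of_notMem]
        simpa using hv.symm
      · intro h
        exact absurd (SimpleFunc.mem_range_self _ _) h
    rw [e]
    refine Finset.aestronglyMeasurable_fun_sum _ fun v _ => ?_
    exact (hf _).indicator ((hs.approx n).measurableSet_fiber v)
  · filter_upwards [hb] with a ha
    obtain ⟨N, B, hB⟩ := ha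
    exact ((continuous_apply_expTest hr hφ hB).tendsto _).comp (hs.tendsto_approx a)

/-! ### Bounded functionals and tame curves -/

theorem BoundedOn.mono {r R : ℝ} {N N' : ℕ} {B B' : ℝ} {T : TDist d} (h : BoundedOn r R N B T)
    (hN : N ≤ N') (hB0 : 0 ≤ B) (hB : B ≤ B') : BoundedOn r R N' B' T := fun φ hφ =>
  (h φ hφ).trans (mul_le_mul hB (schwartzNorm_mono hN φ) (schwartzNorm_nonneg _ _)
    (hB0.trans hB))

theorem BoundedOn.add {r R : ℝ} {N N' : ℕ} {B B' : ℝ} {T T' : TDist d} (h : BoundedOn r R N B T)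
    (h' : BoundedOn r R N' B' T') (hB : 0 ≤ B) (hB' : 0 ≤ B') :
    BoundedOn r R (max N N') (B + B') (T + T') := fun φ hφ => by
  rw [LinearMap.add_apply, add_mul]
  exact (norm_add_le _ _).trans (add_le_add
    (h.mono (le_max_left _ _) hB le_rfl φ hφ) (h'.mono (le_max_right _ _) hB' le_rfl φ hφ))

theorem BoundedOn.smul {r R : ℝ} {N : ℕ} {B : ℝ} {T : TDist d} (h : BoundedOn r R N B T) (c : ℂ) :
    BoundedOn r R N (‖c‖ * B) (c • T) := fun φ hφ => by
  rw [LinearMap.smul_apply, norm_smul, mul_assoc]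
  exact mul_le_mul_of_nonneg_left (h φ hφ) (norm_nonneg _)

theorem exists_boundedOn_mult (m : Symb d) {r : ℝ} (hr : 0 < r) (R : ℝ) (N : ℕ) :
    ∃ (N' : ℕ) (C : ℝ), 0 ≤ C ∧ ∀ (T : TDist d) (B : ℝ), 0 ≤ B → BoundedOn r R N B T →
      BoundedOn r R N' (C * B) (mult m T) := by
  obtain ⟨N', C, hC, h⟩ := schwartzNorm_multTest_le_of_symb m.reflect hr R N
  refine ⟨N', C, hC, fun T B hB hT φ hφ => ?_⟩
  rw [mult_apply]
  calc _ ≤ B * schwartzNorm N _ := hT _ (hφ.multTest _)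
    _ ≤ B * (C * schwartzNorm N' φ) := by gcongr; exact h φ hφ
    _ = _ := by ring

theorem exists_boundedOn_poisson {r : ℝ} (hr : 0 < r) (R : ℝ) (N : ℕ) :
    ∃ (N' : ℕ) (C : ℝ), 0 ≤ C ∧ ∀ t : ℝ, 0 ≤ t → ∀ (T : TDist d) (B : ℝ), 0 ≤ B →
      BoundedOn r R N B T → BoundedOn r R N' (C * Real.exp (-(2 * r * t)) * B) (poisson t T) := by
  obtain ⟨N', C, hC, h⟩ := schwartzNorm_expTest_le (d := d) hr R N
  refine ⟨N', C, hC, fun t ht T B hB hT φ hφ => ?_⟩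
  rw [poisson_apply]
  calc _ ≤ B * schwartzNorm N _ := hT _ (hφ.expTest _)
    _ ≤ B * (C * Real.exp (-(2 * r * t)) * schwartzNorm N' φ) := by gcongr; exact h t ht φ hφ
    _ = _ := by ring

theorem isDistribution_iff {T : TDist d} : IsDistribution T ↔
    ∀ r R : ℝ, 0 < r → ∃ (N : ℕ) (B : ℝ), 0 ≤ B ∧ BoundedOn r R N B T := by
  refine forall₃_congr fun r R _ => ⟨fun ⟨N, B, h⟩ => ⟨N, |B|, abs_nonneg _, fun φ hφ => ?_⟩,
    fun ⟨N, B, _, h⟩ => ⟨N, B, h⟩⟩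
  exact (h φ hφ).trans (mul_le_mul_of_nonneg_right (le_abs_self B) (schwartzNorm_nonneg _ _))

theorem IsDistribution.mult {T : TDist d} (h : IsDistribution T) (m : Symb d) :
    IsDistribution (mult m T) := by
  rw [isDistribution_iff] at h ⊢
  intro r R hr
  obtain ⟨N, B, hB, hT⟩ := h r R hr
  obtain ⟨N', C, hC, hm⟩ := exists_boundedOn_mult m hr R N
  exact ⟨N', C * B, by positivity, hm T B hB hT⟩

theorem IsDistribution.add {T T' : TDist d} (h : IsDistribution T) (h' : IsDistribution T') :
    IsDistribution (T + T') := by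
  rw [isDistribution_iff] at *
  intro r R hr
  obtain ⟨N, B, hB, hT⟩ := h r R hr
  obtain ⟨N', B', hB', hT'⟩ := h' r R hr
  exact ⟨_, _, by positivity, hT.add hT' hB hB'⟩

theorem IsDistribution.smul {T : TDist d} (h : IsDistribution T) (c : ℂ) :
    IsDistribution (c • T) := by
  rw [isDistribution_iff] at *
  intro r R hr
  obtain ⟨N, B, hB, hT⟩ := h r R hr
  exact ⟨_, _, by positivity, hT.smul c⟩

theorem IsDistribution.sub {T T' : TDist d} (h : IsDistribution T) (h' : IsDistribution T') :
    IsDistribution (T - T') := by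
  have := h.add (h'.smul (-1))
  rwa [neg_one_smul, ← sub_eq_add_neg] at this

theorem IsDistribution.sum {ι : Type*} (s : Finset ι) {T : ι → TDist d}
    (h : ∀ i ∈ s, IsDistribution (T i)) : IsDistribution (∑ i ∈ s, T i) := by
  classical
  induction s using Finset.induction_on with
  | empty => exact fun r R hr => ⟨0, 0, fun φ _ => by simp⟩
  | insert i s hi ih =>
    rw [Finset.sum_insert hi]
    exact (h i (by simp)).add (ih fun j hj => h j (by simp [hj]))

/-- The dominating functions of a tame curve can be taken nonnegative. -/
theorem IsTame.exists_bound {I : Set ℝ} {f : ℝ → TDist d} (hf : IsTame I f) {r : ℝ} (hr : 0 < r)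
    (R : ℝ) : ∃ (N : ℕ) (g : ℝ → ℝ), (∀ y, 0 ≤ g y) ∧
      (∀ ε : ℝ, 0 < ε → IntegrableOn (fun y => Real.exp (-ε * |y|) * g y) I) ∧
      ∀ᵐ y ∂volume.restrict I, BoundedOn r R N (g y) (f y) := by
  obtain ⟨N, g, hg, hb⟩ := hf.2 r R hr
  refine ⟨N, fun y => |g y|, fun y => abs_nonneg _, fun ε hε => ?_, ?_⟩
  · refine (hg ε hε).norm.congr (Eventually.of_forall fun y => ?_)
    simp
  · filter_upwards [hb] with y hy φ hφ
    exact (hy φ hφ).trans (mul_le_mul_of_nonneg_right (le_abs_self _) (schwartzNorm_nonneg _ _))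

theorem IsTame.mono {I J : Set ℝ} {f : ℝ → TDist d} (hf : IsTame I f) (h : J ⊆ I) :
    IsTame J f := by
  refine ⟨fun φ => (hf.1 φ).mono_measure (Measure.restrict_mono h le_rfl), fun r R hr => ?_⟩
  obtain ⟨N, g, hg, hb⟩ := hf.2 r R hr
  exact ⟨N, g, fun ε hε => (hg ε hε).mono_set h, ae_restrict_of_ae_restrict_of_subset h hb⟩

theorem IsTame.add {I : Set ℝ} {f f' : ℝ → TDist d} (hf : IsTame I f) (hf' : IsTame I f') :
    IsTame I (fun y => f y + f' y) := by
  refine ⟨fun φ => (hf.1 φ).add (hf'.1 φ), fun r R hr => ?_⟩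
  obtain ⟨N, g, hg0, hg, hb⟩ := hf.exists_bound hr R
  obtain ⟨N', g', hg0', hg', hb'⟩ := hf'.exists_bound hr R
  refine ⟨max N N', fun y => g y + g' y, fun ε hε => ?_, ?_⟩
  · simp only [mul_add]
    exact (hg ε hε).add (hg' ε hε)
  · filter_upwards [hb, hb'] with y hy hy'
    exact hy.add hy' (hg0 y) (hg0' y)

theorem IsTame.smul {I : Set ℝ} {f : ℝ → TDist d} (hf : IsTame I f) (c : ℂ) :
    IsTame I (fun y => c • f y) := by
  refine ⟨fun φ => (hf.1 φ).const_smul c, fun r R hr => ?_⟩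
  obtain ⟨N, g, hg0, hg, hb⟩ := hf.exists_bound hr R
  refine ⟨N, fun y => ‖c‖ * g y, fun ε hε => ?_, ?_⟩
  · refine ((hg ε hε).const_mul ‖c‖).congr (Eventually.of_forall fun y => ?_)
    ring
  · filter_upwards [hb] with y hy
    exact hy.smul c

theorem IsTame.neg {I : Set ℝ} {f : ℝ → TDist d} (hf : IsTame I f) :
    IsTame I (fun y => -f y) := by
  simpa only [neg_one_smul] using hf.smul (-1)

theorem IsTame.sub {I : Set ℝ} {f f' : ℝ → TDist d} (hf : IsTame I f) (hf' : IsTame I f') :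
    IsTame I (fun y => f y - f' y) := by
  simpa only [sub_eq_add_neg] using hf.add hf'.neg

theorem IsTame.zero {I : Set ℝ} : IsTame I (fun _ => (0 : TDist d)) :=
  ⟨fun _ => aestronglyMeasurable_const, fun r R _ =>
    ⟨0, 0, fun ε _ => by simp,
      Eventually.of_forall fun y φ _ => by simp⟩⟩

theorem IsTame.sum {I : Set ℝ} {ι : Type*} (s : Finset ι) {f : ι → ℝ → TDist d}
    (h : ∀ i ∈ s, IsTame I (f i)) : IsTame I (fun y => ∑ i ∈ s, f i y) := by
  classical
  induction s using Finset.induction_on with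
  | empty => simpa using IsTame.zero
  | insert i s hi ih =>
    simp only [Finset.sum_insert hi]
    exact (h i (by simp)).add (ih fun j hj => h j (by simp [hj]))

theorem IsTame.mult {I : Set ℝ} {f : ℝ → TDist d} (hf : IsTame I f) (m : Symb d) :
    IsTame I (fun y => mult m (f y)) := by
  refine ⟨fun φ => hf.1 (multTest m.reflect φ), fun r R hr => ?_⟩
  obtain ⟨N, g, hg0, hg, hb⟩ := hf.exists_bound hr R
  obtain ⟨N', C, hC, hm⟩ := exists_boundedOn_mult m hr R N
  refine ⟨N', fun y => C * g y, fun ε hε => ?_, ?_⟩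
  · refine ((hg ε hε).const_mul C).congr (Eventually.of_forall fun y => ?_)
    ring
  · filter_upwards [hb] with y hy
    exact hm _ _ (hg0 y) hy

theorem IsTame.isLocInt {I : Set ℝ} (hI : IsLocallyClosed I) {f : ℝ → TDist d} (hf : IsTame I f) :
    IsLocInt I f := by
  refine ⟨hf.1, fun r R hr => ?_⟩
  obtain ⟨N, g, hg, hb⟩ := hf.2 r R hr
  refine ⟨N, g, ?_, hb⟩
  have h1 : LocallyIntegrableOn (fun y => Real.exp |y| * (Real.exp (-1 * |y|) * g y)) I :=
    (hg 1 one_pos).locallyIntegrableOn.continuousOn_mul (by fun_prop) hI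
  refine h1.congr (Eventually.of_forall fun y => ?_)
  rw [← mul_assoc, ← Real.exp_add]
  simp

theorem IsLocInt.locallyIntegrableOn {I : Set ℝ} (hI : IsLocallyClosed I) {f : ℝ → TDist d}
    (hf : IsLocInt I f) (φ : TestSpace d) : LocallyIntegrableOn (fun y => f y φ) I := by
  obtain ⟨r, R, hr, hφ⟩ := φ.2
  obtain ⟨N, g, hg, hb⟩ := hf.2 r R hr
  rw [locallyIntegrableOn_iff hI] at hg ⊢
  intro K hKI hK
  refine Integrable.mono' ((hg K hKI hK).mul_const (schwartzNorm N φ))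
    ((hf.1 φ).mono_measure (Measure.restrict_mono hKI le_rfl)) ?_
  filter_upwards [ae_restrict_of_ae_restrict_of_subset hKI hb] with y hy
  exact hy φ hφ

theorem IsTame.locallyIntegrableOn {I : Set ℝ} (hI : IsLocallyClosed I) {f : ℝ → TDist d}
    (hf : IsTame I f) (φ : TestSpace d) : LocallyIntegrableOn (fun y => f y φ) I :=
  (hf.isLocInt hI).locallyIntegrableOn hI φ

/-- Two tame curves on the half line, one of them reflected, fit together to a tame curve on the
line. -/
theorem IsTame.ite {f f' : ℝ → TDist d} (hf : IsTame (Ioi 0) f) (hf' : IsTame (Ioi 0) f') :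
    IsTame univ (fun y => if 0 ≤ y then f y else f' (-y)) := by
  have hneg : MeasurePreserving (fun y : ℝ => -y) (volume.restrict (Iio 0))
      (volume.restrict (Ioi 0)) := by
    have := (Measure.measurePreserving_neg (volume : Measure ℝ)).restrict_preimage
      (s := Ioi 0) measurableSet_Ioi
    simpa using this
  have hIci : volume.restrict (Ici (0 : ℝ)) = volume.restrict (Ioi 0) :=
    Measure.restrict_congr_set Ioi_ae_eq_Ici.symm
  have hc : (Ici (0 : ℝ))ᶜ = Iio 0 := compl_Ici
  refine ⟨fun φ => ?_, fun r R hr => ?_⟩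
  · rw [Measure.restrict_univ]
    have h : (fun y => (if 0 ≤ y then f y else f' (-y)) φ)
        = (Ici (0 : ℝ)).piecewise (fun y => f y φ) (fun y => f' (-y) φ) := by
      ext y
      by_cases hy : 0 ≤ y
      · simp [hy]
      · simp [hy]
    rw [h]
    refine AEStronglyMeasurable.piecewise measurableSet_Ici ?_ ?_
    · rw [hIci]
      exact hf.1 φ
    · rw [hc]
      exact (hf'.1 φ).comp_measurePreserving hneg
  · obtain ⟨N, g, hg0, hg, hb⟩ := hf.exists_bound hr R
    obtain ⟨N', g', hg0', hg', hb'⟩ := hf'.exists_bound hr R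
    refine ⟨max N N', (Ici (0 : ℝ)).piecewise g (fun y => g' (-y)), fun ε hε => ?_, ?_⟩
    · have hu : (univ : Set ℝ) = Ici 0 ∪ Iio 0 := by
        ext y
        simp
      rw [hu]
      refine IntegrableOn.union ?_ ?_
      · rw [integrableOn_Ici_iff_integrableOn_Ioi]
        refine (hg ε hε).congr_fun (fun y hy => ?_) measurableSet_Ioi
        simp [(mem_Ioi.1 hy).le]
      · have h1 : Integrable ((fun y => Real.exp (-ε * |y|) * g' y) ∘ fun y => -y)
            (volume.restrict (Iio 0)) := hneg.integrable_comp_of_integrable (hg' ε hε)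
        refine IntegrableOn.congr_fun h1 (fun y hy => ?_) measurableSet_Iio
        simp [not_le.2 (mem_Iio.1 hy)]
    · have h1 := hb'
      have h2 : ∀ᵐ y ∂volume.restrict (Iio (0 : ℝ)), BoundedOn r R N' (g' (-y)) (f' (-y)) :=
        hneg.quasiMeasurePreserving.ae hb'
      rw [← hIci] at hb
      rw [← hc] at h2
      rw [Measure.restrict_univ]
      refine ae_of_ae_restrict_of_ae_restrict_compl (Ici (0 : ℝ)) ?_ ?_
      · filter_upwards [hb, ae_restrict_mem measurableSet_Ici] with y hy hy0
        have : (0 : ℝ) ≤ y := hy0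
        simp only [this, if_true, piecewise_eq_of_mem _ _ _ hy0]
        exact hy.mono (le_max_left _ _) (hg0 y) le_rfl
      · filter_upwards [h2, ae_restrict_mem measurableSet_Ici.compl] with y hy hy0
        have : ¬ (0 : ℝ) ≤ y := hy0
        simp only [this, if_false, piecewise_eq_of_notMem _ _ _ hy0]
        exact hy.mono (le_max_right _ _) (hg0' _) le_rfl

theorem isTame_extendForce {F : ℝ → Fin (d + 1) → Fin (d + 1) → TDist d}
    (hF : ∀ k l, IsTame (Ioi 0) fun y => F y k l) (k l : Fin (d + 1)) :
    IsTame univ (fun y => extendForce F y k l) := by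
  by_cases hl : l = Fin.last d
  · simpa [extendForce, hl] using (hF k (Fin.last d)).ite (hF k (Fin.last d)).neg
  · simpa [extendForce, hl] using (hF k l).ite (hF k l)

/-! ### Convolutions with Poisson-type kernels in the normal variable -/

theorem weakIntegral_apply {α : Type*} [MeasurableSpace α] {μ : Measure α} {f : α → TDist d}
    (h : ∀ φ, Integrable (fun y => f y φ) μ) (φ : TestSpace d) :
    weakIntegral μ f φ = ∫ y, f y φ ∂μ := by
  rw [weakIntegral, dif_pos h]
  rfl

/-- The curve `x ↦ ∫ c(x - y) e^{-|x - y||∇'|} f(y) dy`. -/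
def pconv (c : ℝ → ℝ) (f : ℝ → TDist d) (x : ℝ) : TDist d :=
  weakIntegral volume fun y => (c (x - y) : ℂ) • poisson |x - y| (f y)

/-- Scalar factors of at most linear growth that are continuous away from the origin. -/
structure IsFactor (c : ℝ → ℝ) : Prop where
  measurable : Measurable c
  bound : ∀ z, |c z| ≤ 1 + |z|
  continuousAt : ∀ z, z ≠ 0 → ContinuousAt c z

/-- A factor of linear growth costs half of the exponential decay. -/
theorem one_add_mul_exp_le {r t : ℝ} (hr : 0 < r) (ht : 0 ≤ t) :
    (1 + t) * Real.exp (-(2 * r * t)) ≤ (1 + r⁻¹) * Real.exp (-r * t) := by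
  have h1 : 1 + t ≤ (1 + r⁻¹) * Real.exp (r * t) := by
    have h2 := Real.add_one_le_exp (r * t)
    have h3 : (1 + r⁻¹) * (r * t + 1) = 1 + t + r * t + r⁻¹ := by field_simp; ring
    have h4 : (1 + r⁻¹) * (r * t + 1) ≤ (1 + r⁻¹) * Real.exp (r * t) := by gcongr
    have h5 : 0 ≤ r * t + r⁻¹ := by positivity
    linarith
  calc _ ≤ (1 + r⁻¹) * Real.exp (r * t) * Real.exp (-(2 * r * t)) := by gcongr
    _ = _ := by
      rw [mul_assoc, ← Real.exp_add]
      ring_nf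

/-- For almost every `y`, the functional `(1 + |z|) e^{-|z||∇'|} f(y)` decays exponentially in `z` on a
frequency annulus, with a dominating function `h` as in the definition of tameness. -/
theorem IsTame.exists_kernel_bound {f : ℝ → TDist d} (hf : IsTame univ f) {r : ℝ} (hr : 0 < r)
    (R : ℝ) : ∃ (N : ℕ) (h : ℝ → ℝ), (∀ y, 0 ≤ h y) ∧
      (∀ ε : ℝ, 0 < ε → Integrable (fun y => Real.exp (-ε * |y|) * h y)) ∧
      ∀ᵐ y, (∃ N B, BoundedOn r R N B (f y)) ∧ ∀ (z : ℝ) (φ : TestSpace d),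
        SpectrumIn r R (φ : 𝓢(Tang d, ℂ)) →
        (1 + |z|) * ‖f y (expTest |z| φ)‖ ≤ Real.exp (-r * |z|) * h y * schwartzNorm N φ := by
  obtain ⟨N, g, hg0, hg, hb⟩ := hf.exists_bound hr R
  obtain ⟨N', C, hC, hp⟩ := exists_boundedOn_poisson (d := d) hr R N
  rw [Measure.restrict_univ] at hb
  refine ⟨N', fun y => C * (1 + r⁻¹) * g y, fun y => mul_nonneg (by positivity) (hg0 y),
    fun ε hε => ?_, ?_⟩
  · have := ((integrableOn_univ.1 (hg ε hε)).const_mul (C * (1 + r⁻¹)))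
    refine this.congr (Eventually.of_forall fun y => ?_)
    ring
  · filter_upwards [hb] with y hy
    refine ⟨⟨N, g y, hy⟩, fun z φ hφ => ?_⟩
    have h1 := hp |z| (abs_nonneg z) (f y) (g y) (hg0 y) hy φ hφ
    rw [poisson_apply] at h1
    have h2 := one_add_mul_exp_le hr (abs_nonneg z)
    have h3 := schwartzNorm_nonneg N' φ
    have h4 := hg0 y
    calc (1 + |z|) * ‖f y (expTest |z| φ)‖
        ≤ (1 + |z|) * (C * Real.exp (-(2 * r * |z|)) * g y * schwartzNorm N' φ) := by gcongr
      _ = C * ((1 + |z|) * Real.exp (-(2 * r * |z|))) * g y * schwartzNorm N' φ := by ring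
      _ ≤ C * ((1 + r⁻¹) * Real.exp (-r * |z|)) * g y * schwartzNorm N' φ := by gcongr
      _ = _ := by ring

theorem exp_neg_mul_abs_sub_le {κ : ℝ} (hκ : 0 ≤ κ) (x y : ℝ) :
    Real.exp (-κ * |x - y|) ≤ Real.exp (κ * |x|) * Real.exp (-κ * |y|) := by
  rw [← Real.exp_add]
  refine Real.exp_le_exp.2 ?_
  have : |y| ≤ |x| + |x - y| := by
    have := abs_sub_abs_le_abs_sub y x
    rw [abs_sub_comm] at this
    linarith
  nlinarith

theorem IsTame.aestronglyMeasurable_kernel {f : ℝ → TDist d} (hf : IsTame univ f) {c : ℝ → ℝ}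
    (hc : IsFactor c) (x : ℝ) (φ : TestSpace d) :
    AEStronglyMeasurable (fun y => (c (x - y) : ℂ) * f y (expTest |x - y| φ)) := by
  obtain ⟨r, R, hr, hφ⟩ := φ.2
  obtain ⟨N, h, h0, hi, hb⟩ := hf.exists_kernel_bound hr R
  refine AEStronglyMeasurable.mul ?_ ?_
  · exact (Complex.measurable_ofReal.comp (hc.measurable.comp
      (measurable_const.sub measurable_id))).aestronglyMeasurable
  · refine aestronglyMeasurable_apply_expTest (fun ψ => ?_) (by fun_prop) hr hφ ?_
    · simpa using hf.1 ψ
    · filter_upwards [hb] with y hy using hy.1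

theorem norm_kernel_le {c : ℝ → ℝ} (hc : IsFactor c) {z B : ℝ} {w : ℂ}
    (h : (1 + |z|) * ‖w‖ ≤ B) : ‖(c z : ℂ) * w‖ ≤ B := by
  rw [norm_mul, Complex.norm_real, Real.norm_eq_abs]
  exact (mul_le_mul_of_nonneg_right (hc.bound z) (norm_nonneg _)).trans h

theorem IsTame.integrable_kernel {f : ℝ → TDist d} (hf : IsTame univ f) {c : ℝ → ℝ}
    (hc : IsFactor c) (x : ℝ) (φ : TestSpace d) :
    Integrable (fun y => (c (x - y) : ℂ) * f y (expTest |x - y| φ)) := by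
  obtain ⟨r, R, hr, hφ⟩ := φ.2
  obtain ⟨N, h, h0, hi, hb⟩ := hf.exists_kernel_bound hr R
  refine Integrable.mono' (((hi r hr).const_mul (Real.exp (r * |x|))).mul_const (schwartzNorm N φ))
    (hf.aestronglyMeasurable_kernel hc x φ) ?_
  filter_upwards [hb] with y hy
  refine (norm_kernel_le hc (hy.2 (x - y) φ hφ)).trans ?_
  have := exp_neg_mul_abs_sub_le hr.le x y
  have h1 := h0 y
  have h2 := schwartzNorm_nonneg N φ
  calc _ ≤ Real.exp (r * |x|) * Real.exp (-r * |y|) * h y * schwartzNorm N φ := by gcongr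
    _ = _ := by ring

theorem IsTame.pconv_apply {f : ℝ → TDist d} (hf : IsTame univ f) {c : ℝ → ℝ}
    (hc : IsFactor c) (x : ℝ) (φ : TestSpace d) :
    pconv c f x φ = ∫ y, (c (x - y) : ℂ) * f y (expTest |x - y| φ) := by
  have e : ∀ y φ, ((c (x - y) : ℂ) • poisson |x - y| (f y)) φ
      = (c (x - y) : ℂ) * f y (expTest |x - y| φ) := fun y φ => by
    rw [LinearMap.smul_apply, poisson_apply, smul_eq_mul]
  rw [pconv, weakIntegral_apply]
  · simp only [e]
  · intro φ
    simp only [e]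
    exact hf.integrable_kernel hc x φ

theorem pconv_mult {f : ℝ → TDist d} (hf : IsTame univ f) {c : ℝ → ℝ} (hc : IsFactor c)
    (m : Symb d) (x : ℝ) : pconv c (fun y => mult m (f y)) x = mult m (pconv c f x) := by
  ext φ
  rw [(hf.mult m).pconv_apply hc, mult_apply, hf.pconv_apply hc]
  refine integral_congr_ae (Eventually.of_forall fun y => ?_)
  simp only [mult_apply]
  rw [expTest, multTest_comm]

theorem pconv_sum {ι : Type*} (s : Finset ι) {f : ι → ℝ → TDist d}
    (hf : ∀ i ∈ s, IsTame univ (f i)) {c : ℝ → ℝ} (hc : IsFactor c) (x : ℝ) :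
    pconv c (fun y => ∑ i ∈ s, f i y) x = ∑ i ∈ s, pconv c (f i) x := by
  ext φ
  rw [(IsTame.sum s hf).pconv_apply hc, LinearMap.coe_sum, Finset.sum_apply,
    Finset.sum_congr rfl (fun i hi => (hf i hi).pconv_apply hc x φ),
    ← integral_finsetSum _ (fun i hi => (hf i hi).integrable_kernel hc x φ)]
  simp only [LinearMap.coe_sum, Finset.sum_apply, Finset.mul_sum]

theorem integrable_exp_neg_mul_abs {a : ℝ} (ha : 0 < a) :
    Integrable fun x : ℝ => Real.exp (-a * |x|) := by
  have h1 : IntegrableOn (fun x : ℝ => Real.exp (-a * |x|)) (Ioi 0) :=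
    (exp_neg_integrableOn_Ioi 0 ha).congr_fun (fun x hx => by
      simp only [abs_of_pos (mem_Ioi.1 hx)]) measurableSet_Ioi
  have h2 : IntegrableOn (fun x : ℝ => Real.exp (-a * |x|)) (Iic 0) := by
    refine (integrableOn_exp_mul_Iic ha 0).congr_fun (fun x hx => ?_) measurableSet_Iic
    simp only [abs_of_nonpos (mem_Iic.1 hx), neg_mul_neg]
  have := h2.union h1
  rwa [Iic_union_Ioi, integrableOn_univ] at this

/-- The convolutions are weakly continuous: their kernels jump only on the diagonal. -/
theorem continuous_pconv {f : ℝ → TDist d} (hf : IsTame univ f) {c : ℝ → ℝ} (hc : IsFactor c)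
    (φ : TestSpace d) : Continuous fun x => pconv c f x φ := by
  obtain ⟨r, R, hr, hφ⟩ := φ.2
  obtain ⟨N, h, h0, hi, hb⟩ := hf.exists_kernel_bound hr R
  simp only [hf.pconv_apply hc]
  refine continuous_iff_continuousAt.2 fun x₀ => ?_
  refine continuousAt_of_dominated (bound := fun y =>
    Real.exp (r * (|x₀| + 1)) * (Real.exp (-r * |y|) * h y) * schwartzNorm N φ)
    (Eventually.of_forall fun x => hf.aestronglyMeasurable_kernel hc x φ) ?_
    (((hi r hr).const_mul _).mul_const _) ?_
  · filter_upwards [Metric.ball_mem_nhds x₀ one_pos] with x hx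
    filter_upwards [hb] with y hy
    refine (norm_kernel_le hc (hy.2 (x - y) φ hφ)).trans ?_
    have h1 := h0 y
    have h2 := schwartzNorm_nonneg N φ
    have h3 : |x| ≤ |x₀| + 1 := by
      have := abs_sub_abs_le_abs_sub x x₀
      rw [Metric.mem_ball, Real.dist_eq] at hx
      linarith
    calc _ ≤ Real.exp (r * |x|) * Real.exp (-r * |y|) * h y * schwartzNorm N φ := by
          gcongr
          exact exp_neg_mul_abs_sub_le hr.le x y
      _ ≤ Real.exp (r * (|x₀| + 1)) * Real.exp (-r * |y|) * h y * schwartzNorm N φ := by gcongr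
      _ = _ := by ring
  · have hne : ∀ᵐ y : ℝ, y ≠ x₀ := by
      simp [ae_iff, measure_singleton]
    filter_upwards [hb, hne] with y hy hy0
    obtain ⟨N', B, hB⟩ := hy.1
    have h1 : ContinuousAt (fun x => c (x - y)) x₀ :=
      ContinuousAt.comp (g := c) (f := fun x => x - y) (hc.continuousAt _ (sub_ne_zero.2 hy0.symm))
        (by fun_prop)
    exact (Complex.continuous_ofReal.continuousAt.comp h1).mul
      ((continuous_apply_expTest hr hφ hB).comp (by fun_prop : Continuous fun x : ℝ =>
        |x - y|)).continuousAt

/-- The convolutions are tame.  For `κ ≤ r` the kernel `e^{-r|x - y|}` is at most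
`e^{κ|x|} e^{-κ|y|}`, so that convolution only loses an arbitrarily small exponential rate `κ`. -/
theorem IsTame.pconv {f : ℝ → TDist d} (hf : IsTame univ f) {c : ℝ → ℝ} (hc : IsFactor c) :
    IsTame univ (pconv c f) := by
  refine ⟨fun φ => (continuous_pconv hf hc φ).aestronglyMeasurable, fun r R hr => ?_⟩
  obtain ⟨N, h, h0, hi, hb⟩ := hf.exists_kernel_bound hr R
  have hle : ∀ κ : ℝ, 0 < κ → κ ≤ r → ∀ x y, Real.exp (-r * |x - y|) * h y
      ≤ Real.exp (κ * |x|) * (Real.exp (-κ * |y|) * h y) := fun κ hκ hκr x y => by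
    rw [← mul_assoc]
    refine mul_le_mul_of_nonneg_right (le_trans (Real.exp_le_exp.2 ?_)
      (exp_neg_mul_abs_sub_le hκ.le x y)) (h0 y)
    nlinarith [abs_nonneg (x - y)]
  have hm : AEStronglyMeasurable h := by
    have h1 : AEStronglyMeasurable (fun y : ℝ => Real.exp |y|) :=
      (by fun_prop : Continuous fun y : ℝ => Real.exp |y|).aestronglyMeasurable
    refine (h1.mul (hi 1 one_pos).aestronglyMeasurable).congr (Eventually.of_forall fun y => ?_)
    simp only [Pi.mul_apply]
    rw [← mul_assoc, ← Real.exp_add]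
    simp
  have hprod : AEStronglyMeasurable (fun p : ℝ × ℝ => Real.exp (-r * |p.1 - p.2|) * h p.2)
      (volume.prod volume) :=
    (by fun_prop : Continuous fun p : ℝ × ℝ =>
      Real.exp (-r * |p.1 - p.2|)).aestronglyMeasurable.mul hm.comp_snd
  have hint : ∀ x, Integrable fun y => Real.exp (-r * |x - y|) * h y := fun x => by
    refine Integrable.mono' ((hi r hr).const_mul (Real.exp (r * |x|))) ?_ ?_
    · exact (by fun_prop : Continuous fun y : ℝ =>
        Real.exp (-r * |x - y|)).aestronglyMeasurable.mul hm
    · refine Eventually.of_forall fun y => ?_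
      rw [Real.norm_of_nonneg (mul_nonneg (Real.exp_pos _).le (h0 y))]
      exact hle r hr le_rfl x y
  refine ⟨N, fun x => ∫ y, Real.exp (-r * |x - y|) * h y, fun ε hε => ?_, ?_⟩
  · rw [integrableOn_univ]
    set κ := min (ε / 2) r with hκ
    have hκ0 : 0 < κ := lt_min (by linarith) hr
    have hκε : κ ≤ ε / 2 := min_le_left _ _
    set M := ∫ y, Real.exp (-κ * |y|) * h y with hM
    have hM0 : 0 ≤ M := integral_nonneg fun y => mul_nonneg (Real.exp_pos _).le (h0 y)
    refine Integrable.mono' ((integrable_exp_neg_mul_abs (half_pos hε)).mul_const M) ?_ ?_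
    · exact (by fun_prop : Continuous fun x : ℝ => Real.exp (-ε * |x|)).aestronglyMeasurable.mul
        hprod.integral_prod_right'
    · refine Eventually.of_forall fun x => ?_
      have h1 : 0 ≤ ∫ y, Real.exp (-r * |x - y|) * h y :=
        integral_nonneg fun y => mul_nonneg (Real.exp_pos _).le (h0 y)
      rw [Real.norm_of_nonneg (mul_nonneg (Real.exp_pos _).le h1)]
      have h2 : ∫ y, Real.exp (-r * |x - y|) * h y ≤ Real.exp (κ * |x|) * M := by
        rw [hM, ← integral_const_mul]
        exact integral_mono (hint x) ((hi κ hκ0).const_mul _) (hle κ hκ0 (min_le_right _ _) x)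
      calc _ ≤ Real.exp (-ε * |x|) * (Real.exp (κ * |x|) * M) := by gcongr
        _ = Real.exp ((κ - ε) * |x|) * M := by
          rw [← mul_assoc, ← Real.exp_add]
          ring_nf
        _ ≤ Real.exp (-(ε / 2) * |x|) * M := by
          gcongr
          linarith
  · refine Eventually.of_forall fun x φ hφ => ?_
    rw [hf.pconv_apply hc, ← integral_mul_const]
    refine norm_integral_le_of_norm_le ((hint x).mul_const _) ?_
    filter_upwards [hb] with y hy
    exact norm_kernel_le hc (hy.2 (x - y) φ hφ)

/-! ### Weak derivatives of curves -/

theorem integrable_cutoff_mul {I : Set ℝ} {g : ℝ → ℂ}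
    (hg : LocallyIntegrableOn g I) {θ : ℝ → ℝ} (hθ : Continuous θ) (hc : HasCompactSupport θ)
    (hs : tsupport θ ⊆ I) : Integrable fun y => (θ y : ℂ) * g y := by
  have h1 : IntegrableOn g (tsupport θ) := hg.integrableOn_compact_subset hs hc
  have h2 : IntegrableOn (fun y => (θ y : ℂ) * g y) (tsupport θ) :=
    h1.continuousOn_mul (by fun_prop) hc
  refine (integrableOn_iff_integrable_of_support_subset fun y hy => ?_).1 h2
  refine subset_tsupport θ fun h0 => hy ?_
  simp [h0]

/-- `v` is the weak derivative of the curve `u` in the normal variable on `I`. -/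
structure HasWeakDeriv (I : Set ℝ) (u v : ℝ → TDist d) : Prop where
  left : ∀ φ, LocallyIntegrableOn (fun y => u y φ) I
  right : ∀ φ, LocallyIntegrableOn (fun y => v y φ) I
  eq : ∀ θ : ℝ → ℝ, ContDiff ℝ ∞ θ → HasCompactSupport θ → tsupport θ ⊆ I → ∀ φ,
    ofCurve u (deriv θ) φ = -ofCurve v θ φ

theorem ofCurve_add {I : Set ℝ} {u v : ℝ → TDist d}
    (hu : ∀ φ, LocallyIntegrableOn (fun y => u y φ) I)
    (hv : ∀ φ, LocallyIntegrableOn (fun y => v y φ) I) {θ : ℝ → ℝ} (hθ : Continuous θ)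
    (hc : HasCompactSupport θ) (hs : tsupport θ ⊆ I) (φ : TestSpace d) :
    ofCurve (fun y => u y + v y) θ φ = ofCurve u θ φ + ofCurve v θ φ := by
  simp only [ofCurve]
  rw [← integral_add (integrable_cutoff_mul (hu φ) hθ hc hs)
    (integrable_cutoff_mul (hv φ) hθ hc hs)]
  simp only [LinearMap.add_apply, mul_add]

theorem ofCurve_smul (c : ℂ) (u : ℝ → TDist d) (θ : ℝ → ℝ) (φ : TestSpace d) :
    ofCurve (fun y => c • u y) θ φ = c * ofCurve u θ φ := by
  simp only [ofCurve, LinearMap.smul_apply, smul_eq_mul]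
  rw [← integral_const_mul]
  congr 1
  ext y
  ring

theorem ofCurve_sub {I : Set ℝ} {u v : ℝ → TDist d}
    (hu : ∀ φ, LocallyIntegrableOn (fun y => u y φ) I)
    (hv : ∀ φ, LocallyIntegrableOn (fun y => v y φ) I) {θ : ℝ → ℝ} (hθ : Continuous θ)
    (hc : HasCompactSupport θ) (hs : tsupport θ ⊆ I) (φ : TestSpace d) :
    ofCurve (fun y => u y - v y) θ φ = ofCurve u θ φ - ofCurve v θ φ := by
  simp only [ofCurve]
  rw [← integral_sub (integrable_cutoff_mul (hu φ) hθ hc hs)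
    (integrable_cutoff_mul (hv φ) hθ hc hs)]
  simp only [LinearMap.sub_apply, mul_sub]

theorem HasWeakDeriv.add {I : Set ℝ} {u v u' v' : ℝ → TDist d}
    (h : HasWeakDeriv I u v) (h' : HasWeakDeriv I u' v') :
    HasWeakDeriv I (fun y => u y + u' y) (fun y => v y + v' y) := by
  refine ⟨fun φ => (h.left φ).add (h'.left φ), fun φ => (h.right φ).add (h'.right φ),
    fun θ hθ hc hs φ => ?_⟩
  rw [ofCurve_add h.left h'.left (hθ.continuous_deriv (by simp)) hc.deriv
    (tsupport_deriv_subset.trans hs), ofCurve_add h.right h'.right hθ.continuous hc hs,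
    h.eq θ hθ hc hs, h'.eq θ hθ hc hs]
  ring

theorem HasWeakDeriv.smul {I : Set ℝ} {u v : ℝ → TDist d} (h : HasWeakDeriv I u v) (c : ℂ) :
    HasWeakDeriv I (fun y => c • u y) (fun y => c • v y) := by
  refine ⟨fun φ => (h.left φ).smul c, fun φ => (h.right φ).smul c, fun θ hθ hc hs φ => ?_⟩
  rw [ofCurve_smul, ofCurve_smul, h.eq θ hθ hc hs]
  ring

theorem HasWeakDeriv.neg {I : Set ℝ} {u v : ℝ → TDist d} (h : HasWeakDeriv I u v) :
    HasWeakDeriv I (fun y => -u y) (fun y => -v y) := by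
  simpa only [neg_one_smul] using h.smul (-1)

theorem HasWeakDeriv.sub {I : Set ℝ} {u v u' v' : ℝ → TDist d}
    (h : HasWeakDeriv I u v) (h' : HasWeakDeriv I u' v') :
    HasWeakDeriv I (fun y => u y - u' y) (fun y => v y - v' y) := by
  simpa only [sub_eq_add_neg] using h.add h'.neg

theorem HasWeakDeriv.mult {I : Set ℝ} {u v : ℝ → TDist d} (h : HasWeakDeriv I u v) (m : Symb d) :
    HasWeakDeriv I (fun y => mult m (u y)) (fun y => mult m (v y)) :=
  ⟨fun φ => h.left (multTest m.reflect φ), fun φ => h.right (multTest m.reflect φ),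
    fun θ hθ hc hs φ => h.eq θ hθ hc hs (multTest m.reflect φ)⟩

theorem HasWeakDeriv.absGrad {I : Set ℝ} {u v : ℝ → TDist d} (h : HasWeakDeriv I u v) :
    HasWeakDeriv I (fun y => absGrad (u y)) (fun y => absGrad (v y)) := h.mult _

theorem HasWeakDeriv.riesz {I : Set ℝ} {u v : ℝ → TDist d} (h : HasWeakDeriv I u v) (k : Fin d) :
    HasWeakDeriv I (fun y => riesz k (u y)) (fun y => riesz k (v y)) := h.mult _

theorem HasWeakDeriv.congr {I : Set ℝ} {u v u' v' : ℝ → TDist d} (h : HasWeakDeriv I u v)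
    (hu : ∀ y, u' y = u y) (hv : ∀ y, v' y = v y) : HasWeakDeriv I u' v' := by
  rwa [funext hu, funext hv]

theorem HasWeakDeriv.mono {I J : Set ℝ} {u v : ℝ → TDist d} (h : HasWeakDeriv I u v)
    (hJ : J ⊆ I) : HasWeakDeriv J u v :=
  ⟨fun φ => (h.left φ).mono_set hJ, fun φ => (h.right φ).mono_set hJ,
    fun θ hθ hc hs φ => h.eq θ hθ hc (hs.trans hJ) φ⟩

/-- Integration by parts for curves that are weakly continuously differentiable. -/
theorem HasWeakDeriv.of_hasDerivAt {u v : ℝ → TDist d}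
    (hu : ∀ φ x, HasDerivAt (fun y => u y φ) (v x φ) x) (hv : ∀ φ, Continuous fun y => v y φ) :
    HasWeakDeriv univ u v := by
  have hcu : ∀ φ, Continuous fun y => u y φ := fun φ =>
    continuous_iff_continuousAt.2 fun x => (hu φ x).continuousAt
  refine ⟨fun φ => (hcu φ).locallyIntegrable.locallyIntegrableOn _,
    fun φ => (hv φ).locallyIntegrable.locallyIntegrableOn _, fun θ hθ hc hs φ => ?_⟩
  have hd : ∀ x, HasDerivAt (fun y => (θ y : ℂ)) ((deriv θ x : ℝ) : ℂ) x := fun x =>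
    ((hθ.differentiable (by simp)) x).hasDerivAt.ofReal_comp
  have hcc : HasCompactSupport (fun y => (θ y : ℂ)) := hc.comp_left Complex.ofReal_zero
  have hcd : Continuous (deriv θ) := hθ.continuous_deriv (by simp)
  have hcθ := hθ.continuous
  have hdc : HasCompactSupport (fun y => ((deriv θ y : ℝ) : ℂ)) :=
    hc.deriv.comp_left Complex.ofReal_zero
  have huc := hcu φ
  have hvc := hv φ
  have h := integral_mul_deriv_eq_deriv_mul_of_integrable (u := fun y => u y φ)
    (v := fun y => (θ y : ℂ)) (u' := fun y => v y φ) (v' := fun y => ((deriv θ y : ℝ) : ℂ))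
    (fun x _ => hu φ x) (fun x _ => hd x)
    ((by fun_prop : Continuous _).integrable_of_hasCompactSupport hdc.mul_left)
    ((by fun_prop : Continuous _).integrable_of_hasCompactSupport hcc.mul_left)
    ((by fun_prop : Continuous _).integrable_of_hasCompactSupport hcc.mul_left)
  simp only [ofCurve]
  simpa only [mul_comm] using h

/-! ### Weak derivatives of the convolutions -/

/-- `c` is smooth on both closed half-lines with derivative `c'` and jump `J` at the origin, and
`e = sgn · c` away from the origin. -/
def IsKernelDeriv (c c' e : ℝ → ℝ) (J : ℝ) : Prop :=
  ∃ p m : ℝ → ℝ, ContDiff ℝ 1 p ∧ ContDiff ℝ 1 m ∧ J = p 0 - m 0 ∧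
    (∀ z, 0 < z → c z = p z ∧ c' z = deriv p z ∧ e z = p z) ∧
    ∀ z, z < 0 → c z = m z ∧ c' z = deriv m z ∧ e z = -m z

theorem IsFactor.integrable_mul {c : ℝ → ℝ} (hc : IsFactor c) {w : ℝ → ℂ} (hw : Continuous w)
    (hs : HasCompactSupport w) (y : ℝ) : Integrable fun x => (c (x - y) : ℂ) * w x := by
  have hm : Measurable fun x : ℝ => ((c (x - y) : ℝ) : ℂ) :=
    Complex.measurable_ofReal.comp (hc.measurable.comp (measurable_id.sub measurable_const))
  have h1 : Integrable fun x => (1 + |x - y|) * ‖w x‖ :=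
    (by fun_prop : Continuous fun x => (1 + |x - y|) * ‖w x‖).integrable_of_hasCompactSupport
      hs.norm.mul_left
  refine h1.mono' (hm.aestronglyMeasurable.mul hw.aestronglyMeasurable)
    (Eventually.of_forall fun x => ?_)
  exact norm_kernel_le hc le_rfl

/-- The scalar form of `(c E)' = J δ + c' E - sgn c A`, where `E(|z|)` plays the role of the
kernel and `E' = -A`. -/
theorem integral_deriv_mul_kernel {E A : ℝ → ℂ} (hE : ∀ t, HasDerivAt E (-A t) t)
    (hA : Continuous A) {c c' e : ℝ → ℝ} {J : ℝ} (h : IsKernelDeriv c c' e J) (hc : IsFactor c)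
    (hc' : IsFactor c') (he : IsFactor e) {θ : ℝ → ℝ} (hθ : ContDiff ℝ ∞ θ)
    (hs : HasCompactSupport θ) (y : ℝ) :
    ∫ x, ((deriv θ x : ℝ) : ℂ) * ((c (x - y) : ℂ) * E |x - y|)
      = -((J : ℂ) * ((θ y : ℂ) * E 0) + (∫ x, (θ x : ℂ) * ((c' (x - y) : ℂ) * E |x - y|))
        - ∫ x, (θ x : ℂ) * ((e (x - y) : ℂ) * A |x - y|)) := by
  obtain ⟨p, m, hp, hm, hJ, hpos, hneg⟩ := h
  have hcd : Continuous (deriv θ) := hθ.continuous_deriv (by simp)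
  have hcθ := hθ.continuous
  have hEc : Continuous E := continuous_iff_continuousAt.2 fun t => (hE t).continuousAt
  have hθc : HasCompactSupport (fun y => (θ y : ℂ)) := hs.comp_left Complex.ofReal_zero
  have hdc : HasCompactSupport (fun y => ((deriv θ y : ℝ) : ℂ)) :=
    hs.deriv.comp_left Complex.ofReal_zero
  have hd : ∀ x, HasDerivAt (fun y => (θ y : ℂ)) ((deriv θ x : ℝ) : ℂ) x := fun x =>
    ((hθ.differentiable (by simp)) x).hasDerivAt.ofReal_comp
  have hpc : Continuous (deriv p) := hp.continuous_deriv le_rfl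
  have hmc : Continuous (deriv m) := hm.continuous_deriv le_rfl
  have hp0 := hp.continuous
  have hm0 := hm.continuous
  have i1 : Integrable fun x => ((deriv θ x : ℝ) : ℂ) * ((c (x - y) : ℂ) * E |x - y|) :=
    (hc.integrable_mul (w := fun x => ((deriv θ x : ℝ) : ℂ) * E |x - y|)
      (by fun_prop) hdc.mul_right y).congr (Eventually.of_forall fun x => by ring)
  have i2 : Integrable fun x => (θ x : ℂ) * ((c' (x - y) : ℂ) * E |x - y|) :=
    (hc'.integrable_mul (w := fun x => (θ x : ℂ) * E |x - y|)
      (by fun_prop) hθc.mul_right y).congr (Eventually.of_forall fun x => by ring)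
  have i3 : Integrable fun x => (θ x : ℂ) * ((e (x - y) : ℂ) * A |x - y|) :=
    (he.integrable_mul (w := fun x => (θ x : ℂ) * A |x - y|)
      (by fun_prop) hθc.mul_right y).congr (Eventually.of_forall fun x => by ring)
  -- the boundary terms at `x = y` from the right and from the left
  have hR : ∫ x in Ioi y, (((deriv θ x : ℝ) : ℂ) * ((c (x - y) : ℂ) * E |x - y|)
      + ((θ x : ℂ) * ((c' (x - y) : ℂ) * E |x - y|)
        - (θ x : ℂ) * ((e (x - y) : ℂ) * A |x - y|))) = -((θ y : ℂ) * ((p 0 : ℂ) * E 0)) := by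
    let G : ℝ → ℂ := fun x => (θ x : ℂ) * ((p (x - y) : ℂ) * E (x - y))
    let G' : ℝ → ℂ := fun x => ((deriv θ x : ℝ) : ℂ) * ((p (x - y) : ℂ) * E (x - y))
      + (θ x : ℂ) * (((deriv p (x - y) : ℝ) : ℂ) * E (x - y) + (p (x - y) : ℂ) * -A (x - y))
    have hG : ∀ x, HasDerivAt G (G' x) x := fun x => by
      have h1 : HasDerivAt (fun x => (p (x - y) : ℂ)) ((deriv p (x - y) : ℝ) : ℂ) x :=
        (((hp.differentiable one_ne_zero) (x - y)).hasDerivAt.comp_sub_const x y).ofReal_comp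
      exact (hd x).mul (h1.mul ((hE (x - y)).comp_sub_const x y))
    have hG'c : Continuous G' := by
      simp only [G']
      fun_prop
    have hG1 : ContDiff ℝ 1 G := contDiff_one_iff_deriv.2
      ⟨fun x => (hG x).differentiableAt, by rwa [funext fun x => (hG x).deriv]⟩
    have hint := HasCompactSupport.integral_Ioi_deriv_eq hG1 hθc.mul_right y
    have hGy : G y = (θ y : ℂ) * ((p 0 : ℂ) * E 0) := by
      simp [G]
    rw [← hGy, ← hint]
    refine setIntegral_congr_fun measurableSet_Ioi fun x hx => ?_
    have hxy : 0 < x - y := sub_pos.2 hx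
    obtain ⟨e1, e2, e3⟩ := hpos _ hxy
    simp only [(hG x).deriv, G', e1, e2, e3, abs_of_pos hxy]
    ring
  have hL : ∫ x in Iic y, (((deriv θ x : ℝ) : ℂ) * ((c (x - y) : ℂ) * E |x - y|)
      + ((θ x : ℂ) * ((c' (x - y) : ℂ) * E |x - y|)
        - (θ x : ℂ) * ((e (x - y) : ℂ) * A |x - y|))) = (θ y : ℂ) * ((m 0 : ℂ) * E 0) := by
    let G : ℝ → ℂ := fun x => (θ x : ℂ) * ((m (x - y) : ℂ) * E (y - x))
    let G' : ℝ → ℂ := fun x => ((deriv θ x : ℝ) : ℂ) * ((m (x - y) : ℂ) * E (y - x))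
      + (θ x : ℂ) * (((deriv m (x - y) : ℝ) : ℂ) * E (y - x) + (m (x - y) : ℂ) * A (y - x))
    have hG : ∀ x, HasDerivAt G (G' x) x := fun x => by
      have h1 : HasDerivAt (fun x => (m (x - y) : ℂ)) ((deriv m (x - y) : ℝ) : ℂ) x :=
        (((hm.differentiable one_ne_zero) (x - y)).hasDerivAt.comp_sub_const x y).ofReal_comp
      have h2 : HasDerivAt (fun x => E (y - x)) (A (y - x)) x := by
        simpa using (hE (y - x)).comp_const_sub y x
      exact (hd x).mul (h1.mul h2)
    have hG'c : Continuous G' := by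
      simp only [G']
      fun_prop
    have hG1 : ContDiff ℝ 1 G := contDiff_one_iff_deriv.2
      ⟨fun x => (hG x).differentiableAt, by rwa [funext fun x => (hG x).deriv]⟩
    have hint := HasCompactSupport.integral_Iic_deriv_eq hG1 hθc.mul_right y
    have hGy : G y = (θ y : ℂ) * ((m 0 : ℂ) * E 0) := by
      simp [G]
    rw [← hGy, ← hint, integral_Iic_eq_integral_Iio, integral_Iic_eq_integral_Iio]
    refine setIntegral_congr_fun measurableSet_Iio fun x hx => ?_
    have hxy : x - y < 0 := sub_neg.2 hx
    obtain ⟨e1, e2, e3⟩ := hneg _ hxy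
    simp only [(hG x).deriv, G', e1, e2, e3, abs_of_neg hxy, neg_sub]
    push_cast
    ring
  have i23 := i2.sub i3
  have hsum := intervalIntegral.integral_Iic_add_Ioi (b := y) (i1.add i23).integrableOn
    (i1.add i23).integrableOn
  have htot := integral_add i1 i23
  have hsub := integral_sub i2 i3
  simp only [Pi.add_apply, Pi.sub_apply] at hsum htot hsub
  rw [hL, hR, htot, hsub] at hsum
  rw [hJ]
  push_cast
  linear_combination -hsum

theorem IsTame.integrable_prod_kernel {f : ℝ → TDist d} (hf : IsTame univ f) {c : ℝ → ℝ}
    (hc : IsFactor c) {η : ℝ → ℝ} (hη : Continuous η) (hs : HasCompactSupport η)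
    (φ : TestSpace d) :
    Integrable (fun q : ℝ × ℝ =>
      (η q.1 : ℂ) * ((c (q.1 - q.2) : ℂ) * f q.2 (expTest |q.1 - q.2| φ)))
      (volume.prod volume) := by
  obtain ⟨r, R, hr, hφ⟩ := φ.2
  obtain ⟨N, h, h0, hi, hb⟩ := hf.exists_kernel_bound hr R
  have hb' : ∀ᵐ q : ℝ × ℝ ∂(volume.prod volume), _ :=
    (Measure.quasiMeasurePreserving_snd (μ := volume) (ν := volume)).ae hb
  have hdom : Integrable (fun x => |η x| * Real.exp (r * |x|)) :=
    (by fun_prop : Continuous fun x => |η x| * Real.exp (r * |x|)).integrable_of_hasCompactSupport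
      (HasCompactSupport.mul_right (hs.comp_left (g := fun t : ℝ => |t|) abs_zero))
  refine Integrable.mono' (hdom.mul_prod ((hi r hr).mul_const (schwartzNorm N φ))) ?_ ?_
  · refine AEStronglyMeasurable.mul
      (by fun_prop : Continuous fun q : ℝ × ℝ => (η q.1 : ℂ)).aestronglyMeasurable
      (AEStronglyMeasurable.mul ?_ ?_)
    · exact (Complex.measurable_ofReal.comp (hc.measurable.comp
        (measurable_fst.sub measurable_snd))).aestronglyMeasurable
    · refine aestronglyMeasurable_apply_expTest (f := fun q : ℝ × ℝ => f q.2) (fun ψ => ?_)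
        (by fun_prop) hr hφ ?_
      · have := hf.1 ψ
        rw [Measure.restrict_univ] at this
        exact this.comp_snd
      · filter_upwards [hb'] with q hq using hq.1
  · filter_upwards [hb'] with q hq
    rw [norm_mul, Complex.norm_real, Real.norm_eq_abs]
    have h1 := norm_kernel_le hc (hq.2 (q.1 - q.2) φ hφ)
    have h2 := exp_neg_mul_abs_sub_le hr.le q.1 q.2
    have h3 := h0 q.2
    have h4 := schwartzNorm_nonneg N φ
    calc _ ≤ |η q.1| * (Real.exp (r * |q.1|) * Real.exp (-r * |q.2|) * h q.2
          * schwartzNorm N φ) := by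
          refine mul_le_mul_of_nonneg_left (h1.trans ?_) (abs_nonneg _)
          gcongr
      _ = _ := by ring

/-- Fubini's theorem for a convolution integrated against a function of `x`. -/
theorem ofCurve_pconv {f : ℝ → TDist d} (hf : IsTame univ f) {c : ℝ → ℝ}
    (hc : IsFactor c) {η : ℝ → ℝ} (hη : Continuous η) (hs : HasCompactSupport η)
    (φ : TestSpace d) :
    ofCurve (pconv c f) η φ
      = ∫ y, ∫ x, (η x : ℂ) * ((c (x - y) : ℂ) * f y (expTest |x - y| φ)) := by
  have h := hf.integrable_prod_kernel hc hη hs φ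
  simp only [ofCurve, hf.pconv_apply hc, ← integral_const_mul]
  exact integral_integral_swap h

/-- The derivative of the kernel `c(z) e^{-|z||∇'|}` is its jump `J` at the diagonal, which reproduces
`f`, plus `(c'(z) - sgn(z) c(z)|∇'|) e^{-|z||∇'|}`. -/
theorem hasWeakDeriv_pconv {f : ℝ → TDist d} (hf : IsTame univ f) {c c' e : ℝ → ℝ} {J : ℝ}
    (h : IsKernelDeriv c c' e J) (hc : IsFactor c) (hc' : IsFactor c') (he : IsFactor e) :
    HasWeakDeriv univ (pconv c f)
      (fun x => (J : ℂ) • f x + pconv c' f x - absGrad (pconv e f x)) := by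
  have hloc : IsLocallyClosed (univ : Set ℝ) := isOpen_univ.isLocallyClosed
  have h1 := hf.pconv hc
  have h2 := hf.pconv hc'
  have h3' : IsTame univ (fun x => absGrad (pconv e f x)) := (hf.pconv he).mult _
  have l1 := fun φ => (hf.smul (J : ℂ)).locallyIntegrableOn hloc φ
  have l2 := fun φ => h2.locallyIntegrableOn hloc φ
  have l3 := fun φ => h3'.locallyIntegrableOn hloc φ
  refine ⟨fun φ => h1.locallyIntegrableOn hloc φ,
    fun φ => (((hf.smul (J : ℂ)).add h2).sub h3').locallyIntegrableOn hloc φ,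
    fun θ hθ hs hsI φ => ?_⟩
  have hcd : Continuous (deriv θ) := hθ.continuous_deriv (by simp)
  rw [ofCurve_sub (fun φ => ((hf.smul (J : ℂ)).add h2).locallyIntegrableOn hloc φ) l3
    hθ.continuous hs hsI, ofCurve_add l1 l2 hθ.continuous hs hsI, ofCurve_smul]
  have e3 : ofCurve (fun x => absGrad (pconv e f x)) θ φ = ofCurve (pconv e f) θ (absTest φ) := by
    simp only [ofCurve, absGrad_apply]
  rw [e3, ofCurve_pconv hf hc hcd hs.deriv, ofCurve_pconv hf hc' hθ.continuous hs,
    ofCurve_pconv hf he hθ.continuous hs, ofCurve]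
  obtain ⟨r, R, hr, hφ⟩ := φ.2
  obtain ⟨N, g, g0, gi, gb⟩ := hf.exists_kernel_bound hr R
  have j1 := integrable_cutoff_mul (hf.locallyIntegrableOn hloc φ) hθ.continuous hs hsI
  have j2 := (hf.integrable_prod_kernel hc' hθ.continuous hs φ).integral_prod_right
  have j3 := (hf.integrable_prod_kernel he hθ.continuous hs (absTest φ)).integral_prod_right
  simp only at j2 j3
  have k1 := integral_add (j1.const_mul (J : ℂ)) j2
  have k2 := integral_sub ((j1.const_mul (J : ℂ)).add j2) j3
  simp only [Pi.add_apply] at k1 k2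
  rw [← integral_const_mul, ← k1, ← k2, ← integral_neg]
  refine integral_congr_ae ?_
  filter_upwards [gb] with y hy
  obtain ⟨N', B, hB⟩ := hy.1
  have key := integral_deriv_mul_kernel (E := fun t => f y (expTest t φ))
    (A := fun t => f y (expTest t (absTest φ)))
    (fun t => by
      simpa using hasDerivAt_apply_expTest_const hr hφ hB (hasDerivAt_id t))
    (continuous_apply_expTest hr hφ.absTest hB) h hc hc' he hθ hs y
  simpa only [expTest_zero] using key

/-! ### The five kernels -/

theorem isFactor_zero : IsFactor fun _ => 0 :=
  ⟨measurable_const, fun z => by simp; positivity, fun z _ => continuousAt_const⟩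

theorem isFactor_one : IsFactor fun _ => 1 :=
  ⟨measurable_const, fun z => by simp, fun z _ => continuousAt_const⟩

theorem isFactor_id : IsFactor fun z => z :=
  ⟨measurable_id, fun z => by linarith [abs_nonneg z], fun z _ => continuousAt_id⟩

theorem isFactor_abs : IsFactor fun z => |z| :=
  ⟨measurable_norm, fun z => by simp, fun z _ => continuous_abs.continuousAt⟩

theorem IsFactor.neg {c : ℝ → ℝ} (hc : IsFactor c) : IsFactor fun z => -c z :=
  ⟨hc.measurable.neg, fun z => by simpa using hc.bound z, fun z hz => (hc.continuousAt z hz).neg⟩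

theorem isFactor_sign : IsFactor Real.sign := by
  refine ⟨?_, fun z => ?_, fun z hz => ?_⟩
  · have : Real.sign = fun r : ℝ => if r < 0 then -1 else if 0 < r then 1 else 0 := rfl
    rw [this]
    exact Measurable.ite measurableSet_Iio measurable_const
      (Measurable.ite measurableSet_Ioi measurable_const measurable_const)
  · have := abs_nonneg z
    rcases Real.sign_apply_eq z with h | h | h <;> rw [h] <;> simp
    linarith
  · rcases lt_or_gt_of_ne hz with h | h
    · refine (continuousAt_const (y := (-1 : ℝ))).congr ?_
      filter_upwards [Iio_mem_nhds h] with w hw using (Real.sign_of_neg hw).symm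
    · refine (continuousAt_const (y := (1 : ℝ))).congr ?_
      filter_upwards [Ioi_mem_nhds h] with w hw using (Real.sign_of_pos hw).symm

theorem isKernelDeriv_one : IsKernelDeriv (fun _ => 1) (fun _ => 0) Real.sign 0 :=
  ⟨fun _ => 1, fun _ => 1, contDiff_const, contDiff_const, by simp,
    fun z hz => by simp [Real.sign_of_pos hz], fun z hz => by simp [Real.sign_of_neg hz]⟩

theorem isKernelDeriv_sign : IsKernelDeriv Real.sign (fun _ => 0) (fun _ => 1) 2 :=
  ⟨fun _ => 1, fun _ => -1, contDiff_const, contDiff_const, by norm_num,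
    fun z hz => by simp [Real.sign_of_pos hz], fun z hz => by simp [Real.sign_of_neg hz]⟩

theorem isKernelDeriv_id : IsKernelDeriv (fun z => z) (fun _ => 1) (fun z => |z|) 0 :=
  ⟨fun z => z, fun z => z, contDiff_id, contDiff_id, by simp,
    fun z hz => by simp [abs_of_pos hz], fun z hz => by simp [abs_of_neg hz]⟩

theorem isKernelDeriv_abs : IsKernelDeriv (fun z => |z|) Real.sign (fun z => z) 0 := by
  refine ⟨fun z => z, fun z => -z, contDiff_id, contDiff_neg, by simp,
    fun z hz => by simp [abs_of_pos hz, Real.sign_of_pos hz], fun z hz => ?_⟩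
  have : deriv (fun z : ℝ => -z) z = -1 := (hasDerivAt_neg z).deriv
  rw [this]
  simp [abs_of_neg hz, Real.sign_of_neg hz]

theorem pconv_zero {f : ℝ → TDist d} (hf : IsTame univ f) (x : ℝ) :
    pconv (fun _ => 0) f x = 0 := by
  ext φ
  simp [hf.pconv_apply isFactor_zero]

theorem pconv_neg {f : ℝ → TDist d} (hf : IsTame univ f) {c : ℝ → ℝ} (hc : IsFactor c) (x : ℝ) :
    pconv (fun z => -c z) f x = -pconv c f x := by
  ext φ
  rw [hf.pconv_apply hc.neg, LinearMap.neg_apply, hf.pconv_apply hc, ← integral_neg]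
  simp

/-- The convolution in the normal variable with the kernel
`(c(z) + c₂(z)|∇'|) e^{-|z||∇'|}`. -/
def kconv (c c₂ : ℝ → ℝ) (f : ℝ → TDist d) (x : ℝ) : TDist d :=
  pconv c f x + absGrad (pconv c₂ f x)

section kconv

variable {c c₂ : ℝ → ℝ}

theorem kconv_mult {f : ℝ → TDist d} (hf : IsTame univ f) (hc : IsFactor c) (hc₂ : IsFactor c₂)
    (m : Symb d) (x : ℝ) : kconv c c₂ (fun y => mult m (f y)) x = mult m (kconv c c₂ f x) := by
  simp only [kconv, map_add, pconv_mult hf hc, pconv_mult hf hc₂, absGrad, mult_comm m]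

theorem kconv_sum {ι : Type*} (s : Finset ι) {f : ι → ℝ → TDist d}
    (hf : ∀ i ∈ s, IsTame univ (f i)) (hc : IsFactor c) (hc₂ : IsFactor c₂) (x : ℝ) :
    kconv c c₂ (fun y => ∑ i ∈ s, f i y) x = ∑ i ∈ s, kconv c c₂ (f i) x := by
  simp only [kconv, pconv_sum s hf hc, pconv_sum s hf hc₂, map_sum, Finset.sum_add_distrib]

theorem IsTame.kconv {f : ℝ → TDist d} (hf : IsTame univ f) (hc : IsFactor c)
    (hc₂ : IsFactor c₂) : IsTame univ (kconv c c₂ f) :=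
  (hf.pconv hc).add ((hf.pconv hc₂).mult _)

theorem continuous_kconv {f : ℝ → TDist d} (hf : IsTame univ f) (hc : IsFactor c)
    (hc₂ : IsFactor c₂) (φ : TestSpace d) : Continuous fun x => kconv c c₂ f x φ := by
  simp only [HalfSpaceStokes.kconv, LinearMap.add_apply, absGrad_apply]
  exact (continuous_pconv hf hc φ).add (continuous_pconv hf hc₂ _)

/-- The integrals over the half line that define the velocity are convolutions on the line with
the extended source. -/
theorem Lop_eq_kconv {K : ℝ → Symb d} {σ : ℂ} {f f₀ : ℝ → TDist d} (hf : IsTame univ f)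
    (hc : IsFactor c) (hc₂ : IsFactor c₂)
    (hK : ∀ z (T : TDist d), mult (K z) T
      = (c z : ℂ) • poisson |z| T + (c₂ z : ℂ) • absGrad (poisson |z| T))
    (hext : ∀ y, 0 < y → f y = f₀ y ∧ f (-y) = σ • f₀ y) (x : ℝ) :
    Lop K σ f₀ x = kconv c c₂ f x := by
  have happ : ∀ y φ, mult (K (x - y)) (f y) φ = (c (x - y) : ℂ) * f y (expTest |x - y| φ)
      + (c₂ (x - y) : ℂ) * f y (expTest |x - y| (absTest φ)) := fun y φ => by
    rw [hK, LinearMap.add_apply, LinearMap.smul_apply, LinearMap.smul_apply, absGrad_apply,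
      poisson_apply, poisson_apply, smul_eq_mul, smul_eq_mul]
  have hint : ∀ φ, Integrable fun y => mult (K (x - y)) (f y) φ := fun φ => by
    simp only [happ]
    exact (hf.integrable_kernel hc x φ).add (hf.integrable_kernel hc₂ x (absTest φ))
  have hcongr : ∀ φ, ∀ y ∈ Ioi (0 : ℝ),
      (mult (K (x - y)) (f₀ y) + σ • mult (K (x + y)) (f₀ y)) φ
        = mult (K (x - y)) (f y) φ + mult (K (x - -y)) (f (-y)) φ := fun φ y hy => by
    obtain ⟨e1, e2⟩ := hext y hy
    rw [e1, e2, sub_neg_eq_add, map_smul, LinearMap.add_apply]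
  have hneg : ∀ φ, IntegrableOn (fun y => mult (K (x - -y)) (f (-y)) φ) (Ioi 0) := fun φ =>
    (hint φ).comp_neg.integrableOn
  ext φ
  rw [Lop, weakIntegral_apply, setIntegral_congr_fun measurableSet_Ioi (hcongr φ),
    integral_add (hint φ).integrableOn (hneg φ),
    integral_comp_neg_Ioi 0 (fun y => mult (K (x - y)) (f y) φ), neg_zero, add_comm,
    intervalIntegral.integral_Iic_add_Ioi (hint φ).integrableOn (hint φ).integrableOn,
    kconv, LinearMap.add_apply, absGrad_apply, hf.pconv_apply hc, hf.pconv_apply hc₂,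
    ← integral_add (hf.integrable_kernel hc x φ) (hf.integrable_kernel hc₂ x (absTest φ))]
  · simp only [happ]
  · intro φ
    exact (((hint φ).integrableOn.add (hneg φ)).congr_fun
      (fun y hy => (hcongr φ y hy).symm) measurableSet_Ioi)

end kconv

/-- A radial multiplier with profile `(c + c₂ρ) e^{-ρ|z|}`. -/
theorem mult_radial_eq {h : ℝ → ℝ} (hh : ContDiff ℝ ∞ h) {z c c₂ : ℝ}
    (hρ : ∀ ρ, h ρ = (c + c₂ * ρ) * Real.exp (-(|z| * ρ))) (T : TDist d) :
    mult (radial h hh) T = (c : ℂ) • poisson |z| T + (c₂ : ℂ) • absGrad (poisson |z| T) := by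
  ext φ
  simp only [mult_radial_apply, LinearMap.add_apply, LinearMap.smul_apply, absGrad_apply,
    poisson_apply]
  rw [← map_smul T, ← map_smul T, ← map_add]
  congr 1
  refine testSpace_ext fun ξ _ => ?_
  rw [← fourierAt_apply, ← fourierAt_apply]
  simp only [map_add, map_smul, fourierAt_apply, fourier_expTest, fourier_absTest,
    fourier_multTest, radial, smul_eq_mul, hρ]
  push_cast
  ring

theorem mult_K1 (z : ℝ) (T : TDist d) : mult (K1 z) T
    = ((1 : ℝ) : ℂ) • poisson |z| T + ((0 : ℝ) : ℂ) • absGrad (poisson |z| T) :=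
  mult_radial_eq _ (fun ρ => by ring_nf) T

theorem mult_K2 (z : ℝ) (T : TDist d) : mult (K2 z) T
    = (Real.sign z : ℂ) • poisson |z| T + ((0 : ℝ) : ℂ) • absGrad (poisson |z| T) :=
  mult_radial_eq _ (fun ρ => by ring_nf) T

theorem mult_K3 (z : ℝ) (T : TDist d) : mult (K3 z) T
    = ((1 : ℝ) : ℂ) • poisson |z| T + ((|z| : ℝ) : ℂ) • absGrad (poisson |z| T) :=
  mult_radial_eq _ (fun ρ => by ring_nf) T

theorem mult_K4 (z : ℝ) (T : TDist d) : mult (K4 z) T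
    = ((0 : ℝ) : ℂ) • poisson |z| T + (z : ℂ) • absGrad (poisson |z| T) :=
  mult_radial_eq _ (fun ρ => by ring_nf) T

theorem mult_K5 (z : ℝ) (T : TDist d) : mult (K5 z) T
    = ((1 : ℝ) : ℂ) • poisson |z| T + ((-|z| : ℝ) : ℂ) • absGrad (poisson |z| T) :=
  mult_radial_eq _ (fun ρ => by ring_nf) T

/-- Convolution with `K⁽¹⁾`. -/
abbrev conv1 : (ℝ → TDist d) → ℝ → TDist d := kconv (fun _ => 1) (fun _ => 0)

/-- Convolution with `K⁽²⁾`. -/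
abbrev conv2 : (ℝ → TDist d) → ℝ → TDist d := kconv Real.sign (fun _ => 0)

/-- Convolution with `K⁽³⁾`. -/
abbrev conv3 : (ℝ → TDist d) → ℝ → TDist d := kconv (fun _ => 1) (fun z => |z|)

/-- Convolution with `K⁽⁴⁾`. -/
abbrev conv4 : (ℝ → TDist d) → ℝ → TDist d := kconv (fun _ => 0) (fun z => z)

/-- Convolution with `K⁽⁵⁾`. -/
abbrev conv5 : (ℝ → TDist d) → ℝ → TDist d := kconv (fun _ => 1) (fun z => -|z|)

section table

variable {f : ℝ → TDist d}

theorem hasWeakDeriv_conv1 (hf : IsTame univ f) :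
    HasWeakDeriv univ (conv1 f) (fun x => -absGrad (conv2 f x)) :=
  (hasWeakDeriv_pconv hf isKernelDeriv_one isFactor_one isFactor_zero isFactor_sign).congr
    (fun y => by simp [kconv, pconv_zero hf]) (fun y => by simp [kconv, pconv_zero hf])

theorem hasWeakDeriv_conv2 (hf : IsTame univ f) :
    HasWeakDeriv univ (conv2 f) (fun x => (2 : ℂ) • f x - absGrad (conv1 f x)) :=
  (hasWeakDeriv_pconv hf isKernelDeriv_sign isFactor_sign isFactor_zero isFactor_one).congr
    (fun y => by simp [kconv, pconv_zero hf]) (fun y => by simp [kconv, pconv_zero hf])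

theorem hasWeakDeriv_pconv_abs (hf : IsTame univ f) : HasWeakDeriv univ (pconv (fun z => |z|) f)
    (fun x => conv2 f x - conv4 f x) :=
  (hasWeakDeriv_pconv hf isKernelDeriv_abs isFactor_abs isFactor_sign isFactor_id).congr
    (fun y => by simp) (fun y => by simp [kconv, pconv_zero hf])

theorem hasWeakDeriv_conv3 (hf : IsTame univ f) :
    HasWeakDeriv univ (conv3 f) (fun x => -absGrad (conv4 f x)) :=
  ((hasWeakDeriv_conv1 hf).add ((hasWeakDeriv_pconv_abs hf).absGrad)).congr
    (fun y => by simp [kconv, pconv_zero hf])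
    (fun y => by
      simp only [kconv, pconv_zero hf, map_sub, map_zero, map_add]
      abel)

theorem hasWeakDeriv_conv4 (hf : IsTame univ f) :
    HasWeakDeriv univ (conv4 f) (fun x => absGrad (conv5 f x)) :=
  ((hasWeakDeriv_pconv hf isKernelDeriv_id isFactor_id isFactor_one isFactor_abs).absGrad).congr
    (fun y => by simp [kconv, pconv_zero hf])
    (fun y => by simp [kconv, pconv_neg hf isFactor_abs, sub_eq_add_neg])

theorem hasWeakDeriv_conv5 (hf : IsTame univ f) : HasWeakDeriv univ (conv5 f)
    (fun x => absGrad (conv4 f x) - (2 : ℂ) • absGrad (conv2 f x)) :=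
  ((hasWeakDeriv_conv1 hf).sub ((hasWeakDeriv_pconv_abs hf).absGrad)).congr
    (fun y => by simp [kconv, pconv_zero hf, pconv_neg hf isFactor_abs, sub_eq_add_neg])
    (fun y => by
      simp only [map_sub]
      module)

/-- The linear relation `K⁽³⁾ + K⁽⁵⁾ = 2K⁽¹⁾`, which closes the table of derivatives. -/
theorem conv3_add_conv5 (hf : IsTame univ f) (x : ℝ) :
    conv3 f x + conv5 f x = (2 : ℂ) • conv1 f x := by
  simp only [kconv, pconv_neg hf isFactor_abs, pconv_zero hf, map_neg, map_zero]
  module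

end table

/-! ### A criterion for solutions in terms of weak derivatives -/

/-- Curves of functionals all of whose evaluations are locally integrable. -/
def WeakLocInt (I : Set ℝ) (f : ℝ → TDist d) : Prop :=
  ∀ φ, LocallyIntegrableOn (fun y => f y φ) I

theorem WeakLocInt.add {I : Set ℝ} {f g : ℝ → TDist d} (hf : WeakLocInt I f)
    (hg : WeakLocInt I g) : WeakLocInt I (fun y => f y + g y) := fun φ => (hf φ).add (hg φ)

theorem WeakLocInt.sub {I : Set ℝ} {f g : ℝ → TDist d} (hf : WeakLocInt I f)
    (hg : WeakLocInt I g) : WeakLocInt I (fun y => f y - g y) := fun φ => (hf φ).sub (hg φ)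

theorem WeakLocInt.mult {I : Set ℝ} {f : ℝ → TDist d} (hf : WeakLocInt I f) (m : Symb d) :
    WeakLocInt I (fun y => mult m (f y)) := fun φ => hf (multTest m.reflect φ)

theorem WeakLocInt.pderiv {I : Set ℝ} {f : ℝ → TDist d} (hf : WeakLocInt I f) (j : Fin d) :
    WeakLocInt I (fun y => pderiv j (f y)) := fun φ => (hf (derivTest j φ)).neg

theorem WeakLocInt.sum {I : Set ℝ} {ι : Type*} (s : Finset ι) {f : ι → ℝ → TDist d}
    (h : ∀ i ∈ s, WeakLocInt I (f i)) : WeakLocInt I (fun y => ∑ i ∈ s, f i y) := by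
  classical
  induction s using Finset.induction_on with
  | empty => exact fun φ => by simpa using locallyIntegrableOn_zero
  | insert i s hi ih =>
    simp only [Finset.sum_insert hi]
    exact (h i (by simp)).add (ih fun j hj => h j (by simp [hj]))

theorem IsTame.weakLocInt {I : Set ℝ} (hI : IsOpen I) {f : ℝ → TDist d} (hf : IsTame I f) :
    WeakLocInt I f := hf.locallyIntegrableOn hI.isLocallyClosed

theorem IsLocInt.weakLocInt {I : Set ℝ} (hI : IsOpen I) {f : ℝ → TDist d} (hf : IsLocInt I f) :
    WeakLocInt I f := hf.locallyIntegrableOn hI.isLocallyClosed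

theorem ofCurve_sum {I : Set ℝ} {ι : Type*} (s : Finset ι) {f : ι → ℝ → TDist d}
    (h : ∀ i ∈ s, WeakLocInt I (f i)) {θ : ℝ → ℝ} (hθ : Continuous θ)
    (hc : HasCompactSupport θ) (hs : tsupport θ ⊆ I) (φ : TestSpace d) :
    ofCurve (fun y => ∑ i ∈ s, f i y) θ φ = ∑ i ∈ s, ofCurve (f i) θ φ := by
  simp only [ofCurve]
  rw [← integral_finsetSum _ fun i hi => integrable_cutoff_mul (h i hi φ) hθ hc hs]
  simp only [LinearMap.coe_sum, Finset.sum_apply, Finset.mul_sum]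

theorem pd_castSucc (j : Fin d) (S : XDist d) (θ : ℝ → ℝ) (φ : TestSpace d) :
    pd j.castSucc S θ φ = -S θ (derivTest j φ) := by
  simp [pd]

theorem pd_last (S : XDist d) (θ : ℝ → ℝ) (φ : TestSpace d) :
    pd (Fin.last d) S θ φ = -S (deriv θ) φ := by
  simp [pd]

theorem pd_castSucc_ofCurve (j : Fin d) (f : ℝ → TDist d) :
    pd j.castSucc (ofCurve f) = ofCurve fun y => pderiv j (f y) := by
  ext θ φ
  rw [pd_castSucc, ofCurve, ofCurve, ← integral_neg]
  refine integral_congr_ae (Eventually.of_forall fun y => ?_)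
  change -((θ y : ℂ) * f y (derivTest j φ)) = (θ y : ℂ) * -f y (derivTest j φ)
  ring

theorem ofCurve_zero (θ : ℝ → ℝ) (φ : TestSpace d) :
    ofCurve (fun _ => (0 : TDist d)) θ φ = 0 := by
  simp [ofCurve]

theorem pd_ofCurve_zero (m : Fin (d + 1)) (θ : ℝ → ℝ) (φ : TestSpace d) :
    pd m (ofCurve fun _ => (0 : TDist d)) θ φ = 0 := by
  refine Fin.lastCases ?_ (fun j => ?_) m
  · rw [pd_last, ofCurve_zero, neg_zero]
  · rw [pd_castSucc, ofCurve_zero, neg_zero]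

theorem absGrad_riesz (k : Fin d) (T : TDist d) : absGrad (riesz k T) = riesz k (absGrad T) :=
  mult_comm _ _ _

theorem sum_pderiv_pderiv (T : TDist d) :
    ∑ j : Fin d, pderiv j (pderiv j T) = -absGrad (absGrad T) := by
  simp only [pderiv_eq, absGrad_riesz]
  exact sum_riesz_riesz _

/-- It suffices to exhibit weak first derivatives `v` of the velocity, to check that the
combinations entering the momentum equation have weak derivatives `q`, and to verify the equations
between functionals at each height. -/
theorem solvesOn_of_hasWeakDeriv {I : Set ℝ} {F : ℝ → Fin (d + 1) → Fin (d + 1) → TDist d}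
    {u v q : ℝ → Fin (d + 1) → TDist d} {p : ℝ → TDist d}
    (hu : ∀ k, HasWeakDeriv I (fun y => u y k) (fun y => v y k))
    (hq : ∀ k : Fin d, HasWeakDeriv I
      (fun y => v y k.castSucc + F y k.castSucc (Fin.last d)) (fun y => q y k.castSucc))
    (hqn : HasWeakDeriv I
      (fun y => v y (Fin.last d) + F y (Fin.last d) (Fin.last d) - p y)
      (fun y => q y (Fin.last d)))
    (hF : ∀ k l, WeakLocInt I fun y => F y k l) (hp : WeakLocInt I p)
    (eqk : ∀ y (k : Fin d), -q y k.castSucc + absGrad (absGrad (u y k.castSucc)) + pderiv k (p y)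
      = ∑ m : Fin d, pderiv m (F y k.castSucc m.castSucc))
    (eqn : ∀ y, -q y (Fin.last d) + absGrad (absGrad (u y (Fin.last d)))
      = ∑ m : Fin d, pderiv m (F y (Fin.last d) m.castSucc))
    (hdiv : ∀ y, ∑ k : Fin d, pderiv k (u y k.castSucc) + v y (Fin.last d) = 0) :
    SolvesOn I 0 F u p := by
  intro θ hθ hc hs φ
  have hθ' : ContDiff ℝ ∞ (deriv θ) := (contDiff_infty_iff_deriv.1 hθ).2
  have huL : ∀ k, WeakLocInt I fun y => u y k := fun k => (hu k).left
  have hs' := tsupport_deriv_subset.trans hs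
  have hsq : ∀ k, ∑ j : Fin d,
      ofCurve (fun y => pderiv j (pderiv j (u y k))) θ φ
        = -ofCurve (fun y => absGrad (absGrad (u y k))) θ φ := fun k => by
    rw [← ofCurve_sum (I := I) _ (fun j _ => ?_) hθ.continuous hc hs]
    · simp only [sum_pderiv_pderiv]
      have := ofCurve_smul (-1) (fun y => absGrad (absGrad (u y k))) θ φ
      simpa only [neg_one_smul, neg_one_mul] using this
    · exact ((huL k).pderiv j).pderiv j
  have hnn : ∀ k, ofCurve (fun y => u y k) (deriv (deriv θ)) φ
      = -ofCurve (fun y => v y k) (deriv θ) φ := fun k => (hu k).eq _ hθ' hc.deriv hs' φ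
  have hFs : ∀ k, WeakLocInt I fun y => ∑ m : Fin d, pderiv m (F y k m.castSucc) := fun k =>
    WeakLocInt.sum _ fun m _ => (hF k m.castSucc).pderiv m
  have hA : ∀ k, WeakLocInt I fun y => absGrad (absGrad (u y k)) := fun k =>
    ((huL k).mult _).mult _
  have hFsum : ∀ k, ∑ m : Fin d, ofCurve (fun y => pderiv m (F y k m.castSucc)) θ φ
      = ofCurve (fun y => ∑ m : Fin d, pderiv m (F y k m.castSucc)) θ φ := fun k =>
    (ofCurve_sum (I := I) _ (fun m _ => (hF k m.castSucc).pderiv m) hθ.continuous hc hs φ).symm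
  refine ⟨fun k => ?_, ?_⟩
  · simp only [Pi.zero_apply, pd_ofCurve_zero, Finset.sum_const_zero, add_zero]
    rw [Fin.sum_univ_castSucc, Fin.sum_univ_castSucc]
    simp only [pd_castSucc_ofCurve, pd_last, neg_neg, hsq, hnn, hFsum]
    refine Fin.lastCases ?_ (fun k => ?_) k
    · have h1 := hqn.eq θ hθ hc hs φ
      rw [ofCurve_sub (fun φ => ((hu _).right φ).add (hF _ _ φ)) hp hθ'.continuous hc.deriv hs',
        ofCurve_add (hu _).right (hF _ _) hθ'.continuous hc.deriv hs'] at h1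
      have h2 : ofCurve (fun y => ∑ m : Fin d, pderiv m (F y (Fin.last d) m.castSucc)) θ φ
          = ofCurve (fun y => absGrad (absGrad (u y (Fin.last d)))) θ φ
            - ofCurve (fun y => q y (Fin.last d)) θ φ := by
        rw [← ofCurve_sub (hA _) hqn.right hθ.continuous hc hs]
        congr 1
        ext y : 1
        rw [← eqn y]
        abel
      rw [h2, pd_last]
      linear_combination h1
    · have h1 := (hq k).eq θ hθ hc hs φ
      rw [ofCurve_add (hu _).right (hF _ _) hθ'.continuous hc.deriv hs'] at h1
      have h2 : ofCurve (fun y => ∑ m : Fin d, pderiv m (F y k.castSucc m.castSucc)) θ φ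
          = ofCurve (fun y => absGrad (absGrad (u y k.castSucc))) θ φ
            - ofCurve (fun y => q y k.castSucc) θ φ + ofCurve (fun y => pderiv k (p y)) θ φ := by
        rw [← ofCurve_sub (hA _) (hq k).right hθ.continuous hc hs,
          ← ofCurve_add ((hA _).sub (hq k).right) (hp.pderiv k) hθ.continuous hc hs]
        congr 1
        ext y : 1
        rw [← eqk y]
        abel
      rw [h2, pd_castSucc_ofCurve]
      linear_combination h1
  · rw [Fin.sum_univ_castSucc]
    simp only [pd_castSucc_ofCurve, pd_last]
    have h1 := (hu (Fin.last d)).eq θ hθ hc hs φ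
    rw [h1, neg_neg, ← ofCurve_sum (I := I) _
      (fun m _ => (huL m.castSucc).pderiv m)
      hθ.continuous hc hs,
      ← ofCurve_add (WeakLocInt.sum _
        (fun m _ => (huL m.castSucc).pderiv m))
        (hu _).right hθ.continuous hc hs]
    simp only [hdiv]
    exact ofCurve_zero θ φ

/-! ### The whole-space solution -/

/-- `∑_m R_m G_{k,m}`, the sum over tangential `m`. -/
def rowSum (G : ℝ → Fin (d + 1) → Fin (d + 1) → TDist d) (k : Fin (d + 1)) (y : ℝ) : TDist d :=
  ∑ m : Fin d, riesz m (G y k m.castSucc)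

/-- `∑_ℓ R_ℓ G_{ℓ,n}`, the sum over tangential `ℓ`. -/
def colSum (G : ℝ → Fin (d + 1) → Fin (d + 1) → TDist d) (y : ℝ) : TDist d :=
  ∑ l : Fin d, riesz l (G y l.castSucc (Fin.last d))

/-- `∑_{ℓ,m} R_ℓ R_m G_{ℓ,m}`, the sum over tangential indices. -/
def doubleSum (G : ℝ → Fin (d + 1) → Fin (d + 1) → TDist d) (y : ℝ) : TDist d :=
  ∑ l : Fin d, riesz l (rowSum G l.castSucc y)

section

variable {G : ℝ → Fin (d + 1) → Fin (d + 1) → TDist d}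

theorem IsTame.rowSum (hG : ∀ k l, IsTame univ fun y => G y k l) (k : Fin (d + 1)) :
    IsTame univ (rowSum G k) :=
  IsTame.sum _ fun _ _ => (hG _ _).mult _

theorem IsTame.colSum (hG : ∀ k l, IsTame univ fun y => G y k l) : IsTame univ (colSum G) :=
  IsTame.sum _ fun _ _ => (hG _ _).mult _

theorem IsTame.doubleSum (hG : ∀ k l, IsTame univ fun y => G y k l) :
    IsTame univ (doubleSum G) :=
  IsTame.sum _ fun _ _ => (IsTame.rowSum hG _).mult _

variable {c c₂ : ℝ → ℝ}

theorem kconv_rowSum (hG : ∀ k l, IsTame univ fun y => G y k l) (hc : IsFactor c)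
    (hc₂ : IsFactor c₂) (k : Fin (d + 1)) (x : ℝ) : kconv c c₂ (rowSum G k) x
      = ∑ m : Fin d, riesz m (kconv c c₂ (fun y => G y k m.castSucc) x) :=
  (kconv_sum Finset.univ (fun _ _ => (hG _ _).mult _) hc hc₂ x).trans
    (Finset.sum_congr rfl fun _ _ => kconv_mult (hG _ _) hc hc₂ _ x)

theorem kconv_colSum (hG : ∀ k l, IsTame univ fun y => G y k l) (hc : IsFactor c)
    (hc₂ : IsFactor c₂) (x : ℝ) : kconv c c₂ (colSum G) x
      = ∑ l : Fin d, riesz l (kconv c c₂ (fun y => G y l.castSucc (Fin.last d)) x) :=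
  (kconv_sum Finset.univ (fun _ _ => (hG _ _).mult _) hc hc₂ x).trans
    (Finset.sum_congr rfl fun _ _ => kconv_mult (hG _ _) hc hc₂ _ x)

theorem kconv_doubleSum (hG : ∀ k l, IsTame univ fun y => G y k l) (hc : IsFactor c)
    (hc₂ : IsFactor c₂) (x : ℝ) : kconv c c₂ (doubleSum G) x
      = ∑ l : Fin d, riesz l (kconv c c₂ (rowSum G l.castSucc) x) :=
  (kconv_sum Finset.univ (fun _ _ => (IsTame.rowSum hG _).mult _) hc hc₂ x).trans
    (Finset.sum_congr rfl fun _ _ => kconv_mult (IsTame.rowSum hG _) hc hc₂ _ x)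

/-- The whole-space velocity with source `G`, with the sums over the entries of `G` carried out
before the convolution. -/
def wholeVelocity (G : ℝ → Fin (d + 1) → Fin (d + 1) → TDist d) (x : ℝ) : Fin (d + 1) → TDist d :=
  let n := Fin.last d
  Fin.lastCases (motive := fun _ => TDist d)
    ((1 / 4 : ℂ) • (conv3 (rowSum G n) x - conv4 (doubleSum G) x - conv4 (fun y => G y n n) x
      - conv5 (colSum G) x))
    (fun k => (1 / 2 : ℂ) • (conv1 (rowSum G k.castSucc) x - conv2 (fun y => G y k.castSucc n) x)
      + (1 / 4 : ℂ) • riesz k (conv3 (doubleSum G) x - conv4 (rowSum G n) x - conv4 (colSum G) x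
        - conv5 (fun y => G y n n) x))

theorem wholeVelocity_castSucc (x : ℝ) (k : Fin d) : wholeVelocity G x k.castSucc
    = (1 / 2 : ℂ) • (conv1 (rowSum G k.castSucc) x
        - conv2 (fun y => G y k.castSucc (Fin.last d)) x)
      + (1 / 4 : ℂ) • riesz k (conv3 (doubleSum G) x - conv4 (rowSum G (Fin.last d)) x
        - conv4 (colSum G) x - conv5 (fun y => G y (Fin.last d) (Fin.last d)) x) := by
  simp [wholeVelocity]

theorem wholeVelocity_last (x : ℝ) : wholeVelocity G x (Fin.last d)
    = (1 / 4 : ℂ) • (conv3 (rowSum G (Fin.last d)) x - conv4 (doubleSum G) x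
      - conv4 (fun y => G y (Fin.last d) (Fin.last d)) x - conv5 (colSum G) x) := by
  simp [wholeVelocity]

/-- The whole-space pressure `-(-Δ)⁻¹ div div G`; the first term is the local part of the
convolution with the second normal derivative of the kernel. -/
def wholePressure (G : ℝ → Fin (d + 1) → Fin (d + 1) → TDist d) (x : ℝ) : TDist d :=
  G x (Fin.last d) (Fin.last d) + (1 / 2 : ℂ) • absGrad (conv2 (rowSum G (Fin.last d)) x
    + conv2 (colSum G) x - conv1 (doubleSum G) x
    - conv1 (fun y => G y (Fin.last d) (Fin.last d)) x)

theorem isTame_wholeVelocity (hG : ∀ k l, IsTame univ fun y => G y k l) (k : Fin (d + 1)) :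
    IsTame univ fun y => wholeVelocity G y k := by
  have hn := hG (Fin.last d) (Fin.last d)
  refine Fin.lastCases ?_ (fun k => ?_) k
  · simp only [wholeVelocity_last]
    exact (((((IsTame.rowSum hG _).kconv isFactor_one isFactor_abs).sub
      ((IsTame.doubleSum hG).kconv isFactor_zero isFactor_id)).sub
      (hn.kconv isFactor_zero isFactor_id)).sub
      ((IsTame.colSum hG).kconv isFactor_one isFactor_abs.neg)).smul _
  · simp only [wholeVelocity_castSucc]
    have h1 := ((IsTame.rowSum hG k.castSucc).kconv isFactor_one isFactor_zero).sub
      ((hG k.castSucc (Fin.last d)).kconv isFactor_sign isFactor_zero)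
    have h2 := ((((IsTame.doubleSum hG).kconv isFactor_one isFactor_abs).sub
      ((IsTame.rowSum hG (Fin.last d)).kconv isFactor_zero isFactor_id)).sub
      ((IsTame.colSum hG).kconv isFactor_zero isFactor_id)).sub
      (hn.kconv isFactor_one isFactor_abs.neg)
    exact (h1.smul (1 / 2)).add ((h2.mult (rieszSymb k)).smul (1 / 4))

theorem isTame_wholePressure (hG : ∀ k l, IsTame univ fun y => G y k l) :
    IsTame univ (wholePressure G) := by
  have hn := hG (Fin.last d) (Fin.last d)
  have h := ((((IsTame.rowSum hG (Fin.last d)).kconv isFactor_sign isFactor_zero).add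
    ((IsTame.colSum hG).kconv isFactor_sign isFactor_zero)).sub
    ((IsTame.doubleSum hG).kconv isFactor_one isFactor_zero)).sub
    (hn.kconv isFactor_one isFactor_zero)
  exact hn.add ((h.mult (radial (fun ρ => ρ) contDiff_id)).smul (1 / 2))

theorem continuous_wholeVelocity (hG : ∀ k l, IsTame univ fun y => G y k l) (k : Fin (d + 1))
    (φ : TestSpace d) : Continuous fun y => wholeVelocity G y k φ := by
  have hn := hG (Fin.last d) (Fin.last d)
  refine Fin.lastCases ?_ (fun k => ?_) k
  · simp only [wholeVelocity_last, LinearMap.smul_apply, LinearMap.sub_apply]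
    exact ((((continuous_kconv (IsTame.rowSum hG _) isFactor_one isFactor_abs φ).sub
      (continuous_kconv (IsTame.doubleSum hG) isFactor_zero isFactor_id φ)).sub
      (continuous_kconv hn isFactor_zero isFactor_id φ)).sub
      (continuous_kconv (IsTame.colSum hG) isFactor_one isFactor_abs.neg φ)).const_smul (1 / 4 : ℂ)
  · simp only [wholeVelocity_castSucc, LinearMap.smul_apply, LinearMap.sub_apply,
      LinearMap.add_apply, riesz, mult_apply]
    have h1 := (continuous_kconv (IsTame.rowSum hG k.castSucc) isFactor_one isFactor_zero φ).sub
      (continuous_kconv (hG k.castSucc (Fin.last d)) isFactor_sign isFactor_zero φ)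
    have h2 := fun ψ => (((continuous_kconv (IsTame.doubleSum hG) isFactor_one isFactor_abs ψ).sub
      (continuous_kconv (IsTame.rowSum hG (Fin.last d)) isFactor_zero isFactor_id ψ)).sub
      (continuous_kconv (IsTame.colSum hG) isFactor_zero isFactor_id ψ)).sub
      (continuous_kconv hn isFactor_one isFactor_abs.neg ψ)
    exact (h1.const_smul (1 / 2 : ℂ)).add ((h2 _).const_smul (1 / 4 : ℂ))

theorem sum_pderiv_row (y : ℝ) (k : Fin (d + 1)) :
    ∑ m : Fin d, pderiv m (G y k m.castSucc) = absGrad (rowSum G k y) := by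
  simp only [pderiv_eq, rowSum, map_sum, absGrad_riesz]

/-- The whole-space Stokes equations.  The table of derivatives of the five convolutions is applied to
the velocity and once more to its derivative; the source enters through the jump of `K⁽²⁾`, and the
remaining terms cancel by `∑ R_k² = -1` and `K⁽³⁾ + K⁽⁵⁾ = 2K⁽¹⁾`. -/
theorem solvesOn_wholeVelocity (hG : ∀ k l, IsTame univ fun y => G y k l) :
    SolvesOn univ 0 G (wholeVelocity G) (wholePressure G) := by
  set n := Fin.last d with hn
  have hr := IsTame.rowSum hG
  have hcol := IsTame.colSum hG
  have hdb := IsTame.doubleSum hG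
  have hnn := hG n n
  -- `v` is the normal derivative of the velocity
  let v : ℝ → Fin (d + 1) → TDist d := fun y => Fin.lastCases (motive := fun _ => TDist d)
    ((1 / 4 : ℂ) • (-absGrad (conv4 (rowSum G n) y) - absGrad (conv5 (doubleSum G) y)
      - absGrad (conv5 (fun y => G y n n) y)
      - (absGrad (conv4 (colSum G) y) - (2 : ℂ) • absGrad (conv2 (colSum G) y))))
    (fun k => (1 / 2 : ℂ) • (-absGrad (conv2 (rowSum G k.castSucc) y)
        - ((2 : ℂ) • G y k.castSucc n - absGrad (conv1 (fun y => G y k.castSucc n) y)))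
      + (1 / 4 : ℂ) • riesz k (-absGrad (conv4 (doubleSum G) y) - absGrad (conv5 (rowSum G n) y)
        - absGrad (conv5 (colSum G) y) - (absGrad (conv4 (fun y => G y n n) y)
          - (2 : ℂ) • absGrad (conv2 (fun y => G y n n) y))))
  -- `q` is what the momentum equations demand of the derivatives of `v_k + G_{k,n}` and of
  -- `v_n + G_{n,n} - p`
  let q : ℝ → Fin (d + 1) → TDist d := fun y => Fin.lastCases (motive := fun _ => TDist d)
    (absGrad (absGrad (wholeVelocity G y n)) - absGrad (rowSum G n y))
    (fun k => absGrad (absGrad (wholeVelocity G y k.castSucc)) + pderiv k (wholePressure G y)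
      - absGrad (rowSum G k.castSucc y))
  have hvk : ∀ y (k : Fin d), v y k.castSucc = _ := fun y k => Fin.lastCases_castSucc _
  have hvn : ∀ y, v y n = _ := fun y => Fin.lastCases_last
  have hqk : ∀ y (k : Fin d), q y k.castSucc = _ := fun y k => Fin.lastCases_castSucc _
  have hqn : ∀ y, q y n = _ := fun y => Fin.lastCases_last
  refine solvesOn_of_hasWeakDeriv (v := v) (q := q) (fun k => ?_) (fun k => ?_) ?_
    (fun k l => (hG k l).weakLocInt isOpen_univ)
    ((isTame_wholePressure hG).weakLocInt isOpen_univ) (fun y k => ?_) (fun y => ?_) (fun y => ?_)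
  · refine Fin.lastCases ?_ (fun k => ?_) k
    · exact (((((hasWeakDeriv_conv3 (hr n)).sub (hasWeakDeriv_conv4 hdb)).sub
        (hasWeakDeriv_conv4 hnn)).sub (hasWeakDeriv_conv5 hcol)).smul (1 / 4)).congr
        (fun y => wholeVelocity_last y) (fun y => hvn y)
    · exact ((((hasWeakDeriv_conv1 (hr k.castSucc)).sub (hasWeakDeriv_conv2 (hG _ _))).smul
        (1 / 2)).add (((((hasWeakDeriv_conv3 hdb).sub (hasWeakDeriv_conv4 (hr n))).sub
        (hasWeakDeriv_conv4 hcol)).sub (hasWeakDeriv_conv5 hnn)).riesz k |>.smul (1 / 4))).congr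
        (fun y => wholeVelocity_castSucc y k) (fun y => hvk y k)
  · refine ((((hasWeakDeriv_conv1 (hG k.castSucc n)).sub
      (hasWeakDeriv_conv2 (hr k.castSucc))).absGrad.smul (1 / 2)).add
      ((((((hasWeakDeriv_conv2 hnn).smul 2).sub (hasWeakDeriv_conv4 hdb)).sub
      (hasWeakDeriv_conv5 (hr n))).sub (hasWeakDeriv_conv5 hcol)).sub
      (hasWeakDeriv_conv4 hnn) |>.absGrad.riesz k |>.smul (1 / 4))).congr
      (fun y => ?_) (fun y => ?_)
    · rw [hvk]
      simp only [map_sub, map_smul, map_neg]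
      module
    · rw [hqk, wholeVelocity_castSucc, wholePressure, pderiv_eq]
      have e1 := congrArg (fun T => riesz k (absGrad (absGrad T))) (conv3_add_conv5 hdb y)
      simp only [map_add, map_sub, map_smul, map_neg, absGrad_riesz] at e1 ⊢
      linear_combination (norm := module) (1 / 4 : ℂ) • e1
  · refine (((((hasWeakDeriv_conv1 hdb).sub (hasWeakDeriv_conv2 (hr n))).sub
      (hasWeakDeriv_conv2 hcol)).add (hasWeakDeriv_conv1 hnn)).absGrad.smul (1 / 2) |>.add
      (((((hasWeakDeriv_conv2 hcol).smul 2).sub (hasWeakDeriv_conv4 hcol)).sub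
      (hasWeakDeriv_conv5 hdb)).sub (hasWeakDeriv_conv5 hnn) |>.sub
      (hasWeakDeriv_conv4 (hr n)) |>.absGrad.smul (1 / 4))).congr
      (fun y => ?_) (fun y => ?_)
    · rw [hvn, wholePressure]
      simp only [map_add, map_sub, map_smul]
      module
    · rw [hqn, wholeVelocity_last]
      have e1 := congrArg (fun T => absGrad (absGrad T)) (conv3_add_conv5 (hr n) y)
      simp only [map_add, map_sub, map_smul, map_neg] at e1 ⊢
      linear_combination (norm := module) (1 / 4 : ℂ) • e1
  · rw [hqk, sum_pderiv_row]
    abel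
  · rw [hqn, sum_pderiv_row]
    abel
  · have s1 : ∀ T : TDist d, ∑ k : Fin d, riesz k (riesz k T) = -T := sum_riesz_riesz
    rw [hvn]
    simp only [wholeVelocity_castSucc, pderiv_eq, absGrad_riesz, map_add, map_sub, map_smul,
      Finset.sum_add_distrib, Finset.sum_sub_distrib, ← Finset.smul_sum, s1]
    simp only [← absGrad_riesz, ← map_sum]
    simp only [conv1, conv2]
    rw [← kconv_doubleSum hG isFactor_one isFactor_zero, ← kconv_colSum hG isFactor_sign isFactor_zero]
    have e1 := congrArg absGrad (conv3_add_conv5 hdb y)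
    simp only [map_add, map_smul] at e1 ⊢
    linear_combination (norm := module) (-1 / 4 : ℂ) • e1

end

/-- The operators on the half line that define `u^w[F]` are convolutions on the line with the entries
of the reflected tensor: even entries go with the sign `+` and odd ones with `-`. -/
theorem uWhole_eq {F : ℝ → Fin (d + 1) → Fin (d + 1) → TDist d}
    (hF : ∀ k l, IsTame (Ioi 0) fun y => F y k l) :
    uWhole F = wholeVelocity (extendForce F) := by
  have hG := isTame_extendForce hF
  have hext : ∀ (k : Fin (d + 1)) (m : Fin d) (y : ℝ), 0 < y →
      extendForce F y k m.castSucc = F y k m.castSucc ∧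
      extendForce F (-y) k m.castSucc = (1 : ℂ) • F y k m.castSucc := fun k m y hy => by
    simp [extendForce, hy.le, hy, Fin.castSucc_ne_last]
  have hextn : ∀ (k : Fin (d + 1)) (y : ℝ), 0 < y →
      extendForce F y k (Fin.last d) = F y k (Fin.last d) ∧
      extendForce F (-y) k (Fin.last d) = (-1 : ℂ) • F y k (Fin.last d) := fun k y hy => by
    simp [extendForce, hy.le, hy]
  have L1 : ∀ k (m : Fin d), Lop K1 1 (fun y => F y k m.castSucc)
      = conv1 (fun y => extendForce F y k m.castSucc) := fun k m =>
    funext (Lop_eq_kconv (hG _ _) isFactor_one isFactor_zero mult_K1 (hext k m))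
  have L2 : ∀ k, Lop K2 (-1) (fun y => F y k (Fin.last d))
      = conv2 (fun y => extendForce F y k (Fin.last d)) := fun k =>
    funext (Lop_eq_kconv (hG _ _) isFactor_sign isFactor_zero mult_K2 (hextn k))
  have L3 : ∀ k (m : Fin d), Lop K3 1 (fun y => F y k m.castSucc)
      = conv3 (fun y => extendForce F y k m.castSucc) := fun k m =>
    funext (Lop_eq_kconv (hG _ _) isFactor_one isFactor_abs mult_K3 (hext k m))
  have L4 : ∀ k (m : Fin d), Lop K4 1 (fun y => F y k m.castSucc)
      = conv4 (fun y => extendForce F y k m.castSucc) := fun k m =>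
    funext (Lop_eq_kconv (hG _ _) isFactor_zero isFactor_id mult_K4 (hext k m))
  have L4n : ∀ k, Lop K4 (-1) (fun y => F y k (Fin.last d))
      = conv4 (fun y => extendForce F y k (Fin.last d)) := fun k =>
    funext (Lop_eq_kconv (hG _ _) isFactor_zero isFactor_id mult_K4 (hextn k))
  have L5 : ∀ k, Lop K5 (-1) (fun y => F y k (Fin.last d))
      = conv5 (fun y => extendForce F y k (Fin.last d)) := fun k =>
    funext (Lop_eq_kconv (hG _ _) isFactor_one isFactor_abs.neg mult_K5 (hextn k))
  ext x k : 2
  refine Fin.lastCases ?_ (fun k => ?_) k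
  · rw [wholeVelocity_last]
    simp only [uWhole, Fin.lastCases_last, L3, L4, L4n, L5]
    simp only [conv3, conv4, conv5]
    rw [kconv_rowSum hG isFactor_one isFactor_abs, kconv_doubleSum hG isFactor_zero isFactor_id,
      kconv_colSum hG isFactor_one isFactor_abs.neg]
    simp only [kconv_rowSum hG isFactor_zero isFactor_id, map_sum, smul_sub]
  · rw [wholeVelocity_castSucc]
    simp only [uWhole, Fin.lastCases_castSucc, L1, L2, L3, L4, L4n, L5]
    simp only [conv1, conv2, conv3, conv4, conv5]
    rw [kconv_rowSum hG isFactor_one isFactor_zero, kconv_doubleSum hG isFactor_one isFactor_abs,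
      kconv_colSum hG isFactor_zero isFactor_id, kconv_rowSum hG isFactor_zero isFactor_id]
    simp only [kconv_rowSum hG isFactor_one isFactor_abs, map_sum, smul_sub, map_sub, map_add,
      Finset.sum_add_distrib, smul_add]
    abel

/-! ### The boundary operator -/

theorem IsDistribution.zero : IsDistribution (0 : TDist d) := fun _ _ _ => ⟨0, 0, by simp⟩

theorem IsDistribution.neg {T : TDist d} (h : IsDistribution T) : IsDistribution (-T) := by
  simpa using h.smul (-1)

/-- The curve `x ↦ e^{-x|∇'|}(B + x D)`. -/
def polyCurve (B D : TDist d) (x : ℝ) : TDist d := poisson x (B + (x : ℂ) • D)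

theorem polyCurve_apply (B D : TDist d) (x : ℝ) (φ : TestSpace d) :
    polyCurve B D x φ = B (expTest x φ) + (x : ℂ) * D (expTest x φ) := by
  rw [polyCurve, poisson_apply]
  rfl

theorem polyCurve_zero (B D : TDist d) : polyCurve B D 0 = B := by
  simp [polyCurve, poisson_zero]

theorem absGrad_poisson (x : ℝ) (T : TDist d) : absGrad (poisson x T) = poisson x (absGrad T) :=
  mult_comm _ _ _

theorem riesz_poisson (k : Fin d) (x : ℝ) (T : TDist d) :
    riesz k (poisson x T) = poisson x (riesz k T) := mult_comm _ _ _

/-- The derivative of `e^{-x|∇'|}(B + x D)` is the curve of the same form with coefficients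
`D - |∇'|B` and `-|∇'|D`. -/
theorem hasDerivAt_polyCurve {B D : TDist d} (hB : IsDistribution B) (hD : IsDistribution D)
    (φ : TestSpace d) (x : ℝ) : HasDerivAt (fun y => polyCurve B D y φ)
      (polyCurve (D - absGrad B) (-absGrad D) x φ) x := by
  obtain ⟨r, R, hr, hφ⟩ := φ.2
  obtain ⟨N, C, -, h⟩ := isDistribution_iff.1 hB r R hr
  obtain ⟨N', C', -, h'⟩ := isDistribution_iff.1 hD r R hr
  have h1 := hasDerivAt_apply_expTest_const hr hφ h (hasDerivAt_id x)
  have h2 := hasDerivAt_apply_expTest_const hr hφ h' (hasDerivAt_id x)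
  simp only [polyCurve_apply]
  refine (h1.add ((hasDerivAt_id x).ofReal_comp.mul h2)).congr_deriv ?_
  simp only [id, LinearMap.sub_apply, LinearMap.neg_apply, absGrad_apply, absTest_expTest]
  push_cast
  ring

theorem continuous_polyCurve {B D : TDist d} (hB : IsDistribution B) (hD : IsDistribution D)
    (φ : TestSpace d) : Continuous fun y => polyCurve B D y φ :=
  continuous_iff_continuousAt.2 fun x => (hasDerivAt_polyCurve hB hD φ x).continuousAt

theorem hasWeakDeriv_polyCurve {B D : TDist d} (hB : IsDistribution B) (hD : IsDistribution D) :
    HasWeakDeriv univ (polyCurve B D) (polyCurve (D - absGrad B) (-absGrad D)) :=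
  HasWeakDeriv.of_hasDerivAt (hasDerivAt_polyCurve hB hD) (continuous_polyCurve
    (hD.sub (hB.mult _)) (hD.mult _).neg)

/-- The factor `x` is absorbed by the exponential decay on each annulus. -/
theorem isTame_polyCurve {B D : TDist d} (hB : IsDistribution B) (hD : IsDistribution D) :
    IsTame (Ioi 0) (polyCurve B D) := by
  refine ⟨fun φ => (continuous_polyCurve hB hD φ).aestronglyMeasurable, fun r R hr => ?_⟩
  obtain ⟨N, C, hC, h⟩ := isDistribution_iff.1 hB r R hr
  obtain ⟨N', C', hC', h'⟩ := isDistribution_iff.1 hD r R hr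
  obtain ⟨M, K, hK, hp⟩ := exists_boundedOn_poisson (d := d) hr R (max N N')
  refine ⟨M, fun x => K * ((1 + r⁻¹) * (C + C')), fun ε hε => ?_, ?_⟩
  · exact ((integrable_exp_neg_mul_abs hε).mul_const _).integrableOn
  · filter_upwards [ae_restrict_mem measurableSet_Ioi] with x hx φ hφ
    have hx0 : 0 < x := hx
    have hsum := h.add (h'.smul (x : ℂ)) hC (by positivity)
    have h1 := hp x hx0.le _ _ (by positivity) hsum φ hφ
    refine h1.trans (mul_le_mul_of_nonneg_right ?_ (schwartzNorm_nonneg _ _))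
    rw [Complex.norm_real, Real.norm_of_nonneg hx0.le]
    have h2 := one_add_mul_exp_le hr hx0.le
    have h3 : Real.exp (-r * x) ≤ 1 := Real.exp_le_one_iff.2 (by nlinarith)
    have h4 : C + x * C' ≤ (1 + x) * (C + C') := by nlinarith
    calc _ ≤ K * Real.exp (-(2 * r * x)) * ((1 + x) * (C + C')) := by gcongr
      _ = K * ((1 + x) * Real.exp (-(2 * r * x)) * (C + C')) := by ring
      _ ≤ K * ((1 + r⁻¹) * Real.exp (-r * x) * (C + C')) := by gcongr
      _ ≤ K * ((1 + r⁻¹) * 1 * (C + C')) := by gcongr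
      _ = _ := by ring

/-- The coefficient of `x` in the boundary operator, so that
`U^boundary[a](x) = e^{-x|∇'|}(a + x · slope a)`. -/
def boundarySlope (a : Fin (d + 1) → TDist d) : Fin (d + 1) → TDist d :=
  Fin.lastCases (motive := fun _ => TDist d) (absGrad (a (Fin.last d)) - tdiv a)
    (fun k => riesz k (tdiv a) - pderiv k (a (Fin.last d)))

theorem boundarySlope_last (a : Fin (d + 1) → TDist d) :
    boundarySlope a (Fin.last d) = absGrad (a (Fin.last d)) - tdiv a := by
  simp [boundarySlope]

theorem boundarySlope_castSucc (a : Fin (d + 1) → TDist d) (k : Fin d) :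
    boundarySlope a k.castSucc = -riesz k (boundarySlope a (Fin.last d)) := by
  simp [boundarySlope, pderiv_eq]

theorem boundaryOp_eq (a : Fin (d + 1) → TDist d) (x : ℝ) (k : Fin (d + 1)) :
    boundaryOp a x k = polyCurve (a k) (boundarySlope a k) x := by
  refine Fin.lastCases ?_ (fun k => ?_) k
  · simp [boundaryOp, polyCurve, boundarySlope, smul_sub, add_sub_assoc]
  · simp [boundaryOp, polyCurve, boundarySlope, smul_sub, add_sub_assoc]

theorem boundaryOp_sub (a b : Fin (d + 1) → TDist d) (x : ℝ) :
    boundaryOp (a - b) x = boundaryOp a x - boundaryOp b x := by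
  have ht : tdiv (a - b) = tdiv a - tdiv b := by
    simp [tdiv, Finset.sum_sub_distrib]
  ext k : 1
  refine Fin.lastCases ?_ (fun k => ?_) k
  · simp only [boundaryOp, Fin.lastCases_last, Pi.sub_apply, ht, map_sub, map_add, map_smul]
    module
  · simp only [boundaryOp, Fin.lastCases_castSucc, Pi.sub_apply, ht, map_sub, map_add, map_smul]
    module

section

variable {a : Fin (d + 1) → TDist d}

theorem IsDistribution.tdiv (ha : ∀ k, IsDistribution (a k)) : IsDistribution (tdiv a) :=
  IsDistribution.sum _ fun j _ => by
    rw [pderiv_eq]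
    exact ((ha _).mult _).mult _

theorem IsDistribution.boundarySlope (ha : ∀ k, IsDistribution (a k)) (k : Fin (d + 1)) :
    IsDistribution (boundarySlope a k) := by
  have hl : IsDistribution (HalfSpaceStokes.boundarySlope a (Fin.last d)) := by
    rw [boundarySlope_last]
    exact ((ha _).mult _).sub (IsDistribution.tdiv ha)
  refine Fin.lastCases hl (fun k => ?_) k
  rw [boundarySlope_castSucc]
  exact (hl.mult (rieszSymb k)).neg

theorem isTame_boundaryOp (ha : ∀ k, IsDistribution (a k)) (k : Fin (d + 1)) :
    IsTame (Ioi 0) fun y => boundaryOp a y k := by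
  simp only [boundaryOp_eq]
  exact isTame_polyCurve (ha k) (IsDistribution.boundarySlope ha k)

theorem continuous_boundaryOp (ha : ∀ k, IsDistribution (a k)) (k : Fin (d + 1))
    (φ : TestSpace d) : Continuous fun y => boundaryOp a y k φ := by
  simp only [boundaryOp_eq]
  exact continuous_polyCurve (ha k) (IsDistribution.boundarySlope ha k) φ

theorem boundaryOp_zero (a : Fin (d + 1) → TDist d) : boundaryOp a 0 = a := by
  ext k : 1
  rw [boundaryOp_eq, polyCurve_zero]

/-- The pressure of the boundary flow. -/
def boundaryPressure (a : Fin (d + 1) → TDist d) : ℝ → TDist d :=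
  polyCurve ((2 : ℂ) • boundarySlope a (Fin.last d)) 0

theorem isTame_boundaryPressure (ha : ∀ k, IsDistribution (a k)) :
    IsTame (Ioi 0) (boundaryPressure a) :=
  isTame_polyCurve ((IsDistribution.boundarySlope ha _).smul 2)
    IsDistribution.zero

theorem solvesOn_boundaryOp (ha : ∀ k, IsDistribution (a k)) :
    SolvesOn (Ioi 0) 0 0 (boundaryOp a) (boundaryPressure a) := by
  set n := Fin.last d with hn
  let D := boundarySlope a
  have hD : ∀ k, IsDistribution (D k) := IsDistribution.boundarySlope ha
  -- the derivatives stay in the class of curves `e^{-y|∇'|}(B + y D)`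
  let v : ℝ → Fin (d + 1) → TDist d := fun y k => polyCurve (D k - absGrad (a k)) (-absGrad (D k)) y
  have hv : ∀ k, HasWeakDeriv univ (fun y => v y k) _ := fun k =>
    hasWeakDeriv_polyCurve ((hD k).sub ((ha k).mult _)) ((hD k).mult _).neg
  have hp : HasWeakDeriv univ (boundaryPressure a) _ := hasWeakDeriv_polyCurve ((hD n).smul 2)
    IsDistribution.zero
  let q : ℝ → Fin (d + 1) → TDist d := fun y => Fin.lastCases (motive := fun _ => TDist d)
    (absGrad (absGrad (boundaryOp a y n)))
    (fun k => absGrad (absGrad (boundaryOp a y k.castSucc)) + pderiv k (boundaryPressure a y))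
  have hqk : ∀ y (k : Fin d), q y k.castSucc = _ := fun y k => Fin.lastCases_castSucc _
  have hqn : ∀ y, q y n = _ := fun y => Fin.lastCases_last
  have hs : ∀ k, D (Fin.castSucc k) = -riesz k (D n) := boundarySlope_castSucc a
  have hDn : D n = absGrad (a n) - tdiv a := boundarySlope_last a
  refine solvesOn_of_hasWeakDeriv (v := v) (q := q) (fun k => ?_) (fun k => ?_) ?_ (fun k l => ?_)
    ((isTame_boundaryPressure ha).weakLocInt isOpen_Ioi) (fun y k => ?_) (fun y => ?_)
    (fun y => ?_)
  · exact ((hasWeakDeriv_polyCurve (ha k) (hD k)).mono (subset_univ _)).congr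
      (fun y => boundaryOp_eq a y k) fun y => rfl
  · refine ((hv k.castSucc).mono (subset_univ _)).congr (fun y => ?_) (fun y => ?_)
    · exact add_zero _
    · rw [hqk, boundaryOp_eq, pderiv_eq]
      change absGrad (absGrad (polyCurve _ (D _) y)) + riesz k (absGrad (polyCurve ((2 : ℂ) • D n) 0 y)) = _
      simp only [polyCurve, hs, map_add, map_sub, map_smul, map_neg, absGrad_poisson, absGrad_riesz,
        riesz_poisson, map_zero]
      module
  · refine (((hv n).sub hp).mono (subset_univ _)).congr (fun y => ?_) (fun y => ?_)
    · rw [Pi.zero_apply, Pi.zero_apply, Pi.zero_apply, add_zero]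
    · rw [hqn, boundaryOp_eq]
      change absGrad (absGrad (polyCurve _ (D _) y)) = _
      simp only [polyCurve, map_add, map_sub, map_smul, map_neg, absGrad_poisson, map_zero]
      module
  · exact fun φ => locallyIntegrableOn_zero
  · rw [hqk]
    simp
  · rw [hqn, hn]
    simp
  · have ht : poisson y (tdiv a) = ∑ k : Fin d, poisson y (riesz k (absGrad (a k.castSucc))) := by
      simp only [tdiv, map_sum, pderiv_eq]
    have hr : ∀ T : TDist d, ∑ k : Fin d, poisson y (riesz k (riesz k T)) = -poisson y T :=
      fun T => by rw [← map_sum, sum_riesz_riesz, map_neg]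
    simp only [v, boundaryOp_eq, pderiv_eq]
    change ∑ k : Fin d, riesz k (absGrad (polyCurve (a k.castSucc) (D k.castSucc) y)) + _ = 0
    simp only [polyCurve, hs, map_add, map_sub, map_smul, map_neg, absGrad_poisson, absGrad_riesz,
      riesz_poisson, Finset.sum_add_distrib, ← Finset.smul_sum, smul_neg, Finset.sum_neg_distrib,
      hr, ← ht]
    rw [hDn]
    simp only [map_sub]
    module

end

/-! ### Linearity of the equations -/

theorem pd_ofCurve_sub {I : Set ℝ} {f g : ℝ → TDist d} (hf : WeakLocInt I f)
    (hg : WeakLocInt I g) {θ : ℝ → ℝ} (hθ : ContDiff ℝ ∞ θ) (hc : HasCompactSupport θ)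
    (hs : tsupport θ ⊆ I) (m : Fin (d + 1)) (φ : TestSpace d) :
    pd m (ofCurve fun y => f y - g y) θ φ = pd m (ofCurve f) θ φ - pd m (ofCurve g) θ φ := by
  have hs' := tsupport_deriv_subset.trans hs
  refine Fin.lastCases ?_ (fun j => ?_) m
  · simp only [pd_last]
    rw [ofCurve_sub hf hg (hθ.continuous_deriv (by simp)) hc.deriv hs']
    ring
  · simp only [pd_castSucc]
    rw [ofCurve_sub hf hg hθ.continuous hc hs]
    ring

theorem pd_pd_ofCurve_sub {I : Set ℝ} {f g : ℝ → TDist d} (hf : WeakLocInt I f)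
    (hg : WeakLocInt I g) {θ : ℝ → ℝ} (hθ : ContDiff ℝ ∞ θ) (hc : HasCompactSupport θ)
    (hs : tsupport θ ⊆ I) (m : Fin (d + 1)) (φ : TestSpace d) :
    pd m (pd m (ofCurve fun y => f y - g y)) θ φ
      = pd m (pd m (ofCurve f)) θ φ - pd m (pd m (ofCurve g)) θ φ := by
  have hs' := tsupport_deriv_subset.trans hs
  have hθ' : ContDiff ℝ ∞ (deriv θ) := (contDiff_infty_iff_deriv.1 hθ).2
  revert φ
  refine Fin.lastCases (fun φ => ?_) (fun j φ => ?_) m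
  · rw [pd_last _ θ, pd_last _ θ, pd_last _ θ, pd_ofCurve_sub hf hg hθ' hc.deriv hs']
    ring
  · rw [pd_castSucc j _ θ φ, pd_castSucc j _ θ φ, pd_castSucc j _ θ φ,
      pd_ofCurve_sub hf hg hθ hc hs]
    ring

theorem SolvesOn.sub {I : Set ℝ} {F F' : ℝ → Fin (d + 1) → Fin (d + 1) → TDist d}
    {u u' : ℝ → Fin (d + 1) → TDist d} {p p' : ℝ → TDist d} (h : SolvesOn I 0 F u p)
    (h' : SolvesOn I 0 F' u' p') (hF : ∀ k l, WeakLocInt I fun y => F y k l)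
    (hF' : ∀ k l, WeakLocInt I fun y => F' y k l) (hu : ∀ k, WeakLocInt I fun y => u y k)
    (hu' : ∀ k, WeakLocInt I fun y => u' y k) (hp : WeakLocInt I p) (hp' : WeakLocInt I p') :
    SolvesOn I 0 (F - F') (u - u') (p - p') := by
  intro θ hθ hc hs φ
  obtain ⟨h1, h2⟩ := h θ hθ hc hs φ
  obtain ⟨h1', h2'⟩ := h' θ hθ hc hs φ
  simp only [Pi.sub_apply]
  refine ⟨fun k => ?_, ?_⟩
  · have e := h1 k
    have e' := h1' k
    have ep : pd k (ofCurve (p - p')) θ φ = _ := pd_ofCurve_sub hp hp' hθ hc hs k φ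
    rw [ep]
    simp only [Pi.zero_apply, pd_ofCurve_zero, Finset.sum_const_zero] at e e' ⊢
    simp only [pd_pd_ofCurve_sub (hu k) (hu' k) hθ hc hs,
      fun m => pd_ofCurve_sub (hF k m) (hF' k m) hθ hc hs m φ, Finset.sum_sub_distrib]
    linear_combination e - e'
  · simp only [fun m => pd_ofCurve_sub (hu m) (hu' m) hθ hc hs m φ, Finset.sum_sub_distrib]
    rw [h2, h2', sub_zero]

/-- The nonlinear term can be moved to the right-hand side. -/
theorem solvesOn_iff_sub {I : Set ℝ} {N F : ℝ → Fin (d + 1) → Fin (d + 1) → TDist d}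
    {u : ℝ → Fin (d + 1) → TDist d} {p : ℝ → TDist d}
    (hN : ∀ k l, WeakLocInt I fun y => N y k l) (hF : ∀ k l, WeakLocInt I fun y => F y k l) :
    SolvesOn I N F u p ↔ SolvesOn I 0 (F - N) u p := by
  refine forall₅_congr fun θ hθ hc hs φ => and_congr_left fun _ => forall_congr' fun k => ?_
  simp only [Pi.zero_apply, Pi.sub_apply, pd_ofCurve_zero, Finset.sum_const_zero,
    fun m => pd_ofCurve_sub (hF k m) (hN k m) hθ hc hs m φ, Finset.sum_sub_distrib]
  constructor <;> intro h <;> linear_combination h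

theorem ofCurve_congr {I : Set ℝ} {f g : ℝ → TDist d} (h : ∀ y ∈ I, f y = g y) {θ : ℝ → ℝ}
    (hs : tsupport θ ⊆ I) (φ : TestSpace d) : ofCurve f θ φ = ofCurve g θ φ := by
  refine integral_congr_ae (Eventually.of_forall fun y => ?_)
  by_cases hy : θ y = 0
  · simp [hy]
  · simp only [h y (hs (subset_tsupport θ hy))]

theorem pd_ofCurve_congr {I : Set ℝ} {f g : ℝ → TDist d} (h : ∀ y ∈ I, f y = g y) {θ : ℝ → ℝ}
    (hs : tsupport θ ⊆ I) (m : Fin (d + 1)) (φ : TestSpace d) :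
    pd m (ofCurve f) θ φ = pd m (ofCurve g) θ φ := by
  have hs' := tsupport_deriv_subset.trans hs
  refine Fin.lastCases ?_ (fun j => ?_) m
  · rw [pd_last, pd_last, ofCurve_congr h hs']
  · rw [pd_castSucc, pd_castSucc, ofCurve_congr h hs]

theorem pd_pd_ofCurve_congr {I : Set ℝ} {f g : ℝ → TDist d} (h : ∀ y ∈ I, f y = g y) {θ : ℝ → ℝ}
    (hs : tsupport θ ⊆ I) (m : Fin (d + 1)) (φ : TestSpace d) :
    pd m (pd m (ofCurve f)) θ φ = pd m (pd m (ofCurve g)) θ φ := by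
  have hs' := tsupport_deriv_subset.trans hs
  revert φ
  refine Fin.lastCases (fun φ => ?_) (fun j φ => ?_) m
  · rw [pd_last _ θ, pd_last _ θ, pd_ofCurve_congr h hs']
  · rw [pd_castSucc j _ θ φ, pd_castSucc j _ θ φ, pd_ofCurve_congr h hs]

/-- The equations on `I` only involve the values on `I` of the force, the velocity and the
pressure. -/
theorem SolvesOn.congr {I : Set ℝ} {N F F' : ℝ → Fin (d + 1) → Fin (d + 1) → TDist d}
    {u u' : ℝ → Fin (d + 1) → TDist d} {p p' : ℝ → TDist d} (h : SolvesOn I N F u p)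
    (hF : ∀ y ∈ I, F y = F' y) (hu : ∀ y ∈ I, u y = u' y) (hp : ∀ y ∈ I, p y = p' y) :
    SolvesOn I N F' u' p' := by
  intro θ hθ hc hs φ
  obtain ⟨h1, h2⟩ := h θ hθ hc hs φ
  have hu' : ∀ k, ∀ y ∈ I, u y k = u' y k := fun k y hy => congrFun (hu y hy) k
  have hF' : ∀ k l, ∀ y ∈ I, F y k l = F' y k l := fun k l y hy =>
    congrFun (congrFun (hF y hy) k) l
  refine ⟨fun k => ?_, ?_⟩
  · simpa only [pd_pd_ofCurve_congr (hu' k) hs,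
      fun m => pd_ofCurve_congr (hF' k m) hs m φ, pd_ofCurve_congr hp hs] using h1 k
  · simpa only [fun m => pd_ofCurve_congr (hu' m) hs m φ] using h2

theorem SolvesOn.mono {I J : Set ℝ} {N F : ℝ → Fin (d + 1) → Fin (d + 1) → TDist d}
    {u : ℝ → Fin (d + 1) → TDist d} {p : ℝ → TDist d} (h : SolvesOn I N F u p) (hJ : J ⊆ I) :
    SolvesOn J N F u p := fun θ hθ hc hs => h θ hθ hc (hs.trans hJ)

theorem IsTame.congr {I : Set ℝ} (hI : MeasurableSet I) {f g : ℝ → TDist d} (hf : IsTame I f)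
    (h : ∀ y ∈ I, f y = g y) : IsTame I g := by
  refine ⟨fun φ => (hf.1 φ).congr ?_, fun r R hr => ?_⟩
  · filter_upwards [ae_restrict_mem hI] with y hy
    rw [h y hy]
  · obtain ⟨N, G, hG, hb⟩ := hf.2 r R hr
    refine ⟨N, G, hG, ?_⟩
    filter_upwards [hb, ae_restrict_mem hI] with y hy hyI
    rwa [← h y hyI]

theorem IsHalfSpaceSolution.congr {a : Fin (d + 1) → TDist d}
    {N F : ℝ → Fin (d + 1) → Fin (d + 1) → TDist d} {u u' : ℝ → Fin (d + 1) → TDist d}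
    {p : ℝ → TDist d} (h : IsHalfSpaceSolution a N F u p) (hu : ∀ y, 0 < y → u y = u' y) :
    IsHalfSpaceSolution a N F u' p := by
  obtain ⟨⟨h1, h2, h3, h4⟩, h5⟩ := h
  have hk : ∀ k, ∀ y ∈ Ioi (0 : ℝ), u y k = u' y k := fun k y hy => congrFun (hu y hy) k
  refine ⟨⟨fun k => (h1 k).congr measurableSet_Ioi (hk k), fun k φ => ?_, h3,
    h4.congr (fun _ _ => rfl) hu fun _ _ => rfl⟩, fun k φ => ?_⟩
  · exact (h2 k φ).congr fun y hy => congrArg (· φ) (hk k y hy).symm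
  · refine (h5 k φ).congr' ?_
    filter_upwards [self_mem_nhdsWithin] with y hy
    rw [hk k y hy]

theorem isHalfSpaceSolution_iff_sub {a : Fin (d + 1) → TDist d}
    {N F : ℝ → Fin (d + 1) → Fin (d + 1) → TDist d} {u : ℝ → Fin (d + 1) → TDist d}
    {p : ℝ → TDist d} (hN : ∀ k l, IsTame (Ioi 0) fun y => N y k l)
    (hF : ∀ k l, IsTame (Ioi 0) fun y => F y k l) :
    IsHalfSpaceSolution a N F u p ↔ IsHalfSpaceSolution a 0 (F - N) u p := by
  rw [IsHalfSpaceSolution, IsHalfSpaceSolution, IsSolutionOn, IsSolutionOn,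
    solvesOn_iff_sub (fun k l => (hN k l).weakLocInt isOpen_Ioi)
      (fun k l => (hF k l).weakLocInt isOpen_Ioi)]

/-! ### Existence -/

/-- The convolutions are distributions at each height, not only at almost every one. -/
theorem isDistribution_pconv {f : ℝ → TDist d} (hf : IsTame univ f) {c : ℝ → ℝ}
    (hc : IsFactor c) (x : ℝ) : IsDistribution (pconv c f x) := by
  intro r R hr
  obtain ⟨N, h, h0, hi, hb⟩ := hf.exists_kernel_bound hr R
  refine ⟨N, ∫ y, Real.exp (r * |x|) * (Real.exp (-r * |y|) * h y), fun φ hφ => ?_⟩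
  rw [hf.pconv_apply hc, ← integral_mul_const]
  refine norm_integral_le_of_norm_le (((hi r hr).const_mul _).mul_const _) ?_
  filter_upwards [hb] with y hy
  refine (norm_kernel_le hc (hy.2 (x - y) φ hφ)).trans ?_
  rw [← mul_assoc]
  exact mul_le_mul_of_nonneg_right (mul_le_mul_of_nonneg_right
    (exp_neg_mul_abs_sub_le hr.le x y) (h0 y)) (schwartzNorm_nonneg _ _)

theorem isDistribution_kconv {f : ℝ → TDist d} (hf : IsTame univ f) {c c₂ : ℝ → ℝ}
    (hc : IsFactor c) (hc₂ : IsFactor c₂) (x : ℝ) : IsDistribution (kconv c c₂ f x) :=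
  (isDistribution_pconv hf hc x).add ((isDistribution_pconv hf hc₂ x).mult _)

theorem isDistribution_wholeVelocity {G : ℝ → Fin (d + 1) → Fin (d + 1) → TDist d}
    (hG : ∀ k l, IsTame univ fun y => G y k l) (x : ℝ) (k : Fin (d + 1)) :
    IsDistribution (wholeVelocity G x k) := by
  have hn := hG (Fin.last d) (Fin.last d)
  refine Fin.lastCases ?_ (fun k => ?_) k
  · rw [wholeVelocity_last]
    exact ((((isDistribution_kconv (IsTame.rowSum hG _) isFactor_one isFactor_abs x).sub
      (isDistribution_kconv (IsTame.doubleSum hG) isFactor_zero isFactor_id x)).sub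
      (isDistribution_kconv hn isFactor_zero isFactor_id x)).sub
      (isDistribution_kconv (IsTame.colSum hG) isFactor_one isFactor_abs.neg x)).smul _
  · rw [wholeVelocity_castSucc]
    have h1 := (isDistribution_kconv (IsTame.rowSum hG k.castSucc) isFactor_one isFactor_zero
      x).sub (isDistribution_kconv (hG k.castSucc (Fin.last d)) isFactor_sign isFactor_zero x)
    have h2 := (((isDistribution_kconv (IsTame.doubleSum hG) isFactor_one isFactor_abs x).sub
      (isDistribution_kconv (IsTame.rowSum hG (Fin.last d)) isFactor_zero isFactor_id x)).sub
      (isDistribution_kconv (IsTame.colSum hG) isFactor_zero isFactor_id x)).sub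
      (isDistribution_kconv hn isFactor_one isFactor_abs.neg x)
    exact (h1.smul (1 / 2)).add ((h2.mult (rieszSymb k)).smul (1 / 4))

section

variable {a : Fin (d + 1) → TDist d} {F : ℝ → Fin (d + 1) → Fin (d + 1) → TDist d}

theorem isWholeSpaceSolution_uWhole (hF : ∀ k l, IsTame (Ioi 0) fun y => F y k l) :
    IsWholeSpaceSolution (extendForce F) (uWhole F) (wholePressure (extendForce F)) := by
  have hG := isTame_extendForce hF
  rw [uWhole_eq hF]
  exact ⟨isTame_wholeVelocity hG, fun k φ => (continuous_wholeVelocity hG k φ).continuousOn,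
    (isTame_wholePressure hG).isLocInt isOpen_univ.isLocallyClosed, solvesOn_wholeVelocity hG⟩

/-- The solution formula is the whole-space velocity with its boundary values corrected. -/
theorem boundaryOp_add_forceOp (x : ℝ) : boundaryOp a x + forceOp F x
    = uWhole F x - boundaryOp (uWhole F 0 - a) x := by
  rw [forceOp, boundaryOp_sub]
  abel

theorem isHalfSpaceSolution_formula (ha : ∀ k, IsDistribution (a k))
    (hF : ∀ k l, IsTame (Ioi 0) fun y => F y k l) :
    IsHalfSpaceSolution a 0 F (fun x => boundaryOp a x + forceOp F x)
      (wholePressure (extendForce F) - boundaryPressure (uWhole F 0 - a)) := by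
  have hG := isTame_extendForce hF
  obtain ⟨w1, w2, -, w4⟩ := isWholeSpaceSolution_uWhole hF
  have hw0 : ∀ k, IsDistribution (uWhole F 0 k) := by
    rw [uWhole_eq hF]
    exact isDistribution_wholeVelocity hG 0
  have hb : ∀ k, IsDistribution ((uWhole F 0 - a) k) := fun k => (hw0 k).sub (ha k)
  have hwc : ∀ k φ, Continuous fun y => uWhole F y k φ := fun k φ =>
    continuousOn_univ.1 (w2 k φ)
  have hI := isOpen_Ioi (a := (0 : ℝ))
  have hw1 : ∀ k, IsTame (Ioi 0) fun y => uWhole F y k := fun k => (w1 k).mono (subset_univ _)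
  have hp := (isTame_wholePressure hG).mono (subset_univ (Ioi 0))
  have hFe : ∀ y ∈ Ioi (0 : ℝ), extendForce F y = F y := fun y hy => by
    ext k l : 2
    simp [extendForce, (mem_Ioi.1 hy).le]
  simp only [boundaryOp_add_forceOp]
  refine ⟨⟨fun k => (hw1 k).sub (isTame_boundaryOp hb k), fun k φ =>
    ((hwc k φ).sub (continuous_boundaryOp hb k φ)).continuousOn,
    (hp.sub (isTame_boundaryPressure hb)).isLocInt hI.isLocallyClosed, ?_⟩, fun k φ => ?_⟩
  · have h := SolvesOn.sub (w4.mono (subset_univ (Ioi 0))) (solvesOn_boundaryOp hb)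
      (fun k l => ((hG k l).mono (subset_univ _)).weakLocInt hI)
      (fun k l φ => locallyIntegrableOn_zero) (fun k => (hw1 k).weakLocInt hI)
      (fun k => (isTame_boundaryOp hb k).weakLocInt hI) (hp.weakLocInt hI)
      ((isTame_boundaryPressure hb).weakLocInt hI)
    rw [sub_zero] at h
    exact h.congr hFe (fun _ _ => rfl) fun _ _ => rfl
  · have h : Continuous fun y => (uWhole F y - boundaryOp (uWhole F 0 - a) y) k φ :=
      (hwc k φ).sub (continuous_boundaryOp hb k φ)
    have h0 := h.tendsto 0
    rw [boundaryOp_zero, sub_sub_cancel] at h0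
    exact h0.mono_left nhdsWithin_le_nhds

end

/-! ### First-order evolution equations of curves of functionals -/

/-- The curve `V` has the derivative `V₁` at `x` in the weak sense. -/
def WDerivAt (V : ℝ → TDist d) (V₁ : TDist d) (x : ℝ) : Prop :=
  ∀ φ, HasDerivAt (fun y => V y φ) (V₁ φ) x

theorem WDerivAt.add {V V' : ℝ → TDist d} {V₁ V₁' : TDist d} {x : ℝ} (h : WDerivAt V V₁ x)
    (h' : WDerivAt V' V₁' x) : WDerivAt (fun y => V y + V' y) (V₁ + V₁') x :=
  fun φ => (h φ).add (h' φ)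

theorem WDerivAt.smul {V : ℝ → TDist d} {V₁ : TDist d} {x : ℝ} (h : WDerivAt V V₁ x) (c : ℂ) :
    WDerivAt (fun y => c • V y) (c • V₁) x :=
  fun φ => (h φ).const_mul c

theorem WDerivAt.mult {V : ℝ → TDist d} {V₁ : TDist d} {x : ℝ} (h : WDerivAt V V₁ x)
    (m : Symb d) : WDerivAt (fun y => mult m (V y)) (mult m V₁) x :=
  fun φ => h (multTest m.reflect φ)

/-- On each annulus `r ≤ |ξ| ≤ R` the curve `V` is of finite order and grows at most like
`e^{r|x|}`, which is slower than the decay `e^{-2πr t}` of `e^{-t|∇'|}` there. -/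
def SlowGrowth (I : Set ℝ) (V : ℝ → TDist d) : Prop :=
  ∀ r R : ℝ, 0 < r → ∃ (N : ℕ) (C : ℝ), 0 ≤ C ∧ ∀ x ∈ I,
    BoundedOn r R N (C * Real.exp (r * |x|)) (V x)

theorem SlowGrowth.add {I : Set ℝ} {V V' : ℝ → TDist d} (h : SlowGrowth I V)
    (h' : SlowGrowth I V') : SlowGrowth I (fun x => V x + V' x) := fun r R hr => by
  obtain ⟨N, C, hC, hb⟩ := h r R hr
  obtain ⟨N', C', hC', hb'⟩ := h' r R hr
  refine ⟨max N N', C + C', by positivity, fun x hx => ?_⟩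
  rw [add_mul]
  exact (hb x hx).add (hb' x hx) (by positivity) (by positivity)

theorem SlowGrowth.smul {I : Set ℝ} {V : ℝ → TDist d} (h : SlowGrowth I V) (c : ℂ) :
    SlowGrowth I (fun x => c • V x) := fun r R hr => by
  obtain ⟨N, C, hC, hb⟩ := h r R hr
  refine ⟨N, ‖c‖ * C, by positivity, fun x hx => ?_⟩
  rw [mul_assoc]
  exact (hb x hx).smul c

theorem SlowGrowth.sub {I : Set ℝ} {V V' : ℝ → TDist d} (h : SlowGrowth I V)
    (h' : SlowGrowth I V') : SlowGrowth I (fun x => V x - V' x) := by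
  simpa only [sub_eq_add_neg, neg_one_smul] using h.add (h'.smul (-1))

theorem SlowGrowth.mult {I : Set ℝ} {V : ℝ → TDist d} (h : SlowGrowth I V) (m : Symb d) :
    SlowGrowth I (fun x => mult m (V x)) := fun r R hr => by
  obtain ⟨N, C, hC, hb⟩ := h r R hr
  obtain ⟨N', C', hC', hm⟩ := exists_boundedOn_mult m hr R N
  refine ⟨N', C' * C, by positivity, fun x hx => ?_⟩
  rw [mul_assoc]
  exact hm _ _ (by positivity) (hb x hx)

theorem SlowGrowth.sum {I : Set ℝ} {ι : Type*} (s : Finset ι) {V : ι → ℝ → TDist d}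
    (h : ∀ i ∈ s, SlowGrowth I (V i)) : SlowGrowth I (fun x => ∑ i ∈ s, V i x) := by
  classical
  induction s using Finset.induction_on with
  | empty => exact fun r R hr => ⟨0, 0, le_rfl, fun x _ φ _ => by simp⟩
  | insert i s hi ih =>
    simp only [Finset.sum_insert hi]
    exact (h i (by simp)).add (ih fun j hj => h j (by simp [hj]))

theorem SlowGrowth.congr {I : Set ℝ} {V V' : ℝ → TDist d} (h : SlowGrowth I V)
    (e : ∀ x ∈ I, V' x = V x) : SlowGrowth I V' := fun r R hr => by
  obtain ⟨N, C, hC, hb⟩ := h r R hr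
  refine ⟨N, C, hC, fun x hx => ?_⟩
  rw [e x hx]
  exact hb x hx

theorem SlowGrowth.eventually_boundedOn {I : Set ℝ} (hI : IsOpen I) {V : ℝ → TDist d}
    (h : SlowGrowth I V) {r : ℝ} (hr : 0 < r) (R : ℝ) {x : ℝ} (hx : x ∈ I) :
    ∃ N B, ∀ᶠ y in 𝓝 x, BoundedOn r R N B (V y) := by
  obtain ⟨N, C, hC, hb⟩ := h r R hr
  refine ⟨N, C * Real.exp (r * (|x| + 1)), ?_⟩
  filter_upwards [hI.mem_nhds hx, Metric.ball_mem_nhds x one_pos] with y hy hy'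
  refine (hb y hy).mono le_rfl (by positivity) ?_
  have : |y| ≤ |x| + 1 := by
    have := abs_sub_abs_le_abs_sub y x
    rw [Metric.mem_ball, Real.dist_eq] at hy'
    linarith
  gcongr

theorem eq_add_of_hasDerivAt_const {h : ℝ → ℂ} {κ : ℂ} {t : ℝ} (ht : 0 ≤ t)
    (hd : ∀ s ∈ Icc 0 t, HasDerivAt h κ s) : h t = h 0 + t * κ := by
  have h1 : ∀ s ∈ Icc 0 t, HasDerivAt (fun s => h s - (s : ℂ) * κ) 0 s := fun s hs => by
    have := (hd s hs).sub (((hasDerivAt_id s).ofReal_comp).mul_const κ)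
    refine this.congr_deriv ?_
    simp
  have h2 := constant_of_has_deriv_right_zero (f := fun s => h s - (s : ℂ) * κ)
    (fun s hs => (h1 s hs).continuousAt.continuousWithinAt)
    (fun s hs => (h1 s (Ico_subset_Icc_self hs)).hasDerivWithinAt) t ⟨ht, le_rfl⟩
  simp only [Complex.ofReal_zero, zero_mul, sub_zero] at h2
  linear_combination h2

/-- A slowly growing solution of `V' = |∇'|V` on a half line `(c, ∞)` or on `ℝ` vanishes, since
`V(x) = e^{-s|∇'|} V(x + s)` for all `s ≥ 0`. -/
theorem eq_zero_of_wDerivAt_absGrad {I : Set ℝ} (hI : IsOpen I)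
    (hup : ∀ x ∈ I, ∀ y, x ≤ y → y ∈ I) {V : ℝ → TDist d}
    (hV : ∀ x ∈ I, WDerivAt V (absGrad (V x)) x) (hg : SlowGrowth I V) {x : ℝ} (hx : x ∈ I) :
    V x = 0 := by
  ext φ
  obtain ⟨r, R, hr, hφ⟩ := φ.2
  have hmem : ∀ s : ℝ, 0 ≤ s → x + s ∈ I := fun s hs => hup x hx _ (by linarith)
  -- `t ↦ ⟨V(x + t), e^{-t|∇'|}φ⟩` has derivative zero and tends to zero
  have hconst : ∀ t, 0 ≤ t → V (x + t) (expTest t φ) = V x φ := fun t ht => by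
    have := eq_add_of_hasDerivAt_const (h := fun s => V (x + s) (expTest s φ)) (κ := 0) ht
      fun s hs => by
        obtain ⟨N, B, hB⟩ := hg.eventually_boundedOn hI hr R (hmem s hs.1)
        have hB' : ∀ᶠ y in 𝓝 s, BoundedOn r R N B (V (x + y)) :=
          ((continuous_const.add continuous_id).tendsto s).eventually hB
        refine (hasDerivAt_apply_expTest (V := fun s => V (x + s)) hr hφ
          (fun ψ => (hV _ (hmem s hs.1) ψ).comp_const_add x s) (hasDerivAt_id s)
          hB').congr_deriv ?_
        simp [absGrad_apply]
    simpa [expTest_zero] using this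
  obtain ⟨N, C, hC, hb⟩ := hg r R hr
  obtain ⟨N', C', hC', hE⟩ := schwartzNorm_expTest_le (d := d) hr R N
  have hle : ∀ t, 0 ≤ t → ‖V x φ‖
      ≤ C * Real.exp (r * |x|) * C' * schwartzNorm N' φ * Real.exp (-(r * t)) := fun t ht => by
    rw [← hconst t ht]
    have hxt : |x + t| ≤ |x| + t := by simpa [abs_of_nonneg ht] using abs_add_le x t
    have h0 := schwartzNorm_nonneg N' φ
    calc _ ≤ C * Real.exp (r * |x + t|) * schwartzNorm N (expTest t φ) :=
          hb _ (hmem t ht) _ (hφ.expTest t)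
      _ ≤ C * Real.exp (r * (|x| + t)) * (C' * Real.exp (-(2 * r * t)) * schwartzNorm N' φ) := by
          gcongr
          · exact schwartzNorm_nonneg _ _
          · exact hE t ht φ hφ
      _ = C * C' * schwartzNorm N' φ * (Real.exp (r * (|x| + t)) * Real.exp (-(2 * r * t))) := by
          ring
      _ = C * C' * schwartzNorm N' φ * (Real.exp (r * |x|) * Real.exp (-(r * t))) := by
          rw [← Real.exp_add, ← Real.exp_add]
          ring_nf
      _ = _ := by ring
  have hlim : Tendsto (fun t : ℝ => C * Real.exp (r * |x|) * C' * schwartzNorm N' φ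
      * Real.exp (-(r * t))) atTop (𝓝 0) := by
    have := Real.tendsto_exp_neg_atTop_nhds_zero.comp (tendsto_id.const_mul_atTop hr)
    simpa using this.const_mul (C * Real.exp (r * |x|) * C' * schwartzNorm N' φ)
  have h0 : ‖V x φ‖ ≤ 0 := ge_of_tendsto hlim
    ((eventually_ge_atTop 0).mono fun t ht => hle t ht)
  simpa using norm_le_zero_iff.1 h0

/-- Duhamel's formula for `V' = -|∇'|V + B` in the resonant case `B(x + s) = e^{-s|∇'|} B(x)`. -/
theorem eq_polyCurve_of_wDerivAt {I : Set ℝ} (hI : IsOpen I)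
    (hup : ∀ x ∈ I, ∀ y, x ≤ y → y ∈ I) {V B : ℝ → TDist d}
    (hV : ∀ x ∈ I, WDerivAt V (-absGrad (V x) + B x) x) (hg : SlowGrowth I V) {x : ℝ}
    (hx : x ∈ I) (hB : ∀ s, 0 ≤ s → B (x + s) = poisson s (B x)) {t : ℝ} (ht : 0 ≤ t) :
    V (x + t) = polyCurve (V x) (B x) t := by
  ext φ
  obtain ⟨r, R, hr, hφ⟩ := φ.2
  have hmem : ∀ s : ℝ, 0 ≤ s → x + s ∈ I := fun s hs => hup x hx _ (by linarith)
  have := eq_add_of_hasDerivAt_const (h := fun s => V (x + s) (expTest (t - s) φ))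
    (κ := B x (expTest t φ)) ht fun s hs => by
      obtain ⟨N, K, hK⟩ := hg.eventually_boundedOn hI hr R (hmem s hs.1)
      have hK' : ∀ᶠ y in 𝓝 s, BoundedOn r R N K (V (x + y)) :=
        ((continuous_const.add continuous_id).tendsto s).eventually hK
      refine (hasDerivAt_apply_expTest (V := fun s => V (x + s)) hr hφ
        (fun ψ => (hV _ (hmem s hs.1) ψ).comp_const_add x s)
        ((hasDerivAt_id s).const_sub t) hK').congr_deriv ?_
      rw [hB s hs.1]
      simp only [LinearMap.add_apply, LinearMap.neg_apply, absGrad_apply, poisson_apply, id]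
      rw [← expTest_add, add_sub_cancel]
      push_cast
      ring
  simp only [sub_self, expTest_zero, add_zero, sub_zero] at this
  rw [this, polyCurve_apply]

/-! ### Smooth solutions of the homogeneous system -/

/-- Solutions of the homogeneous Stokes system that are smooth and slowly growing in the normal
variable: `W i` and `P i` are the `i`-th normal derivatives of the velocity and of the pressure, and
each of them satisfies the equations at the heights in `I`. -/
structure IsSmoothFlow (I : Set ℝ) (W : ℕ → ℝ → Fin (d + 1) → TDist d) (P : ℕ → ℝ → TDist d) :
    Prop where
  derivW : ∀ i k x, WDerivAt (fun y => W i y k) (W (i + 1) x k) x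
  derivP : ∀ i x, WDerivAt (P i) (P (i + 1) x) x
  growth : ∀ i k, SlowGrowth I fun x => W i x k
  eqk : ∀ i, ∀ x ∈ I, ∀ k : Fin d, W (i + 2) x k.castSucc
    = absGrad (absGrad (W i x k.castSucc)) + pderiv k (P i x)
  eqn : ∀ i, ∀ x ∈ I, W (i + 2) x (Fin.last d)
    = absGrad (absGrad (W i x (Fin.last d))) + P (i + 1) x
  div : ∀ i, ∀ x ∈ I, tdiv (W i x) + W (i + 1) x (Fin.last d) = 0

namespace IsSmoothFlow

variable {I : Set ℝ} {W : ℕ → ℝ → Fin (d + 1) → TDist d} {P : ℕ → ℝ → TDist d}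

/-- The tangential momentum equations determine `|∇'|P` through `∑ R_k ∂_k = -|∇'|`. -/
theorem absGrad_pressure (h : IsSmoothFlow I W P) {x : ℝ} (hx : x ∈ I) :
    absGrad (P 0 x) = -∑ k : Fin d,
      riesz k (W 2 x k.castSucc - absGrad (absGrad (W 0 x k.castSucc))) := by
  have : ∀ k : Fin d, riesz k (W 2 x k.castSucc - absGrad (absGrad (W 0 x k.castSucc)))
      = riesz k (riesz k (absGrad (P 0 x))) := fun k => by
    rw [h.eqk 0 x hx k, add_sub_cancel_left, pderiv_eq]
  simp only [this, sum_riesz_riesz, neg_neg]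

theorem growth_absGrad_pressure (h : IsSmoothFlow I W P) :
    SlowGrowth I fun x => absGrad (P 0 x) := by
  have h1 : SlowGrowth I fun x => (-1 : ℂ) • ∑ k : Fin d,
      riesz k (W 2 x k.castSucc - absGrad (absGrad (W 0 x k.castSucc))) :=
    (SlowGrowth.sum _ fun k _ => ((h.growth 2 _).sub
      (((h.growth 0 _).mult _).mult _)).mult _).smul (-1)
  exact h1.congr fun x hx => by rw [h.absGrad_pressure hx, neg_one_smul]

theorem growth_pressure (h : IsSmoothFlow I W P) : SlowGrowth I (P 0) := by
  have h1 : SlowGrowth I fun x => invAbs (absGrad (P 0 x)) := h.growth_absGrad_pressure.mult _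
  have h2 : ∀ T : TDist d, invAbs (absGrad T) = T := fun T =>
    (mult_comm _ _ _).trans (absGrad_invAbs T)
  simpa only [h2] using h1

theorem growth_pressure_deriv (h : IsSmoothFlow I W P) : SlowGrowth I (P 1) := by
  have h1 : SlowGrowth I fun x => W 2 x (Fin.last d) - absGrad (absGrad (W 0 x (Fin.last d))) :=
    (h.growth 2 _).sub (((h.growth 0 _).mult _).mult _)
  exact h1.congr fun x hx => eq_sub_of_add_eq' (h.eqn 0 x hx).symm

/-- The pressure is harmonic. -/
theorem pressure_deriv_deriv (h : IsSmoothFlow I W P) {x : ℝ} (hx : x ∈ I) :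
    P 2 x = absGrad (absGrad (P 0 x)) := by
  have h1 := h.eqn 1 x hx
  have h2 := h.div 2 x hx
  have h3 := h.div 0 x hx
  have h4 : tdiv (W 2 x) = absGrad (absGrad (tdiv (W 0 x)))
      + ∑ k : Fin d, pderiv k (pderiv k (P 0 x)) := by
    rw [tdiv, Finset.sum_congr rfl fun k _ => congrArg (pderiv k) (h.eqk 0 x hx k)]
    simp only [tdiv, map_add, Finset.sum_add_distrib, map_sum, pderiv_eq, absGrad_riesz]
  rw [sum_pderiv_pderiv] at h4
  have h5 : P 2 x = W 3 x (Fin.last d) - absGrad (absGrad (W 1 x (Fin.last d))) := by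
    rw [h1]
    abel
  rw [h5, eq_neg_of_add_eq_zero_right h2, eq_neg_of_add_eq_zero_right h3, h4]
  simp only [map_neg]
  abel

/-- `Y = P' + |∇'|P` satisfies `Y' = |∇'|Y`, hence vanishes. -/
theorem pressure_deriv (h : IsSmoothFlow I W P) (hI : IsOpen I)
    (hup : ∀ x ∈ I, ∀ y, x ≤ y → y ∈ I) {x : ℝ} (hx : x ∈ I) : P 1 x = -absGrad (P 0 x) := by
  have := eq_zero_of_wDerivAt_absGrad (V := fun x => P 1 x + absGrad (P 0 x)) hI hup
    (fun x hx => ?_) (h.growth_pressure_deriv.add h.growth_absGrad_pressure) hx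
  · exact eq_neg_of_add_eq_zero_left this
  · have h1 : WDerivAt (fun x => P 1 x + absGrad (P 0 x)) (P 2 x + absGrad (P 1 x)) x :=
      (h.derivP 1 x).add ((h.derivP 0 x).mult _)
    rwa [h.pressure_deriv_deriv hx, ← map_add, add_comm (absGrad (P 0 x))] at h1

/-- `X = W_k' + |∇'|W_k + ½ R_k P` satisfies `X' = |∇'|X`, hence vanishes. -/
theorem velocity_deriv_castSucc (h : IsSmoothFlow I W P) (hI : IsOpen I)
    (hup : ∀ x ∈ I, ∀ y, x ≤ y → y ∈ I) {x : ℝ} (hx : x ∈ I) (k : Fin d) :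
    W 1 x k.castSucc = -absGrad (W 0 x k.castSucc) + (-(1 / 2) : ℂ) • riesz k (P 0 x) := by
  have := eq_zero_of_wDerivAt_absGrad (V := fun x => W 1 x k.castSucc
      + absGrad (W 0 x k.castSucc) + (1 / 2 : ℂ) • riesz k (P 0 x)) hI hup
    (fun x hx => ?_) (((h.growth 1 _).add ((h.growth 0 _).mult _)).add
      ((h.growth_pressure.mult _).smul _)) hx
  · rw [neg_smul]
    linear_combination (norm := module) this
  · have h1 : WDerivAt (fun x => W 1 x k.castSucc
        + absGrad (W 0 x k.castSucc) + (1 / 2 : ℂ) • riesz k (P 0 x))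
        (W 2 x k.castSucc + absGrad (W 1 x k.castSucc) + (1 / 2 : ℂ) • riesz k (P 1 x)) x :=
      ((h.derivW 1 _ x).add ((h.derivW 0 _ x).mult _)).add (((h.derivP 0 x).mult _).smul _)
    convert h1 using 1
    rw [h.eqk 0 x hx k, h.pressure_deriv hI hup hx, pderiv_eq]
    simp only [map_add, map_smul, map_neg, absGrad_riesz]
    module

/-- `X = W_n' + |∇'|W_n - ½ P` satisfies `X' = |∇'|X`, hence vanishes. -/
theorem velocity_deriv_last (h : IsSmoothFlow I W P) (hI : IsOpen I)
    (hup : ∀ x ∈ I, ∀ y, x ≤ y → y ∈ I) {x : ℝ} (hx : x ∈ I) :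
    W 1 x (Fin.last d) = -absGrad (W 0 x (Fin.last d)) + (1 / 2 : ℂ) • P 0 x := by
  have := eq_zero_of_wDerivAt_absGrad (V := fun x => W 1 x (Fin.last d)
      + absGrad (W 0 x (Fin.last d)) + (-(1 / 2) : ℂ) • P 0 x) hI hup
    (fun x hx => ?_) (((h.growth 1 _).add ((h.growth 0 _).mult _)).add
      (h.growth_pressure.smul _)) hx
  · linear_combination (norm := module) this
  · have h1 : WDerivAt (fun x => W 1 x (Fin.last d)
        + absGrad (W 0 x (Fin.last d)) + (-(1 / 2) : ℂ) • P 0 x)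
        (W 2 x (Fin.last d) + absGrad (W 1 x (Fin.last d)) + (-(1 / 2) : ℂ) • P 1 x) x :=
      ((h.derivW 1 _ x).add ((h.derivW 0 _ x).mult _)).add ((h.derivP 0 x).smul _)
    convert h1 using 1
    rw [h.eqn 0 x hx, h.pressure_deriv hI hup hx]
    simp only [map_add, map_smul]
    module

theorem pressure_add (h : IsSmoothFlow I W P) (hI : IsOpen I)
    (hup : ∀ x ∈ I, ∀ y, x ≤ y → y ∈ I) {x : ℝ} (hx : x ∈ I) {t : ℝ} (ht : 0 ≤ t) :
    P 0 (x + t) = poisson t (P 0 x) := by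
  have := eq_polyCurve_of_wDerivAt (V := P 0) (B := fun _ => 0) hI hup (fun x hx => ?_)
    h.growth_pressure hx (fun _ _ => by simp) ht
  · simpa [polyCurve] using this
  · rw [add_zero, ← h.pressure_deriv hI hup hx]
    exact h.derivP 0 x

/-- The divergence equation expresses the pressure through the values of the velocity. -/
theorem boundarySlope_velocity (h : IsSmoothFlow I W P) (hI : IsOpen I)
    (hup : ∀ x ∈ I, ∀ y, x ≤ y → y ∈ I) {x : ℝ} (hx : x ∈ I) :
    boundarySlope (W 0 x) (Fin.last d) = (1 / 2 : ℂ) • P 0 x := by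
  rw [boundarySlope_last, eq_neg_of_add_eq_zero_left (h.div 0 x hx),
    h.velocity_deriv_last hI hup hx]
  abel

/-- A smooth flow is the boundary flow of each of its values. -/
theorem velocity_add (h : IsSmoothFlow I W P) (hI : IsOpen I)
    (hup : ∀ x ∈ I, ∀ y, x ≤ y → y ∈ I) {x : ℝ} (hx : x ∈ I) {t : ℝ} (ht : 0 ≤ t) :
    W 0 (x + t) = boundaryOp (W 0 x) t := by
  have hs := h.boundarySlope_velocity hI hup hx
  ext k : 1
  rw [boundaryOp_eq]
  refine Fin.lastCases ?_ (fun k => ?_) k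
  · rw [hs]
    refine eq_polyCurve_of_wDerivAt (V := fun x => W 0 x (Fin.last d))
      (B := fun x => (1 / 2 : ℂ) • P 0 x) hI hup (fun x hx => ?_) (h.growth 0 _) hx
      (fun s hs => ?_) ht
    · rw [← h.velocity_deriv_last hI hup hx]
      exact h.derivW 0 _ x
    · simp only [h.pressure_add hI hup hx hs, map_smul]
  · have hk : boundarySlope (W 0 x) k.castSucc = (-(1 / 2) : ℂ) • riesz k (P 0 x) := by
      rw [boundarySlope_castSucc, hs, map_smul, neg_smul]
    rw [hk]
    refine eq_polyCurve_of_wDerivAt (V := fun x => W 0 x k.castSucc)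
      (B := fun x => (-(1 / 2) : ℂ) • riesz k (P 0 x)) hI hup (fun x hx => ?_) (h.growth 0 _) hx
      (fun s hs => ?_) ht
    · rw [← h.velocity_deriv_castSucc hI hup hx]
      exact h.derivW 0 _ x
    · simp only [h.pressure_add hI hup hx hs, map_smul, riesz_poisson]

theorem slowGrowth_comp_neg {V : ℝ → TDist d} (h : SlowGrowth univ V) :
    SlowGrowth univ fun x => V (-x) := fun r R hr => by
  obtain ⟨N, C, hC, hb⟩ := h r R hr
  refine ⟨N, C, hC, fun x _ => ?_⟩
  have := hb (-x) (mem_univ _)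
  rwa [abs_neg] at this

/-- Slowly growing solutions of `V' = -|∇'|V` on the whole line vanish. -/
theorem eq_zero_of_wDerivAt_neg_absGrad {V : ℝ → TDist d}
    (hV : ∀ x, WDerivAt V (-absGrad (V x)) x) (hg : SlowGrowth univ V) (x : ℝ) : V x = 0 := by
  -- reflection turns the equation into `V' = |∇'|V`
  have := eq_zero_of_wDerivAt_absGrad (V := fun x => V (-x)) isOpen_univ
    (fun _ _ _ _ => mem_univ _) (fun x _ φ => ?_) (slowGrowth_comp_neg hg) (mem_univ (-x))
  · simpa using this
  · have h1 := (hV (-x) φ).scomp x (hasDerivAt_neg x)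
    simpa [Function.comp_def] using h1

/-- Smooth flows on the whole space vanish. -/
theorem velocity_eq_zero (h : IsSmoothFlow univ W P) (x : ℝ) : W 0 x = 0 := by
  have hup : ∀ x ∈ (univ : Set ℝ), ∀ y, x ≤ y → y ∈ (univ : Set ℝ) := fun _ _ _ _ => mem_univ _
  have hP : ∀ x, P 0 x = 0 := eq_zero_of_wDerivAt_neg_absGrad (fun x => by
    rw [← h.pressure_deriv isOpen_univ hup (mem_univ x)]
    exact h.derivP 0 x) h.growth_pressure
  ext k : 1
  refine eq_zero_of_wDerivAt_neg_absGrad (V := fun x => W 0 x k) (fun x => ?_) (h.growth 0 k) x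
  have h1 := h.derivW 0 k x
  revert h1
  refine Fin.lastCases (fun h1 => ?_) (fun k h1 => ?_) k
  · rwa [zero_add, h.velocity_deriv_last isOpen_univ hup (mem_univ x), hP, smul_zero,
      add_zero] at h1
  · rwa [zero_add, h.velocity_deriv_castSucc isOpen_univ hup (mem_univ x), hP, map_zero,
      smul_zero, add_zero] at h1

end IsSmoothFlow

/-! ### Mollification in the normal variable -/

/-- The mollified curve `x ↦ ∫ η(x - y) f(y) dy`. -/
def moll (η : ℝ → ℝ) (f : ℝ → TDist d) (x : ℝ) : TDist d :=
  weakIntegral volume fun y => (η (x - y) : ℂ) • f y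

/-- Smooth functions on the line with compact support. -/
structure IsCutoff (η : ℝ → ℝ) : Prop where
  contDiff : ContDiff ℝ ∞ η
  hasCompactSupport : HasCompactSupport η

theorem IsCutoff.deriv {η : ℝ → ℝ} (h : IsCutoff η) : IsCutoff (deriv η) :=
  ⟨(contDiff_infty_iff_deriv.1 h.contDiff).2, h.hasCompactSupport.deriv⟩

theorem IsCutoff.comp_const_sub {η : ℝ → ℝ} (h : IsCutoff η) (x : ℝ) :
    IsCutoff fun y => η (x - y) :=
  ⟨h.contDiff.comp (contDiff_const.sub contDiff_id),
    h.hasCompactSupport.comp_homeomorph (Homeomorph.subLeft x)⟩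

theorem IsCutoff.iteratedDeriv {η : ℝ → ℝ} (h : IsCutoff η) (i : ℕ) :
    IsCutoff (iteratedDeriv i η) := by
  induction i with
  | zero => rwa [iteratedDeriv_zero]
  | succ i ih =>
    rw [iteratedDeriv_succ]
    exact ih.deriv

theorem tsupport_iteratedDeriv_subset_tsupport (η : ℝ → ℝ) (i : ℕ) :
    tsupport (iteratedDeriv i η) ⊆ tsupport η := by
  induction i with
  | zero => rw [iteratedDeriv_zero]
  | succ i ih =>
    rw [iteratedDeriv_succ]
    exact tsupport_deriv_subset.trans ih

section

variable {f : ℝ → TDist d} {η : ℝ → ℝ}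

theorem moll_apply (hf : WeakLocInt univ f) (hη : IsCutoff η) (x : ℝ) (φ : TestSpace d) :
    moll η f x φ = ∫ y, (η (x - y) : ℂ) * f y φ := by
  have h := hη.comp_const_sub x
  rw [moll, weakIntegral_apply]
  · rfl
  · exact fun φ => integrable_cutoff_mul (hf φ) h.contDiff.continuous h.hasCompactSupport
      (subset_univ _)

theorem moll_apply_eq_convolution (hf : WeakLocInt univ f) (hη : IsCutoff η) (x : ℝ)
    (φ : TestSpace d) : moll η f x φ
      = MeasureTheory.convolution η (fun y => f y φ) (ContinuousLinearMap.lsmul ℝ ℝ) volume x := by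
  rw [moll_apply hf hη, convolution_lsmul_swap]
  simp only [Complex.real_smul]

theorem wDerivAt_moll (hf : WeakLocInt univ f) (hη : IsCutoff η) (x : ℝ) :
    WDerivAt (moll η f) (moll (deriv η) f x) x := fun φ => by
  rw [moll_apply_eq_convolution hf hη.deriv,
    funext fun x => moll_apply_eq_convolution hf hη x φ]
  exact hη.hasCompactSupport.hasDerivAt_convolution_left (ContinuousLinearMap.lsmul ℝ ℝ)
    (hη.contDiff.of_le (by simp)) (locallyIntegrableOn_univ.1 (hf φ)) x

/-- The compact support of `η` gives `|η(x - y)| ≤ M e^{r|x|} e^{-r|y|}`, and tameness makes the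
integral over `y` finite. -/
theorem slowGrowth_moll (hf : IsTame univ f) (hη : IsCutoff η) : SlowGrowth univ (moll η f) := by
  intro r R hr
  obtain ⟨N, g, hg0, hg, hb⟩ := hf.exists_bound hr R
  rw [Measure.restrict_univ] at hb
  have hηc := hη.contDiff.continuous
  obtain ⟨M, hM⟩ := (hη.hasCompactSupport.mul_right (f' := fun z => Real.exp (r * |z|)))
    |>.exists_bound_of_continuous (by fun_prop)
  have hM0 : 0 ≤ M := (norm_nonneg _).trans (hM 0)
  have hηle : ∀ z, |η z| ≤ M * Real.exp (-r * |z|) := fun z => by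
    have h1 := hM z
    simp only [Pi.mul_apply, norm_mul, Real.norm_eq_abs, Real.abs_exp] at h1
    rwa [neg_mul, Real.exp_neg, ← div_eq_mul_inv, le_div_iff₀ (Real.exp_pos _)]
  have hi := integrableOn_univ.1 (hg r hr)
  refine ⟨N, M * ∫ y, Real.exp (-r * |y|) * g y, mul_nonneg hM0
    (integral_nonneg fun y => mul_nonneg (Real.exp_pos _).le (hg0 y)), fun x _ φ hφ => ?_⟩
  rw [moll_apply (hf.weakLocInt isOpen_univ) hη]
  have e : M * (∫ y, Real.exp (-r * |y|) * g y) * Real.exp (r * |x|) * schwartzNorm N φ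
      = ∫ y, M * Real.exp (r * |x|) * schwartzNorm N φ * (Real.exp (-r * |y|) * g y) := by
    rw [integral_const_mul]
    ring
  rw [e]
  refine norm_integral_le_of_norm_le (hi.const_mul _) ?_
  filter_upwards [hb] with y hy
  have h2 := schwartzNorm_nonneg N φ
  have h3 := hg0 y
  rw [norm_mul, Complex.norm_real, Real.norm_eq_abs]
  calc _ ≤ M * Real.exp (-r * |x - y|) * (g y * schwartzNorm N φ) := by
        gcongr
        · exact hηle _
        · exact hy φ hφ
    _ ≤ M * (Real.exp (r * |x|) * Real.exp (-r * |y|)) * (g y * schwartzNorm N φ) := by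
        gcongr
        exact exp_neg_mul_abs_sub_le hr.le x y
    _ = _ := by ring

theorem ofCurve_deriv_comp_const_sub (hf : WeakLocInt univ f) (hη : IsCutoff η) (x : ℝ)
    (φ : TestSpace d) :
    ofCurve f (deriv fun y => η (x - y)) φ = -moll (deriv η) f x φ := by
  rw [moll_apply hf hη.deriv, ← integral_neg]
  refine integral_congr_ae (Eventually.of_forall fun y => ?_)
  simp only [deriv_comp_const_sub]
  push_cast
  ring

theorem pd_castSucc_moll (hf : WeakLocInt univ f) (hη : IsCutoff η) (x : ℝ) (j : Fin d)
    (φ : TestSpace d) : pd j.castSucc (ofCurve f) (fun y => η (x - y)) φ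
      = pderiv j (moll η f x) φ := by
  rw [pd_castSucc]
  change _ = -moll η f x (derivTest j φ)
  rw [moll_apply hf hη]
  rfl

theorem pd_last_moll (hf : WeakLocInt univ f) (hη : IsCutoff η) (x : ℝ) (φ : TestSpace d) :
    pd (Fin.last d) (ofCurve f) (fun y => η (x - y)) φ = moll (deriv η) f x φ := by
  rw [pd_last, ofCurve_deriv_comp_const_sub hf hη, neg_neg]

theorem pd_pd_castSucc_moll (hf : WeakLocInt univ f) (hη : IsCutoff η) (x : ℝ) (j : Fin d)
    (φ : TestSpace d) :
    pd j.castSucc (pd j.castSucc (ofCurve f)) (fun y => η (x - y)) φ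
      = pderiv j (pderiv j (moll η f x)) φ := by
  rw [pd_castSucc j _ _ φ, pd_castSucc_moll hf hη]
  rfl

theorem pd_pd_last_moll (hf : WeakLocInt univ f) (hη : IsCutoff η) (x : ℝ) (φ : TestSpace d) :
    pd (Fin.last d) (pd (Fin.last d) (ofCurve f)) (fun y => η (x - y)) φ
      = moll (deriv (deriv η)) f x φ := by
  have h : (deriv fun y => η (x - y)) = fun y => -deriv η (x - y) :=
    funext fun y => deriv_comp_const_sub ..
  have h' : deriv (fun y => -deriv η (x - y)) = fun y => deriv (deriv η) (x - y) := by
    ext y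
    rw [deriv.fun_neg, deriv_comp_const_sub, neg_neg]
  rw [pd_last _ (fun y => η (x - y)), pd_last, neg_neg, h, h', moll_apply hf hη.deriv.deriv]
  rfl

end

/-- Mollification in the normal variable turns solutions of the homogeneous system into smooth
flows. -/
theorem isSmoothFlow_moll {I J : Set ℝ} {w : ℝ → Fin (d + 1) → TDist d} {p : ℝ → TDist d}
    (hw : ∀ k, IsTame univ fun y => w y k) (hp : WeakLocInt univ p) (h : SolvesOn J 0 0 w p)
    {η : ℝ → ℝ} (hη : IsCutoff η) (hIJ : ∀ x ∈ I, ∀ z ∈ tsupport η, x - z ∈ J) :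
    IsSmoothFlow I (fun i x k => moll (iteratedDeriv i η) (fun y => w y k) x)
      (fun i => moll (iteratedDeriv i η) p) := by
  have hwL : ∀ k, WeakLocInt univ fun y => w y k := fun k => (hw k).weakLocInt isOpen_univ
  have hηi := hη.iteratedDeriv
  have hsupp : ∀ i, ∀ x ∈ I, tsupport (fun y => iteratedDeriv i η (x - y)) ⊆ J := by
    intro i x hx y hy
    have h1 : x - y ∈ tsupport (iteratedDeriv i η) :=
      tsupport_comp_subset_preimage (iteratedDeriv i η) (f := fun y => x - y) (by fun_prop) hy
    have := hIJ x hx _ (tsupport_iteratedDeriv_subset_tsupport η i h1)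
    rwa [sub_sub_cancel] at this
  have hsolve := fun i x (hx : x ∈ I) => h (fun y => iteratedDeriv i η (x - y))
    ((hηi i).comp_const_sub x).contDiff ((hηi i).comp_const_sub x).hasCompactSupport
    (hsupp i x hx)
  have hd : ∀ i, deriv (iteratedDeriv i η) = iteratedDeriv (i + 1) η := fun i =>
    iteratedDeriv_succ.symm
  have hsq : ∀ (T : TDist d) (φ : TestSpace d),
      ∑ j : Fin d, pderiv j (pderiv j T) φ = -absGrad (absGrad T) φ := fun T φ => by
    rw [← LinearMap.neg_apply, ← sum_pderiv_pderiv, LinearMap.coe_sum, Finset.sum_apply]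
  refine ⟨fun i k x => ?_, fun i x => ?_, fun i k => ?_, fun i x hx k => ?_, fun i x hx => ?_,
    fun i x hx => ?_⟩
  · rw [← hd i]
    exact wDerivAt_moll (hwL k) (hηi i) x
  · rw [← hd i]
    exact wDerivAt_moll hp (hηi i) x
  · intro r R hr
    obtain ⟨N, C, hC, hb⟩ := slowGrowth_moll (hw k) (hηi i) r R hr
    exact ⟨N, C, hC, fun x _ => hb x (mem_univ x)⟩
  · ext φ
    have e := (hsolve i x hx φ).1 k.castSucc
    simp only [Pi.zero_apply, pd_ofCurve_zero, Finset.sum_const_zero, add_zero] at e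
    rw [Fin.sum_univ_castSucc, pd_pd_last_moll (hwL _) (hηi i), pd_castSucc_moll hp (hηi i)] at e
    simp only [pd_pd_castSucc_moll (hwL _) (hηi i), hd, hsq] at e
    rw [LinearMap.add_apply]
    linear_combination -e
  · ext φ
    have e := (hsolve i x hx φ).1 (Fin.last d)
    simp only [Pi.zero_apply, pd_ofCurve_zero, Finset.sum_const_zero, add_zero] at e
    rw [Fin.sum_univ_castSucc, pd_pd_last_moll (hwL _) (hηi i), pd_last_moll hp (hηi i)] at e
    simp only [pd_pd_castSucc_moll (hwL _) (hηi i), hd, hsq] at e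
    rw [LinearMap.add_apply]
    linear_combination -e
  · ext φ
    have e := (hsolve i x hx φ).2
    rw [Fin.sum_univ_castSucc, pd_last_moll (hwL _) (hηi i)] at e
    simp only [pd_castSucc_moll (hwL _) (hηi i), hd] at e
    rw [LinearMap.add_apply, tdiv, LinearMap.coe_sum, Finset.sum_apply]
    exact e

/-- A sequence of bump functions with supports in `[-δ, δ]`, shrinking to the origin. -/
def shrinkingBump {δ : ℝ} (hδ : 0 < δ) (j : ℕ) : ContDiffBump (0 : ℝ) where
  rIn := δ / (j + 1) / 2
  rOut := δ / (j + 1)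
  rIn_pos := by positivity
  rIn_lt_rOut := half_lt_self (by positivity)

theorem isCutoff_shrinkingBump {δ : ℝ} (hδ : 0 < δ) (j : ℕ) :
    IsCutoff ((shrinkingBump hδ j).normed volume) :=
  ⟨ContDiffBump.contDiff_normed _, ContDiffBump.hasCompactSupport_normed _⟩

theorem abs_le_of_mem_tsupport_shrinkingBump {δ : ℝ} (hδ : 0 < δ) {j : ℕ} {z : ℝ}
    (hz : z ∈ tsupport ((shrinkingBump hδ j).normed volume)) : |z| ≤ δ := by
  rw [ContDiffBump.tsupport_normed_eq, Metric.mem_closedBall, Real.dist_eq, sub_zero] at hz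
  refine hz.trans (div_le_self hδ.le ?_)
  have : (0 : ℝ) ≤ j := j.cast_nonneg
  linarith

theorem tendsto_moll {f : ℝ → TDist d} (hf : WeakLocInt univ f) {δ : ℝ} (hδ : 0 < δ) {x : ℝ}
    {φ : TestSpace d} (hc : ContinuousAt (fun y => f y φ) x) :
    Tendsto (fun j => moll ((shrinkingBump hδ j).normed volume) f x φ) atTop (𝓝 (f x φ)) := by
  simp only [moll_apply_eq_convolution hf (isCutoff_shrinkingBump hδ _)]
  refine ContDiffBump.convolution_tendsto_right (g := fun _ y => f y φ) ?_
    (Eventually.of_forall fun _ => (locallyIntegrableOn_univ.1 (hf φ)).aestronglyMeasurable)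
    (hc.tendsto.comp tendsto_snd) tendsto_const_nhds
  have := (tendsto_one_div_add_atTop_nhds_zero_nat (𝕜 := ℝ)).const_mul δ
  simpa [shrinkingBump, div_eq_mul_inv] using this

/-! ### Uniqueness -/

/-- The boundary operator is continuous under weak convergence. -/
theorem tendsto_boundaryOp {ι : Type*} {l : Filter ι} {a : ι → Fin (d + 1) → TDist d}
    {a₀ : Fin (d + 1) → TDist d} (h : ∀ k φ, Tendsto (fun i => a i k φ) l (𝓝 (a₀ k φ))) (t : ℝ)
    (k : Fin (d + 1)) (φ : TestSpace d) :
    Tendsto (fun i => boundaryOp (a i) t k φ) l (𝓝 (boundaryOp a₀ t k φ)) := by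
  have hlast : ∀ ψ, Tendsto (fun i => boundarySlope (a i) (Fin.last d) ψ) l
      (𝓝 (boundarySlope a₀ (Fin.last d) ψ)) := fun ψ => by
    simp only [boundarySlope_last, LinearMap.sub_apply, absGrad_apply, tdiv, LinearMap.coe_sum,
      Finset.sum_apply]
    exact (h _ _).sub (tendsto_finsetSum _ fun j _ => (h j.castSucc (derivTest j ψ)).neg)
  have hslope : ∀ ψ, Tendsto (fun i => boundarySlope (a i) k ψ) l (𝓝 (boundarySlope a₀ k ψ)) := by
    refine Fin.lastCases hlast (fun k ψ => ?_) k
    simp only [boundarySlope_castSucc]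
    exact (hlast (multTest (rieszSymb k).reflect ψ)).neg
  simp only [boundaryOp_eq, polyCurve_apply]
  exact (h _ _).add ((hslope _).const_mul _)

/-- Mollification yields smooth flows on `((x + b)/2, ∞)`, for which the representation is known; it
is preserved in the weak limit. -/
theorem eq_boundaryOp_of_solvesOn_of_tame_univ {b : ℝ} {w : ℝ → Fin (d + 1) → TDist d}
    {p : ℝ → TDist d} (hw : ∀ k, IsTame univ fun y => w y k)
    (hc : ∀ k φ, ContinuousOn (fun y => w y k φ) (Ioi b)) (hp : WeakLocInt univ p)
    (h : SolvesOn (Ioi b) 0 0 w p) {x : ℝ} (hx : b < x) {t : ℝ} (ht : 0 ≤ t) :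
    w (x + t) = boundaryOp (w x) t := by
  have hδ : 0 < (x - b) / 2 := by linarith
  have hflow := fun j => isSmoothFlow_moll (I := Ioi ((x + b) / 2)) hw hp h
    (isCutoff_shrinkingBump hδ j) fun y hy z hz => by
      have h1 := (le_abs_self z).trans (abs_le_of_mem_tsupport_shrinkingBump hδ hz)
      rw [mem_Ioi] at hy ⊢
      linarith
  have heq := fun j => (hflow j).velocity_add isOpen_Ioi
    (fun y hy z hz => lt_of_lt_of_le hy hz) (x := x) (by rw [mem_Ioi]; linarith) ht
  simp only [iteratedDeriv_zero] at heq
  have hlim : ∀ y, b < y → ∀ k φ, Tendsto (fun j =>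
      moll ((shrinkingBump hδ j).normed volume) (fun y => w y k) y φ) atTop (𝓝 (w y k φ)) :=
    fun y hy k φ => tendsto_moll ((hw k).weakLocInt isOpen_univ) hδ
      ((hc k φ).continuousAt (Ioi_mem_nhds hy))
  ext k φ
  refine tendsto_nhds_unique (hlim (x + t) (by linarith) k φ) ?_
  have h2 := tendsto_boundaryOp (hlim x hx) t k φ
  refine h2.congr fun j => ?_
  rw [← heq j]

theorem IsTame.indicator {I K : Set ℝ} {f : ℝ → TDist d} (hf : IsTame I f) (hKI : K ⊆ I)
    (hK : MeasurableSet K) : IsTame univ (K.indicator f) := by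
  have hfK := hf.mono hKI
  have e : ∀ φ : TestSpace d, (fun y => K.indicator f y φ) = K.indicator fun y => f y φ :=
    fun φ => by
      ext y
      by_cases hy : y ∈ K <;> simp [hy]
  refine ⟨fun φ => ?_, fun r R hr => ?_⟩
  · rw [Measure.restrict_univ, e, aestronglyMeasurable_indicator_iff hK]
    exact hfK.1 φ
  · obtain ⟨N, g, hg0, hg, hb⟩ := hfK.exists_bound hr R
    refine ⟨N, K.indicator g, fun ε hε => ?_, ?_⟩
    · rw [integrableOn_univ]
      refine ((integrable_indicator_iff hK).2 (hg ε hε)).congr (Eventually.of_forall fun y => ?_)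
      by_cases hy : y ∈ K <;> simp [hy]
    · rw [Measure.restrict_univ]
      filter_upwards [(ae_restrict_iff' hK).1 hb] with y hy φ hφ
      by_cases hyK : y ∈ K
      · simpa [hyK] using hy hyK φ hφ
      · simp [hyK]

theorem WeakLocInt.indicator {I K : Set ℝ} {f : ℝ → TDist d} (hf : WeakLocInt I f) (hKI : K ⊆ I)
    (hK : IsClosed K) : WeakLocInt univ (K.indicator f) := fun φ => by
  have e : (fun y => K.indicator f y φ) = K.indicator fun y => f y φ := by
    ext y
    by_cases hy : y ∈ K <;> simp [hy]
  rw [e, locallyIntegrableOn_iff isOpen_univ.isLocallyClosed]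
  intro C _ hC
  rw [IntegrableOn, integrable_indicator_iff hK.measurableSet, IntegrableOn,
    Measure.restrict_restrict hK.measurableSet]
  exact (hf φ).integrableOn_compact_subset (inter_subset_left.trans hKI) (hC.inter_left hK)

/-- A solution of the homogeneous system in a half space is the boundary flow of its values on each
interior hyperplane. -/
theorem eq_boundaryOp_of_solvesOn {b : ℝ} {w : ℝ → Fin (d + 1) → TDist d}
    {p : ℝ → TDist d} (hw : ∀ k, IsTame (Ioi b) fun y => w y k)
    (hc : ∀ k φ, ContinuousOn (fun y => w y k φ) (Ioi b)) (hp : WeakLocInt (Ioi b) p)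
    (h : SolvesOn (Ioi b) 0 0 w p) {x : ℝ} (hx : b < x) {t : ℝ} (ht : 0 ≤ t) :
    w (x + t) = boundaryOp (w x) t := by
  -- the curves are cut off below `c`, which makes them tame on the whole line
  set c := (x + b) / 2 with hcdef
  have hcx : c < x := by linarith
  have hKI : Ici c ⊆ Ioi b := fun y hy => lt_of_lt_of_le (by linarith) (mem_Ici.1 hy)
  have hin : ∀ y, c < y → (Ici c).indicator w y = w y := fun y hy =>
    indicator_of_mem (mem_Ici.2 hy.le) w
  have hcomp : ∀ k, (fun y => (Ici c).indicator w y k) = (Ici c).indicator fun y => w y k :=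
    fun k => by
      ext y : 1
      by_cases hy : y ∈ Ici c <;> simp only [indicator_of_mem, indicator_of_notMem, hy,
        not_false_eq_true, Pi.zero_apply]
  have h1 := eq_boundaryOp_of_solvesOn_of_tame_univ (b := c) (w := (Ici c).indicator w)
    (p := (Ici c).indicator p) (fun k => ?_) (fun k φ => ?_) (hp.indicator hKI isClosed_Ici)
    ((h.mono (Ioi_subset_Ici_self.trans hKI)).congr (fun _ _ => rfl)
      (fun y hy => (hin y hy).symm)
      fun y hy => (indicator_of_mem (mem_Ici.2 (mem_Ioi.1 hy).le) p).symm) hcx ht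
  · rwa [hin _ hcx, hin _ (by linarith)] at h1
  · rw [hcomp]
    exact (hw k).indicator hKI measurableSet_Ici
  · refine ((hc k φ).mono (Ioi_subset_Ici_self.trans hKI)).congr fun y hy => ?_
    rw [hin y hy]

/-- Uniqueness in the whole space: mollifications of the difference vanish. -/
theorem IsWholeSpaceSolution.velocity_eq {G : ℝ → Fin (d + 1) → Fin (d + 1) → TDist d}
    (hG : ∀ k l, IsTame univ fun y => G y k l) {u u' : ℝ → Fin (d + 1) → TDist d}
    {p p' : ℝ → TDist d} (h : IsWholeSpaceSolution G u p) (h' : IsWholeSpaceSolution G u' p') :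
    u = u' := by
  obtain ⟨h1, h2, h3, h4⟩ := h
  obtain ⟨h1', h2', h3', h4'⟩ := h'
  have hI := isOpen_univ (X := ℝ)
  have hp := (h3.weakLocInt hI).sub (h3'.weakLocInt hI)
  have hw : ∀ k, IsTame univ fun y => (u - u') y k := fun k => (h1 k).sub (h1' k)
  have hs := h4.sub h4' (fun k l => (hG k l).weakLocInt hI) (fun k l => (hG k l).weakLocInt hI)
    (fun k => (h1 k).weakLocInt hI) (fun k => (h1' k).weakLocInt hI) (h3.weakLocInt hI)
    (h3'.weakLocInt hI)
  rw [sub_self] at hs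
  rw [← sub_eq_zero]
  ext x k φ
  have hlim := tendsto_moll ((hw k).weakLocInt hI) one_pos (x := x) (φ := φ)
    (((h2 k φ).continuousAt univ_mem).sub ((h2' k φ).continuousAt univ_mem))
  refine tendsto_nhds_unique hlim (tendsto_const_nhds.congr fun j => ?_)
  have hz := (isSmoothFlow_moll (I := univ) hw hp hs (isCutoff_shrinkingBump one_pos j)
    fun _ _ _ _ => mem_univ _).velocity_eq_zero x
  have hzk := congrArg (fun T => T φ) (congrFun hz k)
  simp only [iteratedDeriv_zero] at hzk
  exact hzk.symm

/-- Uniqueness in the half space. -/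
theorem IsHalfSpaceSolution.velocity_eq {a : Fin (d + 1) → TDist d}
    {F : ℝ → Fin (d + 1) → Fin (d + 1) → TDist d} (hF : ∀ k l, IsTame (Ioi 0) fun y => F y k l)
    {u u' : ℝ → Fin (d + 1) → TDist d} {p p' : ℝ → TDist d} (h : IsHalfSpaceSolution a 0 F u p)
    (h' : IsHalfSpaceSolution a 0 F u' p') {x : ℝ} (hx : 0 < x) : u x = u' x := by
  obtain ⟨⟨h1, h2, h3, h4⟩, h5⟩ := h
  obtain ⟨⟨h1', h2', h3', h4'⟩, h5'⟩ := h'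
  have hI := isOpen_Ioi (a := (0 : ℝ))
  have hp := (h3.weakLocInt hI).sub (h3'.weakLocInt hI)
  have hw : ∀ k, IsTame (Ioi 0) fun y => (u - u') y k := fun k => (h1 k).sub (h1' k)
  have hc : ∀ k φ, ContinuousOn (fun y => (u - u') y k φ) (Ioi 0) := fun k φ =>
    (h2 k φ).sub (h2' k φ)
  have hs := h4.sub h4' (fun k l => (hF k l).weakLocInt hI) (fun k l => (hF k l).weakLocInt hI)
    (fun k => (h1 k).weakLocInt hI) (fun k => (h1' k).weakLocInt hI) (h3.weakLocInt hI)
    (h3'.weakLocInt hI)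
  rw [sub_self] at hs
  have h0 : ∀ k φ, Tendsto (fun y => (u - u') y k φ) (𝓝[>] 0)
      (𝓝 ((0 : Fin (d + 1) → TDist d) k φ)) := fun k φ => by
    have := (h5 k φ).sub (h5' k φ)
    rw [sub_self] at this
    exact this
  rw [← sub_eq_zero]
  ext k φ
  -- `(u - u')(y + x)` is the boundary flow of `(u - u')(y)` at height `x`; now `y ↓ 0`
  have hl : Tendsto (fun y => (u - u') (y + x) k φ) (𝓝[>] 0) (𝓝 ((u - u') x k φ)) := by
    have hcx : ContinuousAt (fun y => (u - u') y k φ) (0 + x) := by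
      rw [zero_add]
      exact (hc k φ).continuousAt (Ioi_mem_nhds hx)
    have := (hcx.comp (f := fun y => y + x) (by fun_prop)).tendsto
    simp only [Function.comp_def, zero_add] at this
    exact this.mono_left nhdsWithin_le_nhds
  have hr := tendsto_boundaryOp h0 x k φ
  have hz : boundaryOp (0 : Fin (d + 1) → TDist d) x = 0 := by
    simpa using boundaryOp_sub (0 : Fin (d + 1) → TDist d) 0 x
  rw [hz] at hr
  refine tendsto_nhds_unique hl (hr.congr' ?_)
  filter_upwards [self_mem_nhdsWithin] with y hy
  rw [eq_boundaryOp_of_solvesOn hw hc hp hs hy hx.le]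

end HalfSpaceStokes

end

open HalfSpaceStokes

theorem mainTheorem3 (d : ℕ) (hd : 1 ≤ d)
    (a : Fin (d + 1) → TDist d) (ha : ∀ k, IsDistribution (a k))
    (F : ℝ → Fin (d + 1) → Fin (d + 1) → TDist d)
    (hF : ∀ k l, IsTame (Set.Ioi 0) fun y => F y k l) :
    -- the whole-space problem with the reflected force is uniquely solved by `uWhole F`
    ((∃ p, IsWholeSpaceSolution (extendForce F) (uWhole F) p) ∧
      ∀ w p, IsWholeSpaceSolution (extendForce F) w p → w = uWhole F) ∧
    -- the half-space Stokes problem is uniquely solved by `boundaryOp a + forceOp F`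
    ((∃ p, IsHalfSpaceSolution a 0 F (fun x => boundaryOp a x + forceOp F x) p) ∧
      ∀ u p, IsHalfSpaceSolution a 0 F u p →
        ∀ x, 0 < x → u x = boundaryOp a x + forceOp F x) ∧
    -- the half-space Navier-Stokes problem is equivalent to the integral equation
    ∀ v : ℝ → Fin (d + 1) → Tang d → ℂ, IsAdmissible v →
      ((∃ p, IsHalfSpaceSolution a (selfTensor v) F (velocity v) p) ↔
        ∀ x, 0 < x → velocity v x = boundaryOp a x + forceOp (F - selfTensor v) x) := by
  refine ⟨⟨⟨_, isWholeSpaceSolution_uWhole hF⟩, fun w p h => h.velocity_eq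
    (isTame_extendForce hF) (isWholeSpaceSolution_uWhole hF)⟩,
    ⟨⟨_, isHalfSpaceSolution_formula ha hF⟩, fun u p h x hx => h.velocity_eq hF
      (isHalfSpaceSolution_formula ha hF) hx⟩, fun v hv => ?_⟩
  have hN := hv.2.2
  have hFN : ∀ k l, IsTame (Set.Ioi 0) fun y => (F - selfTensor v) y k l := fun k l =>
    (hF k l).sub (hN k l)
  have hformula := isHalfSpaceSolution_formula ha hFN
  constructor
  · rintro ⟨p, hp⟩ x hx
    exact ((isHalfSpaceSolution_iff_sub hN hF).1 hp).velocity_eq hFN hformula hx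
  · intro h
    exact ⟨_, (isHalfSpaceSolution_iff_sub hN hF).2
      (hformula.congr fun y hy => (h y hy).symm)⟩
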